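/- Let $\mathcal O$ be a complete discrete valuation ring with fraction field $E$, and let $B$ be a complete Noetherian local $\mathcal O$-algebra with $\dim B=1$ and with an augmentation, i.e. an $\mathcal O$-algebra homomorphism $\pi_B:B\to\mathcal O$, such that the cotangent space $\Phi(B)=\ker(\pi_B)/\ker(\pi_B)^2$ is an $\mathcal O$-module of finite length. Write $\ell$ for the length of an $\mathcal O$-module, and regard $E/\mathcal O$ as a $B$-module through $\pi_B$. Let $\mathrm{Der}^i_{\mathcal O}(B,E/\mathcal O)$ denote André–Quillen cohomology. Let $C$ be the largest Cohen–Macaulay quotient of $B$ (the quotient of $B$ by the ideal of elements killed by a power of the maximal ideal), with induced augmentation $\pi_C$, and put $$c_0(B)=\ell\bigl(\mathcal O/\pi_C(\mathrm{Ann}_C(\ker\pi_C))\bigr).$$ A complete intersection cover of $B$ is a surjection of $\mathcal O$-algebras $\varphi:A\to B$ where $A$ is the quotient of a power series ring $\mathcal O[[x_1,\dots,x_n]]$ by a regular sequence, $\dim A=1$, and the augmentation $\pi_A=\pi_B\circ\varphi$ has a cotangent space $\ker(\pi_A)/\ker(\pi_A)^2$ of finite length. Given generators $\mathbf x=(x_1,\dots,x_\delta)$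 of $J=\ker\varphi$, let $K_A(\mathbf x)$ be the Koszul complex, let $H_\delta(K_A(\mathbf x))_1\subseteq H_\delta(K_A(\mathbf x))$ be the $A$-submodule generated by the products of elements of $H_1(K_A(\mathbf x))$, and let $\pi_{A,*}$ be the map induced by $\pi_A$ from $H_\delta(K_A(\mathbf x))$ to $H_\delta(K_{\mathcal O}(0,\dots,0))=\bigwedge^\delta\mathcal O^\delta\cong\mathcal O$. Put $$c_1(B)=\ell\bigl(\pi_{A,*}H_\delta(K_A(\mathbf x))\,/\,\pi_{A,*}(H_\delta(K_A(\mathbf x))_1)\bigr),\qquad C_1=\pi_A(\mathrm{Ann}_A(J))/\pi_A(\mathrm{Fitt}_A(J)),$$ where $\mathrm{Fitt}_A(J)$ is the zeroth Fitting ideal. Then: 1. A complete intersection cover of $B$ exists, and if $B$ is finite over $\mathcal O$ then $A$ can be chosen finite and free over $\mathcal O$. 2. $c_0(B)$, $\ell(\mathrm{Der}^0_{\mathcal O}(B,E/\mathcal O))$ and $\ell(\mathrm{Der}^1_{\mathcal O}(B,E/\mathcal O))$ are finite, and for every complete intersection cover and all generators $\mathbf x$ of $J$ the number $c_1(B)$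 is finite, $c_1(B)=\ell(C_1)$, and $$c_0(B)-c_1(B)=\ell(\mathrm{Der}^0_{\mathcal O}(B,E/\mathcal O))-\ell(\mathrm{Der}^1_{\mathcal O}(B,E/\mathcal O)).$$ In particular $c_1(B)$ does not depend on the choices. 3. Suppose moreover that $\mathcal O$ has characteristic zero and finite residue field of characteristic $p$, and that $B$ is finite over $\mathcal O$. Let $B^{\mathrm{tf}}$ be the largest $\mathcal O$-torsion-free quotient of $B$, with induced augmentation $\lambda$, let $\Psi(B)=\mathcal O/\lambda(\mathrm{Ann}(\ker\lambda))$ and let $\delta(B)=(\ell(\Phi(B))-\ell(\Psi(B)))/\ell(\mathcal O/p)$ be the Wiles defect. Then for every complete intersection cover and all generators $\mathbf x$ the groups $\mathrm{Der}^1_{\mathcal O}(B,E/\mathcal O)$, $C_1$, $\Phi(B)$, $\Psi(B)$ are finite, and $$\frac{|\mathrm{Der}^1_{\mathcal O}(B,E/\mathcal O)|}{|C_1|}=\frac{|\Phi(B)|}{|\Psi(B)|},$$ $$\delta(B)=\frac{\log|\mathrm{Der}^1_{\mathcal O}(B,E/\mathcal O)|-\log|C_1|}{\log|\mathcal O/p|}=\frac{\ell(\mathrm{Der}^1_{\mathcal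 O}(B,E/\mathcal O))-\ell(C_1)}{\ell(\mathcal O/p)}.$$ -/

import Mathlib

open IsLocalRing

universe u v w

noncomputable section

namespace WilesDefect

/-! ### The coefficient module `E/O` -/

section Coefficients

variable {O : Type u} {B : Type v} [CommRing O] [CommRing B] [Algebra O B]

/-- The `O`-module `E/O`, where `E` is the field of fractions of `O`. The (unused) argument `π`
records the augmentation `π : B → O` through which `B` acts on it. -/
def EModO (_π : B →ₐ[O] O) : Type u :=
  FractionRing O ⧸ LinearMap.range (Algebra.linearMap O (FractionRing O))

instance (π : B →ₐ[O] O) : AddCommGroup (EModO π) :=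
  inferInstanceAs (AddCommGroup
    (FractionRing O ⧸ LinearMap.range (Algebra.linearMap O (FractionRing O))))

instance (π : B →ₐ[O] O) : Module O (EModO π) :=
  inferInstanceAs (Module O
    (FractionRing O ⧸ LinearMap.range (Algebra.linearMap O (FractionRing O))))

/-- `b : B` acts on `E/O` as multiplication by `π b`. -/
instance (π : B →ₐ[O] O) : Module B (EModO π) :=
  Module.compHom (EModO π) π.toRingHom

theorem EModO.smul_def (π : B →ₐ[O] O) (b : B) (m : EModO π) : b • m = π b • m := rfl

instance (π : B →ₐ[O] O) : IsScalarTower O B (EModO π) :=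
  ⟨fun r b m => by simp only [EModO.smul_def, map_smul, smul_assoc]⟩

end Coefficients

/-! ### André–Quillen cohomology in degrees `0` and `1` -/

section AndreQuillen

variable (R : Type u) (S : Type v) [CommRing R] [CommRing S] [Algebra R S]
  (M : Type w) [AddCommGroup M] [Module R M] [Module S M] [IsScalarTower R S M]

/-- `Der⁰_R(S, M)`: the `R`-linear derivations from `S` to `M`. -/
abbrev Der0 : Type _ := Derivation R S M

/-- The coboundary map of `Hom_S(L, M)` from degree `0` to degree `1`, where
`L = (I/I² → S ⊗ Ω[P/R])`, `P = R[S]` is the polynomial ring on the set `S` and `I = ker (P → S)`,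
is the truncation of the cotangent complex of `R → S` in (homological) degrees `0` and `1`. -/
def derCoboundary :
    ((Algebra.Generators.self R S).toExtension.CotangentSpace →ₗ[S] M) →ₗ[R]
      ((Algebra.Generators.self R S).toExtension.Cotangent →ₗ[S] M) :=
  LinearMap.lcomp R M (Algebra.Generators.self R S).toExtension.cotangentComplex

/-- `Der¹_R(S, M) = H¹(Hom_S(L_{S/R}, M))`, the first André–Quillen cohomology module. As
`H¹` only depends on the truncation of the cotangent complex in degrees `0` and `1`, it
is the cokernel of `Hom_S(S ⊗ Ω[P/R], M) → Hom_S(I/I², M)`. -/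
abbrev Der1 : Type _ :=
  ((Algebra.Generators.self R S).toExtension.Cotangent →ₗ[S] M) ⧸
    LinearMap.range (derCoboundary R S M)

end AndreQuillen

/-! ### Cotangent spaces, congruence modules, the largest Cohen–Macaulay quotient -/

section Augmented

variable {O : Type u} {B : Type v} [CommRing O] [CommRing B] [Algebra O B]

/-- The cotangent space `Φ = ker π / (ker π)²` of an augmentation `π : B → O`. -/
abbrev CotSpace (π : B →ₐ[O] O) : Type _ := (RingHom.ker π).Cotangent

/-- The ideal `π (Ann_B (ker π))` of `O` (the map `π` is surjective). -/
def congruenceIdeal (π : B →ₐ[O] O) : Ideal O :=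
  (RingHom.ker π).annihilator.map π

/-- The augmentation of `B ⧸ J` induced by an augmentation of `B` that vanishes on `J`. -/
def quotAug (π : B →ₐ[O] O) (J : Ideal B) (hJ : J ≤ RingHom.ker π) : (B ⧸ J) →ₐ[O] O :=
  Ideal.Quotient.liftₐ J π hJ

/-- The ideal of all elements of a local ring `B` killed by a power of the maximal ideal. For a
one-dimensional Noetherian local ring, `B ⧸ cmKernel B` is the largest
Cohen–Macaulay quotient (of dimension one) of `B`, see `cmKernel_isLeast`. -/
def cmKernel (B : Type v) [CommRing B] [IsLocalRing B] : Ideal B where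
  carrier := {b | ∃ n : ℕ, ∀ a ∈ maximalIdeal B ^ n, a * b = 0}
  zero_mem' := ⟨0, fun a _ => mul_zero a⟩
  add_mem' := by
    rintro b c ⟨n, hn⟩ ⟨m, hm⟩
    refine ⟨n + m, fun a ha => ?_⟩
    rw [mul_add, hn a (Ideal.pow_le_pow_right (Nat.le_add_right n m) ha),
      hm a (Ideal.pow_le_pow_right (Nat.le_add_left m n) ha), add_zero]
  smul_mem' := by
    rintro c b ⟨n, hn⟩
    refine ⟨n, fun a ha => ?_⟩
    rw [smul_eq_mul, mul_left_comm, hn a ha, mul_zero]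

/-- Among the ideals `I` of a one-dimensional Noetherian local ring `B` such that `B ⧸ I` is
Cohen–Macaulay of dimension one (that is, of dimension one and of depth at least one), `cmKernel B`
is the smallest. -/
theorem cmKernel_isLeast (B : Type v) [CommRing B] [IsLocalRing B] [IsNoetherianRing B]
    (hB : ringKrullDim B = 1) :
    IsLeast {I : Ideal B | ringKrullDim (B ⧸ I) = 1 ∧
      ∃ x ∈ maximalIdeal B, Ideal.Quotient.mk I x ∈ nonZeroDivisors (B ⧸ I)} (cmKernel B) := by
  have hmem : ∀ b, b ∈ cmKernel B ↔ ∃ n : ℕ, ∀ a ∈ maximalIdeal B ^ n, a * b = 0 := fun b => Iff.rfl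
  constructor
  · constructor
    · apply le_antisymm
      · rw [← hB]
        exact ringKrullDim_quotient_le _
      · have hlt : 0 < ringKrullDim B := by rw [hB]; exact zero_lt_one
        obtain ⟨P, hP, hPm⟩ : ∃ P : Ideal B, P.IsPrime ∧ P ≠ maximalIdeal B := by
          by_contra! hcon
          have : Ring.KrullDimLE 0 B := by
            rw [Ring.krullDimLE_zero_iff]
            intro I hI
            rw [hcon I hI]
            infer_instance
          have h0 := (Ring.krullDimLE_iff (n := 0) (R := B)).mp this
          exact absurd h0 (not_le.mpr (by simpa using hlt))
        have hle : cmKernel B ≤ P := by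
          rintro b ⟨n, hn⟩
          obtain ⟨t, ht, htP⟩ : ∃ t ∈ maximalIdeal B, t ∉ P := by
            by_contra! h
            exact hPm (le_antisymm (le_maximalIdeal hP.ne_top) h)
          have h := hn _ (Ideal.pow_mem_pow ht n)
          have h2 : t ^ n * b ∈ P := by rw [h]; exact P.zero_mem
          exact (hP.mem_or_mem h2).resolve_left (fun h3 => htP (hP.mem_of_pow_mem _ h3))
        have h1 : ringKrullDim (B ⧸ P) ≤ ringKrullDim (B ⧸ cmKernel B) :=
          ringKrullDim_le_of_surjective (Ideal.Quotient.factor hle)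
            (Ideal.Quotient.factor_surjective hle)
        refine le_trans ?_ h1
        have hdom : IsDomain (B ⧸ P) := Ideal.Quotient.isDomain P
        by_contra hcon
        have : Ring.KrullDimLE 0 (B ⧸ P) := by
          rw [Ring.krullDimLE_iff]
          exact ENat.WithBot.lt_add_one_iff.mp (not_le.mp hcon)
        have hf : IsField (B ⧸ P) := Ring.KrullDimLE.isField_of_isDomain
        exact hPm (IsLocalRing.eq_maximalIdeal (Ideal.Quotient.maximal_of_isField P hf))
    · by_contra! hcon
      have hsurj := Ideal.Quotient.mk_surjective (I := cmKernel B)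
      have hdisj : Disjoint (((maximalIdeal B).map (Ideal.Quotient.mk (cmKernel B)) :
          Ideal (B ⧸ cmKernel B)) : Set (B ⧸ cmKernel B))
          (nonZeroDivisors (B ⧸ cmKernel B)) := by
        rw [Set.disjoint_left]
        intro y hy
        obtain ⟨x, hx, rfl⟩ := (Ideal.mem_map_iff_of_surjective _ hsurj).mp hy
        exact hcon x hx
      obtain ⟨-, y, hy, hy0⟩ := SetLike.lt_iff_le_and_exists.mp
        (Ideal.bot_lt_annihilator_of_disjoint_nonZeroDivisors hdisj)
      obtain ⟨b, rfl⟩ := hsurj y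
      have hab : ∀ a ∈ maximalIdeal B, a * b ∈ cmKernel B := by
        intro a ha
        have h := Submodule.mem_annihilator.mp hy _ (Ideal.mem_map_of_mem _ ha)
        rw [smul_eq_mul, ← map_mul, mul_comm] at h
        exact Ideal.Quotient.eq_zero_iff_mem.mp h
      apply hy0
      rw [Submodule.mem_bot]
      apply Ideal.Quotient.eq_zero_iff_mem.mpr
      obtain ⟨s, hs⟩ := (isNoetherianRing_iff_ideal_fg B).mp inferInstance (maximalIdeal B)
      have hsm : ∀ a ∈ s, a ∈ maximalIdeal B := fun a ha => hs ▸ Ideal.subset_span ha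
      choose! f hf using fun a (ha : a ∈ s) => (hmem _).mp (hab a (hsm a ha))
      have hN : ∀ a ∈ maximalIdeal B, ∀ c ∈ maximalIdeal B ^ s.sup f, c * (a * b) = 0 := by
        intro a ha c hc
        have ha' : a ∈ Submodule.span B (s : Set B) := hs.ge ha
        induction ha' using Submodule.span_induction with
        | mem a h => exact hf a h c (Ideal.pow_le_pow_right (Finset.le_sup h) hc)
        | zero => ring
        | add a a' h h' e e' =>
          have h1 := e (hs.le h)
          have h2 := e' (hs.le h')
          linear_combination h1 + h2
        | smul r a h e =>
          have h1 := e (hs.le h)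
          rw [smul_eq_mul]
          linear_combination r * h1
      refine (hmem b).mpr ⟨s.sup f + 1, fun c hc => ?_⟩
      rw [pow_succ] at hc
      induction hc using Submodule.mul_induction_on' with
      | mem_mul_mem c hc a ha => rw [mul_assoc]; exact hN a ha c hc
      | add c _ c' _ h h' => rw [add_mul, h, h', add_zero]
  · rintro I ⟨-, x, hx, hxI⟩ b ⟨n, hn⟩
    have h := congrArg (Ideal.Quotient.mk I) (hn _ (Ideal.pow_mem_pow hx n))
    rw [map_mul, map_pow, map_zero] at h
    have h2 := (mul_left_mem_nonZeroDivisors_eq_zero_iff (pow_mem hxI n)).mp h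
    exact Ideal.Quotient.eq_zero_iff_mem.mp h2

theorem cmKernel_le_ker [IsDomain O] [IsDiscreteValuationRing O] [IsLocalRing B]
    (π : B →ₐ[O] O) : cmKernel B ≤ RingHom.ker π := by
  rintro b ⟨n, hn⟩
  obtain ⟨t, ht⟩ := IsDiscreteValuationRing.exists_irreducible O
  have htm : algebraMap O B t ∈ maximalIdeal B := by
    rw [mem_maximalIdeal, mem_nonunits_iff]
    intro h
    have := h.map π
    rw [AlgHom.commutes] at this
    exact ht.not_isUnit this
  have h := congrArg π (hn _ (Ideal.pow_mem_pow htm n))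
  rw [map_mul, map_pow, AlgHom.commutes, map_zero] at h
  exact (mul_eq_zero.mp h).resolve_left (pow_ne_zero _ ht.ne_zero)

/-- `c₀(B)` is the length of this module `O / π_C (Ann_C (ker π_C))`, where `C` is the largest
Cohen–Macaulay quotient of `B` and `π_C` is the augmentation of `C` induced by `π`. -/
abbrev C0 [IsDomain O] [IsDiscreteValuationRing O] [IsLocalRing B] (π : B →ₐ[O] O) : Type _ :=
  O ⧸ congruenceIdeal (quotAug π (cmKernel B) (cmKernel_le_ker π))

/-- The ideal of `O`-torsion elements of `B`. -/
def torsionIdeal (O : Type u) (B : Type v) [CommRing O] [CommRing B] [Algebra O B] : Ideal B :=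
  Submodule.torsion' B B (nonZeroDivisors O)

theorem torsionIdeal_le_ker [IsDomain O] (π : B →ₐ[O] O) :
    torsionIdeal O B ≤ RingHom.ker π := by
  rintro b ⟨⟨r, hr⟩, h⟩
  have h' := congrArg π (show r • b = 0 from h)
  rw [map_smul, map_zero, smul_eq_mul] at h'
  exact (mul_eq_zero.mp h').resolve_left (nonZeroDivisors.ne_zero hr)

/-- The congruence module `Ψ = O / π (Ann (ker π))`, formed for the largest
`O`-torsion-free quotient of `B`. -/
abbrev CongruenceModule [IsDomain O] (π : B →ₐ[O] O) : Type _ :=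
  O ⧸ congruenceIdeal (quotAug π (torsionIdeal O B) (torsionIdeal_le_ker π))

/-- The Wiles defect `δ = (ℓ(Φ) - ℓ(Ψ)) / ℓ(O/p)`. -/
def wilesDefect [IsDomain O] (p : ℕ) (π : B →ₐ[O] O) : ℝ :=
  (((Module.length O (CotSpace π)).toNat : ℝ) - ((Module.length O (CongruenceModule π)).toNat : ℝ)) /
    ((Module.length O (O ⧸ Ideal.span {(p : O)})).toNat : ℝ)

end Augmented

/-! ### Complete intersection covers -/

section Covers

variable {O : Type u} {B : Type v} {A : Type w} [CommRing O] [CommRing B] [Algebra O B]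
  [CommRing A] [Algebra O A]

/-- A complete intersection cover `φ : A → B` of an augmented `O`-algebra `π : B → O`: a
surjection of `O`-algebras, where `A` is a quotient of a power series ring
`O[[x₁, …, xₙ]]` by a regular sequence, `dim A = 1`, and the augmentation `π ∘ φ` of `A` has a
cotangent space of finite length. -/
structure IsCICover (π : B →ₐ[O] O) (φ : A →ₐ[O] B) : Prop where
  surjective : Function.Surjective φ
  completeIntersection : ∃ (n : ℕ) (ψ : MvPowerSeries (Fin n) O →ₐ[O] A)
    (rs : List (MvPowerSeries (Fin n) O)), Function.Surjective ψ ∧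
      RingTheory.Sequence.IsRegular (MvPowerSeries (Fin n) O) rs ∧
      RingHom.ker ψ = Ideal.ofList rs
  dim_eq_one : ringKrullDim A = 1
  finite_cotSpace : IsFiniteLength O (CotSpace (π.comp φ))

end Covers

/-! ### The Koszul complex and `c₁` -/

section Koszul

variable {A : Type w} [CommRing A] {d : ℕ}

/-- The differential of the Koszul complex `K_A(x)`, whose underlying algebra is the exterior
algebra of `A^d`: contraction with the linear form `v ↦ ∑ vᵢ xᵢ`. -/
def koszulD (x : Fin d → A) :
    ExteriorAlgebra A (Fin d → A) →ₗ[A] ExteriorAlgebra A (Fin d → A) :=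
  CliffordAlgebra.contractLeft (Fintype.linearCombination A x)

/-- The cycles of degree `i` in the Koszul complex `K_A(x)`. -/
def koszulCycles (x : Fin d → A) (i : ℕ) : Submodule A (ExteriorAlgebra A (Fin d → A)) :=
  LinearMap.ker (koszulD x) ⊓ ⋀[A]^i (Fin d → A)

/-- The top homology `H_d(K_A(x))`; there are no boundaries in degree `d`, because
`⋀^(d+1) A^d = 0`. -/
def koszulTop (x : Fin d → A) : Submodule A (ExteriorAlgebra A (Fin d → A)) :=
  koszulCycles x d

/-- The submodule `H_d(K_A(x))₁` of `H_d(K_A(x))` generated by the products of elements of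
`H_1(K_A(x))`, computed on cycles. -/
def koszulTopProducts (x : Fin d → A) : Submodule A (ExteriorAlgebra A (Fin d → A)) :=
  Submodule.span A
    {ω | ∃ z : Fin d → ExteriorAlgebra A (Fin d → A),
      (∀ j, z j ∈ koszulCycles x 1) ∧ ω = (List.ofFn z).prod}

/-- The map of Koszul algebras induced by a ring homomorphism `f : A → O`: it is `f` on scalars
and sends `v ∈ A^d` to `f ∘ v ∈ O^d`. -/
def koszulMap {O : Type u} [CommRing O] (f : A →+* O) (d : ℕ) :
    ExteriorAlgebra A (Fin d → A) →+* ExteriorAlgebra O (Fin d → O) :=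
  letI : Algebra A O := f.toAlgebra
  (ExteriorAlgebra.lift A
    ⟨((ExteriorAlgebra.ι O).restrictScalars A).comp
        ((Algebra.linearMap A O).compLeft (Fin d)), fun v => by simp⟩).toRingHom

variable {O : Type u} [CommRing O] [Algebra O A]

/-- The `O`-submodule of `H_d(K_O(0)) = ⋀^d O^d` (which is free of rank one) generated by the
image of a submodule of `H_d(K_A(x))`. (When the augmentation `π` kills all `xᵢ`, the Koszul
complex of the images of the `xᵢ` in `O` has zero differential.) -/
def koszulImage (π : A →ₐ[O] O) (N : Submodule A (ExteriorAlgebra A (Fin d → A))) :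
    Submodule O (ExteriorAlgebra O (Fin d → O)) :=
  Submodule.span O (koszulMap (π : A →+* O) d '' (N : Set (ExteriorAlgebra A (Fin d → A))))

/-- `c₁`, computed from the augmented ring `π : A → O` and the generators `x` of the kernel of
`A → B`: the length of `π_* H_d(K_A(x)) / π_* (H_d(K_A(x))₁)`. -/
def c1 (π : A →ₐ[O] O) (x : Fin d → A) : ℕ∞ :=
  Module.length O (↥(koszulImage π (koszulTop x)) ⧸
    (koszulImage π (koszulTopProducts x)).submoduleOf (koszulImage π (koszulTop x)))

/-- The (zeroth) Fitting ideal of the ideal generated by `x₁, …, x_d`: it is generated by the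
determinants of all `d × d` matrices whose rows are relations between `x₁, …, x_d`. -/
def fittingIdeal (x : Fin d → A) : Ideal A :=
  Ideal.span {r | ∃ V : Matrix (Fin d) (Fin d) A, V.mulVec x = 0 ∧ r = V.det}

/-- Venkatesh's module `C₁ = π (A[I]) / π (Fitt I)`, where `I` is the ideal of `A` generated by
`x₁, …, x_d` and `A[I]` is its annihilator. -/
abbrev C1 (π : A →ₐ[O] O) (x : Fin d → A) : Type _ :=
  ↥((Ideal.span (Set.range x)).annihilator.map π) ⧸
    Submodule.submoduleOf ((fittingIdeal x).map π) ((Ideal.span (Set.range x)).annihilator.map π)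

end Koszul

end WilesDefect

end

open WilesDefect

/-!
Let `J` be the kernel of a complete intersection cover `φ : A → B`, and let `χ = π ∘ φ` be the
augmentation of `A`. The formula for `c₀ - c₁` compares two computations of lengths over `A`.

*Derivations.* `Der⁰` and `Der¹` with values in `E/O` are described by derivations along an
augmentation (`AugDer`) and by `O`-linear maps on an ideal that are semilinear for the augmentation
(`AugHom`). The transitivity sequence of André–Quillen cohomology becomes
`0 → Der⁰(B) → Der⁰(A) → Hom(J, E/O) → Der¹(B) → 0`; it ends there because `Der¹(A, E/O) = 0`.
This vanishing (`exists_augDer_extend`) is elementary. Extending a homomorphism from the kernel of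
a presentation to a derivation amounts to solving a linear system whose matrix is the Jacobian matrix
of the relations of `A`. Its determinant is nonzero in `O`, as the cotangent space has finite length,
and `E/O` is divisible. Taking lengths gives `length_der_one_add_length_augDer`.

The module `Hom(J, E/O)` has the length of `O/χ(Fitt J)` (`length_augHom`, by the Smith normal form
of the relations between generators of `J`, reduced along `χ`). Applied to the ideal `ker χ` this
also computes `Der⁰(A)`: by Wiebe's theorem (`CIPresentation.annihilator_ker`) the annihilator of
`ker χ` is generated by the Jacobian determinant, so `ℓ(Der⁰(A)) = ℓ(O/χ(Ann (ker χ)))`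
(`CIPresentation.length_augDer`).

*Duality.* As `A` is Gorenstein of dimension one, ideals of the form `Ann I` are reflexive in a
sense explicit enough to show that `χ(Ann (ker χ))` is the product of `χ(Ann J)` and of the congruence
ideal of the largest Cohen–Macaulay quotient of `B` (`congruenceIdeal_eq_mul`). Hence
`ℓ(Der⁰(A)) = c₀ + ℓ(O/χ(Ann J))`, and together with `C₁ = χ(Ann J)/χ(Fitt J)` the two computations
give `IsCICover.length_formula`. The top Koszul homology of generators of `J` is `Ann J`, and the
products of classes of degree one are the determinants of matrices of relations, that is, `Fitt J`;
so the Koszul definition of `c₁` agrees with the length of `C₁` (`c1_eq_length_C1`).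

*Existence of covers.* Present `B` as a quotient of `R = O[[x₁, …, xₙ]]` and let `ξᵢ` be the variables,
translated into the kernel of the augmentation. If `c ≠ 0` kills the cotangent space, the elements
`c ξᵢ` lift to relations of `B` modulo the square of `(ξ₁, …, ξₙ)`. Adding elements of the product of
that ideal with the ideal of relations makes them a regular sequence: a sequence of length `n` can be
so corrected, by prime avoidance, because `R` has depth `n + 1` and the primes that contain the product
have dimension at most one (`exists_add_isWeaklyRegular`). The correction does not change the
Jacobian matrix, which is `c` times the identity, so the cotangent space of the quotient has finite
length (`exists_isCICover`). If `B` is finite over `O`, the same argument modulo a uniformizer of `O`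
makes the relations regular on `R/t`, and the quotient is finite and free over `O`
(`exists_isCICover_finite_free`).

*The Wiles defect.* If `B` is finite over `O`, the torsion ideal is the ideal of elements killed by a
power of the maximal ideal (`torsionIdeal_eq_cmKernel`), so that `ℓ(Ψ(B)) = c₀`, and
`ℓ(Der⁰(B)) = ℓ(Φ(B))` by duality (`length_derZero`). The cardinalities follow, because a module of
length `m` has `q ^ m` elements, where `q` is the order of the residue field.
-/

noncomputable section

namespace WilesDefect

/-! ### Regular sequences modulo an ideal -/

section RegularSequences

open RingTheory.Sequence

variable {R : Type*} [CommRing R]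

theorem ofList_ofFn {n : ℕ} (x : Fin n → R) :
    Ideal.ofList (List.ofFn x) = Ideal.span (Set.range x) := by
  rw [Ideal.ofList]
  congr 1
  ext y
  simp [List.mem_ofFn]

/-- The isomorphism `(R ⧸ b) ⧸ r (R ⧸ b) ≃ R ⧸ (b ⊔ (r))`. -/
def quotSMulTopQuotientEquiv (b : Ideal R) (r : R) :
    QuotSMulTop r (R ⧸ b) ≃ₗ[R] R ⧸ (b ⊔ Ideal.span {r}) :=
  Submodule.quotEquivOfEq _ _ (by
    rw [← Submodule.ideal_span_singleton_smul, ← Submodule.range_mkQ b, ← Submodule.map_top,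
      ← Submodule.map_smul'', smul_eq_mul, Ideal.mul_top]) ≪≫ₗ
  Submodule.quotientQuotientEquivQuotientSup b (Ideal.span {r})

theorem isSMulRegular_quotient_iff (b : Ideal R) (r : R) :
    IsSMulRegular (R ⧸ b) r ↔ ∀ a, a * r ∈ b → a ∈ b := by
  rw [isSMulRegular_iff_right_eq_zero_of_smul]
  constructor
  · intro h a ha
    rw [← Ideal.Quotient.eq_zero_iff_mem]
    apply h
    rw [← Ideal.Quotient.eq_zero_iff_mem, mul_comm] at ha
    rw [← ha, map_mul]
    rfl
  · intro h m hm
    obtain ⟨a, rfl⟩ := Ideal.Quotient.mk_surjective m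
    rw [Ideal.Quotient.eq_zero_iff_mem]
    apply h
    rw [← Ideal.Quotient.eq_zero_iff_mem, mul_comm, map_mul]
    exact hm

theorem isWeaklyRegular_quotient_cons_iff (b : Ideal R) (r : R) (l : List R) :
    IsWeaklyRegular (R ⧸ b) (r :: l) ↔
      (∀ a, a * r ∈ b → a ∈ b) ∧ IsWeaklyRegular (R ⧸ (b ⊔ Ideal.span {r})) l := by
  rw [isWeaklyRegular_cons_iff, isSMulRegular_quotient_iff,
    (quotSMulTopQuotientEquiv b r).isWeaklyRegular_congr]

theorem isWeaklyRegular_quotient_append_iff (b : Ideal R) (l l' : List R) :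
    IsWeaklyRegular (R ⧸ b) (l ++ l') ↔
      IsWeaklyRegular (R ⧸ b) l ∧ IsWeaklyRegular (R ⧸ (b ⊔ Ideal.ofList l)) l' := by
  induction l generalizing b with
  | nil => rw [Ideal.ofList_nil, sup_bot_eq]; simp
  | cons r l ih =>
    rw [List.cons_append, isWeaklyRegular_quotient_cons_iff, isWeaklyRegular_quotient_cons_iff,
      ih, Ideal.ofList_cons, sup_assoc, and_assoc]

theorem isWeaklyRegular_quotient_singleton_iff (b : Ideal R) (r : R) :
    IsWeaklyRegular (R ⧸ b) [r] ↔ ∀ a, a * r ∈ b → a ∈ b := by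
  rw [isWeaklyRegular_quotient_cons_iff]
  simp

theorem isWeaklyRegular_quotient_bot_iff (l : List R) :
    IsWeaklyRegular (R ⧸ (⊥ : Ideal R)) l ↔ IsWeaklyRegular R l :=
  (Submodule.quotEquivOfEqBot (⊥ : Ideal R) rfl).isWeaklyRegular_congr l

/-- Weak regularity modulo an ideal is transported along a surjection. -/
theorem isWeaklyRegular_quotient_comap_iff {S : Type*} [CommRing S] (f : R →+* S)
    (hf : Function.Surjective f) (b : Ideal S) (l : List R) :
    IsWeaklyRegular (R ⧸ b.comap f) l ↔ IsWeaklyRegular (S ⧸ b) (l.map f) := by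
  induction l generalizing b with
  | nil => simp
  | cons r l ih =>
    have h : b.comap f ⊔ Ideal.span {r} = (b ⊔ Ideal.span {f r}).comap f := by
      apply le_antisymm
      · refine sup_le (Ideal.comap_mono le_sup_left) ?_
        rw [Ideal.span_singleton_le_iff_mem]
        exact Ideal.mem_sup_right (Ideal.mem_span_singleton_self _)
      · intro y hy
        obtain ⟨c, hc, d, hd, hcd⟩ := Submodule.mem_sup.mp (Ideal.mem_comap.mp hy)
        obtain ⟨e, rfl⟩ := Ideal.mem_span_singleton'.mp hd
        obtain ⟨e, rfl⟩ := hf e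
        have : y - e * r ∈ b.comap f := by
          rw [Ideal.mem_comap, map_sub, map_mul, ← hcd, add_sub_cancel_right]
          exact hc
        rw [← sub_add_cancel y (e * r)]
        exact Submodule.add_mem_sup this (Ideal.mem_span_singleton'.mpr ⟨e, rfl⟩)
    rw [List.map_cons, isWeaklyRegular_quotient_cons_iff, isWeaklyRegular_quotient_cons_iff, h, ih]
    refine and_congr_left' ⟨fun h a ha => ?_, fun h a ha => h (f a) ?_⟩
    · obtain ⟨a, rfl⟩ := hf a
      exact h a (by rwa [Ideal.mem_comap, map_mul])
    · rwa [Ideal.mem_comap, map_mul] at ha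

/-- Weak regularity modulo `b` only depends on the sequence modulo `b`. -/
theorem IsWeaklyRegular.congr_mod {b : Ideal R} {l l' : List R}
    (h : List.Forall₂ (fun r r' => r - r' ∈ b) l l') (hl : IsWeaklyRegular (R ⧸ b) l) :
    IsWeaklyRegular (R ⧸ b) l' := by
  induction l generalizing b l' with
  | nil => rw [List.forall₂_nil_left_iff.mp h]; simp
  | cons r l ih =>
    obtain ⟨r', l', hr, h', rfl⟩ := List.forall₂_cons_left_iff.mp h
    have hb : b ⊔ Ideal.span {r} = b ⊔ Ideal.span {r'} := by
      apply le_antisymm <;> refine sup_le le_sup_left ?_ <;>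
        rw [Ideal.span_singleton_le_iff_mem]
      · rw [← sub_add_cancel r r']
        exact Submodule.add_mem_sup hr (Ideal.mem_span_singleton_self _)
      · rw [← sub_sub_cancel r r', sub_eq_neg_add]
        exact Submodule.add_mem_sup (neg_mem hr) (Ideal.mem_span_singleton_self _)
    rw [isWeaklyRegular_quotient_cons_iff] at hl ⊢
    refine ⟨fun a ha => hl.1 a ?_, ?_⟩
    · rw [← sub_add_cancel r r', mul_add]
      exact b.add_mem (b.mul_mem_left _ hr) ha
    · rw [← hb]
      exact ih (h'.imp fun _ _ h => Ideal.mem_sup_left h) hl.2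

theorem IsWeaklyRegular.perm_mod [IsLocalRing R] [IsNoetherianRing R] {b : Ideal R}
    {l l' : List R} (hl : IsWeaklyRegular (R ⧸ b) l) (h : l.Perm l')
    (hm : ∀ r ∈ l, r ∈ maximalIdeal R) : IsWeaklyRegular (R ⧸ b) l' :=
  IsLocalRing.isWeaklyRegular_of_perm_of_subset_maximalIdeal hl h hm

/-- The relations between the members of a regular sequence are generated by the Koszul
relations: a family `v` that satisfies the Koszul relations satisfies all relations. -/
theorem sum_smul_eq_zero_of_isWeaklyRegular {n : ℕ} {x : Fin n → R}
    (hx : IsWeaklyRegular R (List.ofFn x)) {N : Type*} [AddCommGroup N] [Module R N]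
    {v : Fin n → N} (hv : ∀ i j, x i • v j = x j • v i) {r : Fin n → R}
    (hr : ∑ i, r i * x i = 0) : ∑ i, r i • v i = 0 := by
  induction n with
  | zero => simp
  | succ n ih =>
    rw [← isWeaklyRegular_quotient_bot_iff, List.ofFn_succ', List.concat_eq_append,
      isWeaklyRegular_quotient_append_iff, isWeaklyRegular_quotient_singleton_iff, bot_sup_eq,
      isWeaklyRegular_quotient_bot_iff, ofList_ofFn] at hx
    obtain ⟨hx, hl⟩ := hx
    rw [Fin.sum_univ_castSucc] at hr ⊢
    have h1 : r (Fin.last n) ∈ Ideal.span (Set.range fun i : Fin n => x i.castSucc) := by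
      apply hl
      rw [eq_neg_of_add_eq_zero_right hr]
      exact neg_mem (Ideal.sum_mem _ fun i _ =>
        Ideal.mul_mem_left _ _ (Ideal.subset_span ⟨i, rfl⟩))
    obtain ⟨c, hc⟩ := (Submodule.mem_span_range_iff_exists_fun R).mp h1
    simp only [smul_eq_mul] at hc
    have h2 := ih hx (v := fun i => v i.castSucc) (fun i j => hv _ _)
      (r := fun i => r i.castSucc + c i * x (Fin.last n)) (by
        rw [← hr, ← hc, Finset.sum_mul, ← Finset.sum_add_distrib]
        exact Finset.sum_congr rfl fun i _ => by ring)
    rw [← h2, ← hc, Finset.sum_smul, ← Finset.sum_add_distrib]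
    refine Finset.sum_congr rfl fun i _ => ?_
    rw [add_smul, mul_smul, mul_smul, hv]

/-- Prime avoidance for cosets. -/
theorem exists_add_notMem_of_not_le {S : Finset (Ideal R)} (hS : ∀ P ∈ S, P.IsPrime) {x : R}
    {J : Ideal R} (h : ∀ P ∈ S, ¬ (Ideal.span {x} ⊔ J ≤ P)) :
    ∃ j ∈ J, ∀ P ∈ S, x + j ∉ P := by
  classical
  induction S using Finset.strongInduction with
  | H S ih =>
    rcases S.eq_empty_or_nonempty with rfl | hne
    · exact ⟨0, J.zero_mem, by simp⟩
    obtain ⟨P, hP, hmin⟩ := S.exists_minimal hne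
    obtain ⟨j, hj, hjS⟩ := ih (S.erase P) (Finset.erase_ssubset hP)
      (fun Q hQ => hS Q (Finset.mem_of_mem_erase hQ))
      (fun Q hQ => h Q (Finset.mem_of_mem_erase hQ))
    by_cases hz : x + j ∈ P
    · have hPp := hS P hP
      have hJ : ¬ J ≤ P := fun hJ => h P hP (sup_le (by
        rw [Ideal.span_singleton_le_iff_mem]
        exact (Ideal.add_mem_iff_left _ (hJ hj)).mp hz) hJ)
      have hinf : ¬ (J ⊓ (S.erase P).inf id ≤ P) := by
        intro hle
        rcases hPp.inf_le.mp hle with h1 | h1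
        · exact hJ h1
        · obtain ⟨Q, hQ, hQP⟩ := (hPp.inf_le').mp h1
          exact (Finset.mem_erase.mp hQ).1
            (le_antisymm hQP (hmin (Finset.mem_of_mem_erase hQ) hQP))
      obtain ⟨w, hw, hwP⟩ := SetLike.not_le_iff_exists.mp hinf
      refine ⟨j + w, J.add_mem hj hw.1, fun Q hQ => ?_⟩
      rw [← add_assoc]
      by_cases hQP : Q = P
      · rw [hQP]
        exact fun h => hwP ((Ideal.add_mem_iff_right _ hz).mp h)
      · have hQ' : Q ∈ S.erase P := Finset.mem_erase.mpr ⟨hQP, hQ⟩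
        have hwQ : w ∈ Q := (Finset.inf_le hQ' : (S.erase P).inf id ≤ Q) hw.2
        exact fun h => hjS Q hQ' ((Ideal.add_mem_iff_left _ hwQ).mp h)
    · refine ⟨j, hj, fun Q hQ => ?_⟩
      by_cases hQP : Q = P
      · rwa [hQP]
      · exact hjS Q (Finset.mem_erase.mpr ⟨hQP, hQ⟩)

/-- Prime avoidance for cosets and associated primes: if no associated prime of `N` contains
`x` and `J`, the coset `x + J` contains an `N`-regular element. -/
theorem exists_add_isSMulRegular [IsNoetherianRing R] (N : Type*) [AddCommGroup N] [Module R N]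
    [Module.Finite R N] {x : R} {J : Ideal R}
    (h : ∀ P ∈ associatedPrimes R N, ¬ (Ideal.span {x} ⊔ J ≤ P)) :
    ∃ j ∈ J, IsSMulRegular N (x + j) := by
  have hfin := associatedPrimes.finite R N
  obtain ⟨j, hj, h'⟩ := exists_add_notMem_of_not_le (S := hfin.toFinset)
    (fun P hP => (hfin.mem_toFinset.mp hP).isPrime) (x := x) (J := J)
    (fun P hP => h P (hfin.mem_toFinset.mp hP))
  refine ⟨j, hj, ?_⟩
  by_contra hreg
  have : x + j ∈ ⋃ p ∈ associatedPrimes R N, (p : Set R) := by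
    rw [biUnion_associatedPrimes_eq_compl_regular R N]
    exact hreg
  simp only [Set.mem_iUnion] at this
  obtain ⟨P, hP, hxP⟩ := this
  exact h' P (hfin.mem_toFinset.mpr hP) hxP

end RegularSequences

/-! ### Wiebe's theorem -/

section Wiebe

open RingTheory.Sequence

variable {R : Type*} [CommRing R]

/-- Cramer's rule, modulo an ideal. -/
theorem det_mul_mem_of_mulVec_mem {ι : Type*} [Fintype ι] [DecidableEq ι] {b : Ideal R}
    {M : Matrix ι ι R} {x : ι → R} (h : ∀ i, M.mulVec x i ∈ b) (j : ι) : M.det * x j ∈ b := by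
  have : M.det * x j = (M.adjugate.mulVec (M.mulVec x)) j := by
    rw [Matrix.mulVec_mulVec, Matrix.adjugate_mul, Matrix.smul_mulVec, Matrix.one_mulVec]
    rfl
  rw [this]
  exact Ideal.sum_mem _ fun i _ => b.mul_mem_left _ (h i)

/-- The Schur complement of the last entry, for a matrix with last row `(e, 1)`. -/
theorem det_updateRow_last_snoc_one {n : ℕ} (M : Matrix (Fin (n + 1)) (Fin (n + 1)) R)
    (e : Fin n → R) :
    (M.updateRow (Fin.last n) (Fin.snoc e 1 : Fin (n + 1) → R)).det =
      (Matrix.of fun i j : Fin n =>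
        M i.castSucc j.castSucc - M i.castSucc (Fin.last n) * e j).det := by
  rw [← Matrix.det_submatrix_equiv_self (finSumFinEquiv (m := n) (n := 1))]
  have : (M.updateRow (Fin.last n) (Fin.snoc e 1 : Fin (n + 1) → R)).submatrix
      (finSumFinEquiv (m := n) (n := 1)) (finSumFinEquiv (m := n) (n := 1)) =
      Matrix.fromBlocks (Matrix.of fun i j => M i.castSucc j.castSucc)
        (Matrix.of fun i _ => M i.castSucc (Fin.last n)) (Matrix.of fun _ j => e j) 1 := by
    have hl : ∀ k : Fin 1, Fin.natAdd n k = Fin.last n := fun k => by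
      rw [Subsingleton.elim k 0]; rfl
    have hs : ∀ i : Fin n, (Fin.castAdd 1 i : Fin (n + 1)) = i.castSucc := fun i => rfl
    ext (i | i) (j | j)
    · simp [hs]
    · simp [hs, hl]
    · simp [hs, hl]
    · simp [hl, Subsingleton.elim i j]
  rw [this, Matrix.det_fromBlocks_one₂₂]
  congr 1
  ext i j
  simp [Matrix.mul_apply]

/-- **Wiebe's theorem**: let `x` and `f` be regular sequences of the same length in a Noetherian
local ring with `f = M x`. Then the ideal quotient `(f) : (x)` is generated by `f` and `det M`.
Everything is taken modulo an ideal `b`. -/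
theorem mem_of_forall_mul_mem_of_isWeaklyRegular [IsLocalRing R] [IsNoetherianRing R] {n : ℕ}
    {b : Ideal R} {x f : Fin n → R} (hxm : ∀ i, x i ∈ maximalIdeal R)
    (hfm : ∀ i, f i ∈ maximalIdeal R)
    (hx : IsWeaklyRegular (R ⧸ b) (List.ofFn x)) (hf : IsWeaklyRegular (R ⧸ b) (List.ofFn f))
    {M : Matrix (Fin n) (Fin n) R} (hM : ∀ i, f i - M.mulVec x i ∈ b) {a : R}
    (ha : ∀ j, a * x j ∈ b ⊔ Ideal.span (Set.range f)) :
    a ∈ b ⊔ Ideal.span (Set.range f) ⊔ Ideal.span {M.det} := by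
  induction n generalizing b a with
  | zero =>
    refine Ideal.mem_sup_right ?_
    rw [Matrix.det_fin_zero, Ideal.span_singleton_one]
    trivial
  | succ n ih =>
    set f' : Fin n → R := fun i => f i.castSucc with hf'
    set x' : Fin n → R := fun i => x i.castSucc with hx'
    set c : Ideal R := b ⊔ Ideal.span (Set.range f') with hc
    have hcf : b ⊔ Ideal.span (Set.range f) = c ⊔ Ideal.span {f (Fin.last n)} := by
      rw [hc, sup_assoc, ← Ideal.span_union]
      congr 2
      rw [Set.union_singleton, ← Fin.range_snoc]
      congr 1
      exact (Fin.snoc_init_self f).symm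
    rw [List.ofFn_succ', List.concat_eq_append] at hx hf
    have hfl := ((isWeaklyRegular_quotient_append_iff _ _ _).mp hf).2
    have hf1 := ((isWeaklyRegular_quotient_append_iff _ _ _).mp hf).1
    have hx1 := ((isWeaklyRegular_quotient_append_iff _ _ _).mp hx).1
    have hxl := ((isWeaklyRegular_quotient_append_iff _ _ _).mp hx).2
    rw [ofList_ofFn, isWeaklyRegular_quotient_singleton_iff] at hfl hxl
    have hmv : ∀ P : Ideal R, (∀ j, x j ∈ P) → ∀ r : Fin (n + 1) → R, r ⬝ᵥ x ∈ P :=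
      fun P hP r => Ideal.sum_mem _ fun j _ => P.mul_mem_left _ (hP j)
    have hfx : ∀ P : Ideal R, b ≤ P → (∀ j, x j ∈ P) → ∀ i, f i ∈ P := fun P hb hP i => by
      rw [← sub_add_cancel (f i) (M.mulVec x i)]
      exact P.add_mem (hb (hM i)) (hmv P (fun j => hP j) _)
    -- a generator `z` of `(x)` that is regular modulo `f'`
    obtain ⟨y, hy, hz⟩ := exists_add_isSMulRegular (R ⧸ c) (x := x (Fin.last n))
      (J := Ideal.span (Set.range x')) (by
        intro P hP hle
        have hcP : c ≤ P := by
          rw [← Ideal.annihilator_quotient (I := c), ← Submodule.annihilator_top]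
          exact hP.annihilator_le
        have hxP : ∀ j, x j ∈ P := by
          intro j
          refine Fin.lastCases ?_ (fun i => ?_) j
          · exact hle (Ideal.mem_sup_left (Ideal.mem_span_singleton_self _))
          · exact hle (Ideal.mem_sup_right (Ideal.subset_span ⟨i, rfl⟩))
        have hfP := hfx P (le_sup_left.trans hcP) hxP (Fin.last n)
        have hreg := (isSMulRegular_quotient_iff c (f (Fin.last n))).mpr hfl
        have : f (Fin.last n) ∈ ⋃ p ∈ associatedPrimes R (R ⧸ c), (p : Set R) :=
          Set.mem_biUnion hP hfP
        rw [biUnion_associatedPrimes_eq_compl_regular] at this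
        exact this hreg)
    rw [isSMulRegular_quotient_iff] at hz
    obtain ⟨e, he⟩ := (Submodule.mem_span_range_iff_exists_fun R).mp hy
    simp only [smul_eq_mul] at he
    set z := x (Fin.last n) + y with hzdef
    have hzm : z ∈ maximalIdeal R := by
      refine Ideal.add_mem _ (hxm _) ?_
      rw [← he]
      exact Ideal.sum_mem _ fun i _ => Ideal.mul_mem_left _ _ (hxm _)
    -- the rows of `M` without the last one, and the row of `z`
    set T : Matrix (Fin n) (Fin n) R :=
      Matrix.of fun i j => M i.castSucc j.castSucc - M i.castSucc (Fin.last n) * e j with hT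
    have hfc : ∀ i : Fin n, f i.castSucc ∈ c := fun i =>
      Ideal.mem_sup_right (Ideal.subset_span ⟨i, rfl⟩)
    have hzx : ∀ {P : Ideal R} {u : R}, (∀ j, u * x j ∈ P) → u * z ∈ P := by
      intro P u hu
      rw [hzdef, ← he, mul_add, Finset.mul_sum]
      exact P.add_mem (hu _) (P.sum_mem fun i _ => by
        rw [mul_left_comm]; exact P.mul_mem_left _ (hu _))
    -- a determinant with a relation between the `x j` as its last row vanishes modulo `f'`
    have hrow : ∀ r : Fin (n + 1) → R, r ⬝ᵥ x ∈ b →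
        (M.updateRow (Fin.last n) r).det ∈ c := by
      intro r hr
      refine hz _ (hzx fun j => det_mul_mem_of_mulVec_mem (fun i => ?_) j)
      refine Fin.lastCases ?_ (fun i => ?_) i
      · rw [Matrix.mulVec, Matrix.updateRow_self]
        exact Ideal.mem_sup_left hr
      · rw [Matrix.mulVec, Matrix.updateRow_ne (Fin.castSucc_lt_last i).ne]
        rw [← sub_sub_cancel (f i.castSucc) (M i.castSucc ⬝ᵥ x)]
        exact c.sub_mem (hfc i) (Ideal.mem_sup_left (hM _))
    have hex : (Fin.snoc e 1 : Fin (n + 1) → R) ⬝ᵥ x = z := by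
      rw [dotProduct, Fin.sum_univ_castSucc]
      simp only [Fin.snoc_castSucc, Fin.snoc_last, one_mul]
      rw [hzdef, ← he, add_comm]
    -- the last row `f_n (e, 1) - z M_n`, where `f_n` is the last member of `f` and `M_n` the last row
    -- of `M`, is a relation, so that `f_n det T` and `z det M` agree modulo `f'`
    have hTdet : f (Fin.last n) * T.det - z * M.det ∈ c := by
      have h1 := hrow (f (Fin.last n) • (Fin.snoc e 1 : Fin (n + 1) → R) +
        (-z) • M (Fin.last n)) (by
          rw [add_dotProduct, smul_dotProduct, smul_dotProduct, hex]
          have := b.mul_mem_left z (hM (Fin.last n))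
          rw [Matrix.mulVec] at this
          convert this using 1
          simp only [smul_eq_mul]
          ring)
      rw [Matrix.det_updateRow_add, Matrix.det_updateRow_smul, Matrix.det_updateRow_smul,
        Matrix.updateRow_eq_self, det_updateRow_last_snoc_one, neg_mul,
        ← sub_eq_add_neg] at h1
      exact h1
    -- the induction hypothesis applies modulo `z`, as `f' = T x'` modulo `b` and `z`
    have ih' : ∀ u, (∀ j, u * x j ∈ c ⊔ Ideal.span {z}) →
        u ∈ c ⊔ Ideal.span {z} ⊔ Ideal.span {T.det} := by
      intro u hu
      have hbz : b ⊔ Ideal.span {z} ⊔ Ideal.span (Set.range f') = c ⊔ Ideal.span {z} := by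
        rw [hc, sup_right_comm]
      have := @ih (b ⊔ Ideal.span {z}) x' f' (fun i => hxm _) (fun i => hfm _) ?_ ?_ T ?_ u ?_
      · rwa [hbz] at this
      · have h1 : IsWeaklyRegular (R ⧸ b) (List.ofFn x' ++ [z]) := by
          rw [isWeaklyRegular_quotient_append_iff, isWeaklyRegular_quotient_singleton_iff,
            ofList_ofFn]
          refine ⟨hx1, fun a ha => hxl a ?_⟩
          rw [hzdef, mul_add] at ha
          exact (Ideal.add_mem_iff_left _ (Ideal.mem_sup_right (Ideal.mul_mem_left _ _ hy))).mp ha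
        exact ((isWeaklyRegular_quotient_cons_iff _ _ _).mp
          (IsWeaklyRegular.perm_mod h1 (List.perm_append_singleton _ _) (by
            simp only [List.mem_append, List.mem_ofFn, List.mem_singleton]
            rintro r (⟨i, rfl⟩ | rfl)
            · exact hxm _
            · exact hzm))).2
      · have h1 : IsWeaklyRegular (R ⧸ b) (List.ofFn f' ++ [z]) := by
          rw [isWeaklyRegular_quotient_append_iff, isWeaklyRegular_quotient_singleton_iff,
            ofList_ofFn]
          exact ⟨hf1, hz⟩
        exact ((isWeaklyRegular_quotient_cons_iff _ _ _).mp
          (IsWeaklyRegular.perm_mod h1 (List.perm_append_singleton _ _) (by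
            simp only [List.mem_append, List.mem_ofFn, List.mem_singleton]
            rintro r (⟨i, rfl⟩ | rfl)
            · exact hfm _
            · exact hzm))).2
      · intro i
        have h1 : f' i - T.mulVec x' i =
            (f i.castSucc - M.mulVec x i.castSucc) + M i.castSucc (Fin.last n) * z := by
          have h2 : M.mulVec x i.castSucc = ∑ j : Fin n, M i.castSucc j.castSucc * x j.castSucc +
              M i.castSucc (Fin.last n) * x (Fin.last n) := Fin.sum_univ_castSucc _
          have h3 : T.mulVec x' i = ∑ j : Fin n, M i.castSucc j.castSucc * x j.castSucc -
              M i.castSucc (Fin.last n) * y := by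
            rw [← he, Finset.mul_sum, ← Finset.sum_sub_distrib]
            rw [Matrix.mulVec, dotProduct]
            refine Finset.sum_congr rfl fun j _ => ?_
            simp only [hT, hx', Matrix.of_apply]
            ring
          rw [h2, h3, hzdef]
          ring
        rw [h1]
        exact Submodule.add_mem_sup (hM _)
          (Ideal.mul_mem_left _ _ (Ideal.mem_span_singleton_self _))
      · intro j
        rw [hbz]
        exact hu _
    rw [hcf] at ha ⊢
    -- `a z = g + u f_n` with `g` in `c`, and `u` lies in `(c, z, det T)` by induction; dividing by `z`
    -- yields `a`
    obtain ⟨g, hg, d, hd, hgd⟩ := Submodule.mem_sup.mp (hzx ha)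
    obtain ⟨u, rfl⟩ := Ideal.mem_span_singleton'.mp hd
    have hu : u ∈ c ⊔ Ideal.span {z} ⊔ Ideal.span {T.det} := by
      refine ih' u fun j => ?_
      obtain ⟨g', hg', d, hd, hgd'⟩ := Submodule.mem_sup.mp (ha j)
      obtain ⟨w, rfl⟩ := Ideal.mem_span_singleton'.mp hd
      have : u * x j - w * z ∈ c := by
        apply hfl
        have h1 : (u * x j - w * z) * f (Fin.last n) = z * g' - x j * g := by
          linear_combination x j * hgd - z * hgd'
        rw [h1]
        exact c.sub_mem (c.mul_mem_left _ hg') (c.mul_mem_left _ hg)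
      rw [← sub_add_cancel (u * x j) (w * z)]
      exact Submodule.add_mem_sup this (Ideal.mem_span_singleton'.mpr ⟨w, rfl⟩)
    obtain ⟨k, hk, d, hd, hkd⟩ := Submodule.mem_sup.mp hu
    obtain ⟨q, rfl⟩ := Ideal.mem_span_singleton'.mp hd
    obtain ⟨g2, hg2, d, hd, hgv⟩ := Submodule.mem_sup.mp hk
    obtain ⟨v, rfl⟩ := Ideal.mem_span_singleton'.mp hd
    have hfinal : a - v * f (Fin.last n) - q * M.det ∈ c := by
      apply hz
      have h1 : (a - v * f (Fin.last n) - q * M.det) * z =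
          g + f (Fin.last n) * g2 + q * (f (Fin.last n) * T.det - z * M.det) := by
        linear_combination -hgd - f (Fin.last n) * hkd - f (Fin.last n) * hgv
      rw [h1]
      exact c.add_mem (c.add_mem hg (c.mul_mem_left _ hg2)) (c.mul_mem_left _ hTdet)
    have h2 : a = (a - v * f (Fin.last n) - q * M.det) + v * f (Fin.last n) + q * M.det := by ring
    rw [h2]
    exact Submodule.add_mem_sup (Submodule.add_mem_sup hfinal
      (Ideal.mem_span_singleton'.mpr ⟨v, rfl⟩)) (Ideal.mem_span_singleton'.mpr ⟨q, rfl⟩)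

end Wiebe

/-! ### Depth -/

section Depth

open RingTheory.Sequence CategoryTheory Abelian Pointwise

variable {R : Type u} [CommRing R] [IsLocalRing R] [IsNoetherianRing R]

/-- Dividing by a regular element lowers the depth by at most one. -/
theorem exists_isRegular_quotSMulTop (N : Type u) [AddCommGroup N] [Module R N]
    [Module.Finite R N] [Nontrivial N] {t : R} (ht : t ∈ maximalIdeal R) (htN : IsSMulRegular N t)
    {n : ℕ} (h : ∃ l : List R, l.length = n + 1 ∧ (∀ r ∈ l, r ∈ maximalIdeal R) ∧ IsRegular N l) :
    ∃ l : List R, l.length = n ∧ (∀ r ∈ l, r ∈ maximalIdeal R) ∧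
      IsRegular (QuotSMulTop t N) l := by
  have hlt : ∀ (N : Type u) [AddCommGroup N] [Module R N] [Module.Finite R N] [Nontrivial N],
      maximalIdeal R • (⊤ : Submodule R N) < ⊤ := fun N _ _ _ _ =>
    lt_top_iff_ne_top.mpr (Ne.symm (Submodule.top_ne_ideal_smul_of_le_jacobson_annihilator
      (maximalIdeal_le_jacobson _)))
  have := nontrivial_quotSMulTop_of_mem_maximalIdeal N ht
  have h1 := (ModuleCat.exists_isRegular_tfae (maximalIdeal R) (n + 1) (ModuleCat.of R N)
    (hlt N)).out 3 1
  have h2 := (ModuleCat.exists_isRegular_tfae (maximalIdeal R) n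
    (ModuleCat.of R (QuotSMulTop t N)) (hlt _)).out 1 3
  refine h2.mp fun i hi => ?_
  have h3 := h1.mp h
  have zero1 := AddCommGrpCat.isZero_of_iff_subsingleton.mpr (h3 i (by omega))
  have zero2 := AddCommGrpCat.isZero_of_iff_subsingleton.mpr (h3 (i + 1) (by omega))
  have htN' : IsSMulRegular (ModuleCat.of R N) t := htN
  exact AddCommGrpCat.subsingleton_of_isZero <| ShortComplex.Exact.isZero_of_both_zeros
    ((Ext.covariant_sequence_exact₃' _ htN'.smulShortComplex_shortExact) i (i + 1) rfl)
    (zero1.eq_zero_of_src _) (zero2.eq_zero_of_tgt _)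

/-- Dividing by a regular sequence lowers the depth by at most its length. -/
theorem exists_isWeaklyRegular_quotient_sup {b : Ideal R} (hb : b ≠ ⊤) {l : List R}
    (hl : IsWeaklyRegular (R ⧸ b) l) (hlm : ∀ r ∈ l, r ∈ maximalIdeal R) {n : ℕ}
    (h : ∃ l' : List R, l'.length = l.length + n ∧ (∀ r ∈ l', r ∈ maximalIdeal R) ∧
      IsWeaklyRegular (R ⧸ b) l') :
    ∃ l' : List R, l'.length = n ∧ (∀ r ∈ l', r ∈ maximalIdeal R) ∧
      IsWeaklyRegular (R ⧸ (b ⊔ Ideal.ofList l)) l' := by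
  induction l generalizing b with
  | nil =>
    rw [Ideal.ofList_nil, sup_bot_eq]
    simpa using h
  | cons t l ih =>
    have hnt : Nontrivial (R ⧸ b) := Ideal.Quotient.nontrivial_iff.mpr hb
    rw [isWeaklyRegular_quotient_cons_iff] at hl
    have ht := hlm t List.mem_cons_self
    rw [Ideal.ofList_cons, ← sup_assoc]
    refine ih (b := b ⊔ Ideal.span {t}) ?_ hl.2 (fun r hr => hlm r (List.mem_cons_of_mem _ hr)) ?_
    · refine ne_top_of_le_ne_top (IsLocalRing.maximalIdeal.isMaximal R).ne_top
        (sup_le (le_maximalIdeal hb) ?_)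
      rwa [Ideal.span_singleton_le_iff_mem]
    · obtain ⟨l', hl', hm', hreg⟩ := h
      obtain ⟨l'', h1, h2, h3⟩ := exists_isRegular_quotSMulTop (R ⧸ b) ht
        ((isSMulRegular_quotient_iff _ _).mpr hl.1) (n := l.length + n)
        ⟨l', by rw [hl', List.length_cons]; omega, hm',
          .of_isWeaklyRegular_of_mem_maximalIdeal _ hm' hreg⟩
      exact ⟨l'', h1, h2,
        ((quotSMulTopQuotientEquiv b t).isWeaklyRegular_congr l'').mp h3.toIsWeaklyRegular⟩

/-- The depth of a module is at most the dimension of each of its associated primes. -/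
theorem length_le_ringKrullDim_quotient_of_mem_associatedPrimes {N : Type*} [AddCommGroup N]
    [Module R N] [Module.Finite R N] {l : List R} (hl : IsWeaklyRegular N l)
    (hm : ∀ r ∈ l, r ∈ maximalIdeal R) {P : Ideal R} (hP : P ∈ associatedPrimes R N) :
    (l.length : WithBot ℕ∞) ≤ ringKrullDim (R ⧸ P) := by
  induction l generalizing N P with
  | nil =>
    have := hP.isPrime
    exact ringKrullDim_nonneg_of_nontrivial
  | cons t l ih =>
    have hPp : P.IsPrime := hP.isPrime
    have ht := hm t List.mem_cons_self
    obtain ⟨htN, hl⟩ := (isWeaklyRegular_cons_iff _ _ _).mp hl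
    have htP : t ∉ P := by
      intro h
      have : t ∈ ⋃ p ∈ associatedPrimes R N, (p : Set R) := Set.mem_biUnion hP h
      rw [biUnion_associatedPrimes_eq_compl_regular] at this
      exact this htN
    -- an element killed by `P` that is nonzero modulo `t`
    obtain ⟨m, hmP, hmt⟩ : ∃ m : N, (∀ r ∈ P, r • m = 0) ∧ m ∉ t • (⊤ : Submodule R N) := by
      by_contra! hcon
      let K : Submodule R N := Submodule.torsionBySet R N (P : Set R)
      have hK : ∀ m, m ∈ K ↔ ∀ r ∈ P, r • m = 0 := fun m => by
        simp [K, Submodule.mem_torsionBySet_iff]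
      have hle : K ≤ Ideal.span {t} • K := by
        intro m hmK
        have := hcon m ((hK m).mp hmK)
        obtain ⟨m', -, rfl⟩ := this
        refine Submodule.smul_mem_smul (Ideal.mem_span_singleton_self t) ((hK m').mpr ?_)
        intro r hr
        apply htN
        have h1 := (hK _).mp hmK r hr
        simp only [DistribSMul.toLinearMap_apply, smul_zero] at h1 ⊢
        rw [smul_comm]
        exact h1
      have hbot := Submodule.eq_bot_of_le_smul_of_le_jacobson_bot _ K (IsNoetherian.noetherian _)
        hle (by
          refine le_trans ?_ (maximalIdeal_le_jacobson _)
          rwa [Ideal.span_singleton_le_iff_mem])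
      obtain ⟨m, hm0⟩ := (isAssociatedPrime_iff.mp hP).2
      have : m ∈ K := (hK m).mpr fun r hr => by
        rw [hm0, Submodule.mem_colon_singleton] at hr
        exact hr
      rw [hbot, Submodule.mem_bot] at this
      apply htP
      rw [hm0, Submodule.mem_colon_singleton, this, smul_zero]
      exact Submodule.zero_mem _
    let m' : QuotSMulTop t N := Submodule.Quotient.mk m
    have hm' : m' ≠ 0 := by
      rw [Ne, Submodule.Quotient.mk_eq_zero]
      exact hmt
    obtain ⟨Q, hQ, hle⟩ := exists_le_isAssociatedPrime_of_isNoetherianRing R m' hm'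
    have hPQ : P ≤ Q := fun r hr => hle (by
      rw [Submodule.mem_colon_singleton, ← Submodule.Quotient.mk_smul, hmP r hr]
      exact Submodule.zero_mem _)
    have htQ : t ∈ Q := hle (by
      rw [Submodule.mem_colon_singleton, ← Submodule.Quotient.mk_smul, Submodule.mem_bot,
        Submodule.Quotient.mk_eq_zero]
      exact Submodule.smul_mem_pointwise_smul _ _ _ trivial)
    have hQp : Q.IsPrime := hQ.isPrime
    have h1 := ih hl (fun r hr => hm r (List.mem_cons_of_mem _ hr)) hQ
    have h2 : ringKrullDim (R ⧸ Q) ≤ ringKrullDim ((R ⧸ P) ⧸ Ideal.span {Ideal.Quotient.mk P t}) :=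
      ringKrullDim_le_of_surjective
        (Ideal.Quotient.lift _ (Ideal.Quotient.factor hPQ) (by
          intro a ha
          obtain ⟨c, rfl⟩ := Ideal.mem_span_singleton'.mp ha
          rw [map_mul, Ideal.Quotient.factor_mk, Ideal.Quotient.eq_zero_iff_mem.mpr htQ, mul_zero]))
        (Ideal.Quotient.lift_surjective_of_surjective _ _ (Ideal.Quotient.factor_surjective hPQ))
    have h3 := ringKrullDim_quotient_succ_le_of_nonZeroDivisor
      (R := R ⧸ P) (r := Ideal.Quotient.mk P t) (mem_nonZeroDivisors_of_ne_zero (by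
        rwa [Ne, Ideal.Quotient.eq_zero_iff_mem]))
    calc ((t :: l).length : WithBot ℕ∞) = (l.length : WithBot ℕ∞) + 1 := by simp
      _ ≤ _ := add_le_add_left (h1.trans h2) 1
      _ ≤ _ := h3

end Depth

/-! ### Duality over one-dimensional Gorenstein rings -/

section Duality

variable {A : Type*} [CommRing A]

theorem length_le_add_of_exact {N₁ N₂ N₃ : Type*} [AddCommGroup N₁] [AddCommGroup N₂]
    [AddCommGroup N₃] [Module A N₁] [Module A N₂] [Module A N₃] {f : N₁ →ₗ[A] N₂}
    {g : N₂ →ₗ[A] N₃} (h : Function.Exact f g) :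
    Module.length A N₂ ≤ Module.length A N₁ + Module.length A N₃ := by
  have h1 := Module.length_eq_add_of_exact (LinearMap.ker g).subtype g.rangeRestrict
    (Submodule.subtype_injective _) g.surjective_rangeRestrict (by
      rw [LinearMap.exact_iff, LinearMap.ker_rangeRestrict, Submodule.range_subtype])
  rw [h1, h.linearMap_ker_eq]
  exact add_le_add (Module.length_le_of_surjective f.rangeRestrict f.surjective_rangeRestrict)
    (Module.length_le_of_injective _ (Submodule.subtype_injective _))

theorem length_quotient_le_one_of_isMaximal {m : Ideal A} [hm : m.IsMaximal] :
    Module.length A (A ⧸ m) ≤ 1 := by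
  have : IsSimpleModule A (A ⧸ m) := isSimpleModule_iff_isCoatom.mpr hm.out
  exact Module.length_eq_one A _ |>.le

/-- If the socle of `E` is cyclic, passing to `Hom(-, E)` does not increase the length. -/
theorem length_linearMap_le [IsLocalRing A] {E : Type*} [AddCommGroup E] [Module A E] {s : E}
    (hs : ∀ m ∈ maximalIdeal A, m • s = 0)
    (hsoc : ∀ e : E, (∀ m ∈ maximalIdeal A, m • e = 0) → e ∈ Submodule.span A {s})
    {N : Type*} [AddCommGroup N] [Module A N] (hN : IsFiniteLength A N) :
    Module.length A (N →ₗ[A] E) ≤ Module.length A N := by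
  induction hN with
  | of_subsingleton => simp
  | @of_simple_quotient M _ _ N hsimple hN ih =>
    have h1 : Module.length A (M →ₗ[A] E) ≤
        Module.length A ((M ⧸ N) →ₗ[A] E) + Module.length A (N →ₗ[A] E) :=
      length_le_add_of_exact (f := LinearMap.lcomp A E N.mkQ) (g := LinearMap.lcomp A E N.subtype)
        (by
          intro f
          constructor
          · intro hf
            refine ⟨N.liftQ f fun n hn => LinearMap.congr_fun hf ⟨n, hn⟩, ?_⟩
            ext m
            rfl
          · rintro ⟨g, rfl⟩
            ext n
            change g (Submodule.Quotient.mk (n : M)) = 0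
            rw [(Submodule.Quotient.mk_eq_zero N).mpr n.2, map_zero])
    have h2 : Module.length A M = Module.length A (M ⧸ N) + Module.length A N := by
      rw [add_comm]
      exact Module.length_eq_add_of_exact N.subtype N.mkQ N.subtype_injective N.mkQ_surjective
        (LinearMap.exact_subtype_mkQ N)
    have h3 : Module.length A ((M ⧸ N) →ₗ[A] E) ≤ 1 := by
      obtain ⟨m, hm, ⟨e⟩⟩ := isSimpleModule_iff_quot_maximal.mp hsimple
      have hmm := IsLocalRing.eq_maximalIdeal hm
      have h4 : Module.length A (Submodule.span A {s}) ≤ 1 := by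
        refine le_trans ?_ (length_quotient_le_one_of_isMaximal (m := maximalIdeal A))
        refine Module.length_le_of_surjective
          (((maximalIdeal A).liftQ (LinearMap.toSpanSingleton A E s) fun m hm => hs m hm).codRestrict
            (Submodule.span A {s}) ?_) ?_
        · intro c
          obtain ⟨c, rfl⟩ := Ideal.Quotient.mk_surjective c
          exact Submodule.smul_mem _ _ (Submodule.mem_span_singleton_self s)
        · rintro ⟨c, hc⟩
          obtain ⟨r, rfl⟩ := Submodule.mem_span_singleton.mp hc
          exact ⟨Ideal.Quotient.mk _ r, rfl⟩
      refine le_trans ?_ h4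
      -- a map on the simple module `M ⧸ N` is determined by the image of a generator, in the socle
      set e1 : M ⧸ N := e.symm 1 with he1
      have hev : ∀ f : (M ⧸ N) →ₗ[A] E, f e1 ∈ Submodule.span A {s} := by
        intro f
        refine hsoc _ fun r hr => ?_
        have h5 : r • (1 : A ⧸ m) = 0 := by
          rw [Algebra.smul_def, mul_one]
          exact Ideal.Quotient.eq_zero_iff_mem.mpr (hmm ▸ hr)
        rw [← map_smul, he1, ← map_smul, h5, map_zero, map_zero]
      refine Module.length_le_of_injective
        ((LinearMap.applyₗ (R := A) e1).codRestrict (Submodule.span A {s}) hev) ?_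
      intro f g hfg
      have hfg' : f e1 = g e1 := congrArg Subtype.val hfg
      ext x
      obtain ⟨c, hc⟩ := Ideal.Quotient.mk_surjective (e (Submodule.Quotient.mk x))
      have hx : (Submodule.Quotient.mk x : M ⧸ N) = c • e1 := by
        apply e.injective
        rw [he1, map_smul, e.apply_symm_apply, ← hc, Algebra.smul_def, mul_one]
        rfl
      simp only [LinearMap.comp_apply, Submodule.mkQ_apply]
      rw [hx, map_smul, map_smul, hfg']
    rw [h2]
    exact h1.trans (add_le_add (h3.trans_eq (Module.length_eq_one A _).symm) ih)

/-- The map `E → Hom(W, E)` given by multiplication, for a submodule `W` of `E = A ⧸ a`. -/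
def mulRestrict {a : Ideal A} (W : Submodule A (A ⧸ a)) : (A ⧸ a) →ₗ[A] (W →ₗ[A] (A ⧸ a)) :=
  LinearMap.lcomp A (A ⧸ a) W.subtype ∘ₗ LinearMap.mul A (A ⧸ a)

theorem mulRestrict_apply {a : Ideal A} (W : Submodule A (A ⧸ a)) (e : A ⧸ a) (x : W) :
    mulRestrict W e x = e * (x : A ⧸ a) := rfl

variable [IsLocalRing A] {a : Ideal A} (ha : IsFiniteLength A (A ⧸ a)) {s : A ⧸ a}
  (hs : ∀ m ∈ maximalIdeal A, m • s = 0)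
  (hsoc : ∀ e : A ⧸ a, (∀ m ∈ maximalIdeal A, m • e = 0) → e ∈ Submodule.span A {s})

include ha hs hsoc

/-- Multiplication `E → Hom(W, E)` is surjective, for `E = A ⧸ a` Artinian with simple socle, and its
kernel, the annihilator of `W`, has the length of `E ⧸ W`. -/
theorem length_ker_mulRestrict_and (W : Submodule A (A ⧸ a)) :
    Module.length A (LinearMap.ker (mulRestrict W)) = Module.length A ((A ⧸ a) ⧸ W) ∧
      LinearMap.range (mulRestrict W) = ⊤ := by
  have hW : IsFiniteLength A W := ha.of_injective W.subtype_injective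
  have hQ : IsFiniteLength A ((A ⧸ a) ⧸ W) := ha.of_surjective W.mkQ_surjective
  have hH := length_linearMap_le hs hsoc hW
  have hHQ := length_linearMap_le hs hsoc hQ
  have h1 : Module.length A (A ⧸ a) = Module.length A (LinearMap.ker (mulRestrict W)) +
      Module.length A (LinearMap.range (mulRestrict W)) :=
    Module.length_eq_add_of_exact (LinearMap.ker (mulRestrict W)).subtype
      (mulRestrict W).rangeRestrict (Submodule.subtype_injective _)
      (mulRestrict W).surjective_rangeRestrict (by
      rw [LinearMap.exact_iff, LinearMap.ker_rangeRestrict, Submodule.range_subtype])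
  have h2 : Module.length A (A ⧸ a) = Module.length A W + Module.length A ((A ⧸ a) ⧸ W) :=
    Module.length_eq_add_of_exact W.subtype W.mkQ W.subtype_injective W.mkQ_surjective
      (LinearMap.exact_subtype_mkQ W)
  have h3 : Module.length A (LinearMap.ker (mulRestrict W)) ≤
      Module.length A (((A ⧸ a) ⧸ W) →ₗ[A] (A ⧸ a)) := by
    let F : LinearMap.ker (mulRestrict W) →ₗ[A] (((A ⧸ a) ⧸ W) →ₗ[A] (A ⧸ a)) :=
      { toFun := fun e => W.liftQ (LinearMap.mul A (A ⧸ a) e.1) fun x hx =>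
          LinearMap.congr_fun e.2 ⟨x, hx⟩
        map_add' := fun e e' => Submodule.linearMap_qext _ (LinearMap.ext fun x =>
          add_mul (e : A ⧸ a) e' x)
        map_smul' := fun r e => Submodule.linearMap_qext _ (LinearMap.ext fun x =>
          smul_mul_assoc r (e : A ⧸ a) x) }
    refine Module.length_le_of_injective F fun e e' h => ?_
    have h6 : (e : A ⧸ a) * 1 = (e' : A ⧸ a) * 1 :=
      LinearMap.congr_fun h (Submodule.Quotient.mk 1)
    rw [mul_one, mul_one] at h6
    exact Subtype.ext h6
  have h4 : Module.length A (LinearMap.range (mulRestrict W)) ≤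
      Module.length A (W →ₗ[A] (A ⧸ a)) :=
    Module.length_le_of_injective _ (Submodule.subtype_injective _)
  -- the kernel and the range are bounded by the duals of `E ⧸ W` and `W`, and their lengths sum
  -- up to that of `E`, so all the bounds are equalities
  have hWt := Module.length_ne_top_iff.mpr hW
  have hQt := Module.length_ne_top_iff.mpr hQ
  have hHt : Module.length A (W →ₗ[A] (A ⧸ a)) ≠ ⊤ := ne_top_of_le_ne_top hWt hH
  have hkt := ne_top_of_le_ne_top hQt (h3.trans hHQ)
  have hrt := ne_top_of_le_ne_top hHt h4
  have h3' := h3.trans hHQ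
  have hfl := Module.length_ne_top_iff.mp hHt
  obtain ⟨k, hk⟩ := ENat.ne_top_iff_exists.mp hkt
  obtain ⟨r, hr⟩ := ENat.ne_top_iff_exists.mp hrt
  obtain ⟨w, hw⟩ := ENat.ne_top_iff_exists.mp hWt
  obtain ⟨q, hq⟩ := ENat.ne_top_iff_exists.mp hQt
  obtain ⟨h, hh⟩ := ENat.ne_top_iff_exists.mp hHt
  rw [h1, ← hk, ← hr, ← hw, ← hq] at h2
  rw [← hk, ← hq] at h3'
  rw [← hr, ← hh] at h4
  rw [← hh, ← hw] at hH
  norm_cast at h2 h3' h4 hH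
  refine ⟨by rw [← hk, ← hq]; norm_cast; omega, ?_⟩
  by_contra hne
  have := isFiniteLength_iff_isNoetherian_isArtinian.mp hfl
  obtain ⟨_, _⟩ := this
  have := Submodule.length_lt hne
  rw [← hr, ← hh] at this
  norm_cast at this
  omega

/-- Self-injectivity of an Artinian local ring with simple socle. -/
theorem exists_smul_eq_of_linearMap {W : Submodule A (A ⧸ a)} (f : W →ₗ[A] (A ⧸ a)) :
    ∃ c : A, ∀ x : W, f x = c • (x : A ⧸ a) := by
  obtain ⟨e, rfl⟩ := LinearMap.range_eq_top.mp (length_ker_mulRestrict_and ha hs hsoc W).2 f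
  obtain ⟨c, rfl⟩ := Ideal.Quotient.mk_surjective e
  exact ⟨c, fun x => rfl⟩

/-- The double annihilator theorem for an Artinian local ring with simple socle. -/
theorem mem_of_forall_smul_eq_zero {W : Submodule A (A ⧸ a)} {e : A ⧸ a}
    (he : ∀ y : A, (∀ x ∈ W, y • x = 0) → y • e = 0) : e ∈ W := by
  -- `W` and `W'` have the same annihilator, hence the same length
  set W' := W ⊔ Submodule.span A {e}
  have hker : LinearMap.ker (mulRestrict W) = LinearMap.ker (mulRestrict W') := by
    ext c
    obtain ⟨c, rfl⟩ := Ideal.Quotient.mk_surjective c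
    simp only [LinearMap.mem_ker, LinearMap.ext_iff, mulRestrict_apply, LinearMap.zero_apply]
    constructor
    · rintro h ⟨x, hx⟩
      obtain ⟨y, hy, z, hz, rfl⟩ := Submodule.mem_sup.mp hx
      obtain ⟨r, rfl⟩ := Submodule.mem_span_singleton.mp hz
      have h1 := h ⟨y, hy⟩
      have h2 : c • e = 0 := he c fun x hx => h ⟨x, hx⟩
      have h3 : (Ideal.Quotient.mk a c) * e = 0 := h2
      simp only at h1 ⊢
      rw [mul_add, h1, mul_smul_comm, h3, smul_zero, add_zero]
    · rintro h ⟨x, hx⟩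
      exact h ⟨x, Submodule.mem_sup_left hx⟩
  have h1 := (length_ker_mulRestrict_and ha hs hsoc W).1
  have h2 := (length_ker_mulRestrict_and ha hs hsoc W').1
  rw [hker, h2] at h1
  have hlen : ∀ W : Submodule A (A ⧸ a), Module.length A (A ⧸ a) =
      Module.length A W + Module.length A ((A ⧸ a) ⧸ W) := fun W =>
    Module.length_eq_add_of_exact W.subtype W.mkQ W.subtype_injective W.mkQ_surjective
      (LinearMap.exact_subtype_mkQ W)
  have h3 := (hlen W).symm.trans (hlen W')
  rw [h1] at h3
  have hQ : Module.length A ((A ⧸ a) ⧸ W) ≠ ⊤ :=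
    Module.length_ne_top_iff.mpr (ha.of_surjective W.mkQ_surjective)
  have h4 : Module.length A W = Module.length A W' := (ENat.add_left_injective_of_ne_top hQ) h3
  have hle : W ≤ W' := le_sup_left
  by_contra hmem
  have hlt : W < W' := lt_of_le_of_ne hle fun h => hmem (by
    rw [h]; exact Submodule.mem_sup_right (Submodule.mem_span_singleton_self e))
  obtain ⟨_, _⟩ := isFiniteLength_iff_isNoetherian_isArtinian.mp ha
  have := Submodule.height_strictMono hlt
  rw [← Module.length_submodule, ← Module.length_submodule, h4] at this
  exact lt_irrefl _ this

end Duality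

section GorensteinDuality

/-- Extension of homomorphisms over a one-dimensional Gorenstein ring: if `t` is regular on `A` and on
`A ⧸ I` and `A ⧸ t` has simple socle, every linear map `I → A` is a multiplication. -/
theorem exists_mul_eq_of_linearMap {A : Type*} [CommRing A] [IsLocalRing A] [IsNoetherianRing A]
    {t : A} (htm : t ∈ maximalIdeal A) (ht : t ∈ nonZeroDivisors A)
    (hfin : IsFiniteLength A (A ⧸ Ideal.span {t})) {s : A ⧸ Ideal.span {t}}
    (hs : ∀ m ∈ maximalIdeal A, m • s = 0)
    (hsoc : ∀ e : A ⧸ Ideal.span {t}, (∀ m ∈ maximalIdeal A, m • e = 0) →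
      e ∈ Submodule.span A {s})
    {I : Ideal A} (hI : ∀ x, t * x ∈ I → x ∈ I) (f : I →ₗ[A] A) :
    ∃ c : A, ∀ x : I, f x = c * x := by
  let mulI : A →ₗ[A] (I →ₗ[A] A) := (LinearMap.toSpanSingleton A (I →ₗ[A] A) I.subtype)
  have hmulI : ∀ c (x : I), mulI c x = c * x := fun c x => rfl
  suffices h : (⊤ : Submodule A (I →ₗ[A] A)) ≤ LinearMap.range mulI by
    obtain ⟨c, hc⟩ := h (Submodule.mem_top (x := f))
    exact ⟨c, fun x => by rw [← hc, hmulI]⟩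
  refine Submodule.le_of_le_smul_of_le_jacobson_bot (I := Ideal.span {t})
    (IsNoetherian.noetherian _) ?_ ?_
  · refine le_trans ?_ (maximalIdeal_le_jacobson _)
    rwa [Ideal.span_singleton_le_iff_mem]
  -- by Nakayama's lemma, it is enough that `f` minus some multiplication is divisible by `t`; modulo
  -- `t` self-injectivity applies, as `f` induces a map on the image `W` of `I` in `A ⧸ t`
  rintro f -
  let W : Submodule A (A ⧸ Ideal.span {t}) := Submodule.map (Submodule.mkQ _) I
  let p : I →ₗ[A] W := ((Submodule.mkQ (Ideal.span {t})).domRestrict I).codRestrict W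
    fun x => Submodule.mem_map_of_mem x.2
  have hp : Function.Surjective p := by
    rintro ⟨_, x, hx, rfl⟩
    exact ⟨⟨x, hx⟩, rfl⟩
  let f' : I →ₗ[A] (A ⧸ Ideal.span {t}) := (Submodule.mkQ _).comp f
  have hker : LinearMap.ker p ≤ LinearMap.ker f' := by
    intro x hx
    have hx' : (x : A) ∈ Ideal.span {t} := by
      rw [← Ideal.Quotient.eq_zero_iff_mem]
      exact congrArg Subtype.val hx
    obtain ⟨y, hy⟩ := Ideal.mem_span_singleton'.mp hx'
    have hyI : y ∈ I := hI y (by rw [mul_comm, hy]; exact x.2)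
    have : x = t • (⟨y, hyI⟩ : I) := Subtype.ext (by rw [← hy, mul_comm]; rfl)
    rw [this, LinearMap.mem_ker, map_smul]
    change t • Ideal.Quotient.mk (Ideal.span {t}) (f ⟨y, hyI⟩) = 0
    rw [Algebra.smul_def, Ideal.Quotient.algebraMap_eq,
      Ideal.Quotient.eq_zero_iff_mem.mpr (Ideal.mem_span_singleton_self t), zero_mul]
  obtain ⟨c, hc⟩ := exists_smul_eq_of_linearMap hfin hs hsoc
    (((LinearMap.ker p).liftQ f' hker).comp (p.quotKerEquivOfSurjective hp).symm.toLinearMap)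
  have hc' : ∀ x : I, (f - mulI c) x ∈ LinearMap.range (LinearMap.mulLeft A t) := by
    intro x
    have h1 := hc (p x)
    have h2 : (p.quotKerEquivOfSurjective hp).symm (p x) = Submodule.Quotient.mk x := by
      rw [LinearEquiv.symm_apply_eq]
      rfl
    rw [LinearMap.comp_apply, LinearEquiv.coe_coe, h2] at h1
    have h3 : Ideal.Quotient.mk (Ideal.span {t}) (f x - c * x) = 0 := by
      rw [map_sub, sub_eq_zero]
      exact h1
    obtain ⟨y, hy⟩ := Ideal.mem_span_singleton'.mp (Ideal.Quotient.eq_zero_iff_mem.mp h3)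
    exact ⟨y, by rw [LinearMap.mulLeft_apply, mul_comm, hy, LinearMap.sub_apply, hmulI]⟩
  have hinj : Function.Injective (LinearMap.mulLeft A t) := fun a b h =>
    (mul_cancel_left_mem_nonZeroDivisors ht).mp h
  let f₁ : I →ₗ[A] A := (LinearEquiv.ofInjective _ hinj).symm.toLinearMap.comp
    ((f - mulI c).codRestrict _ hc')
  have hf₁ : f = mulI c + t • f₁ := by
    ext x
    have : LinearMap.mulLeft A t (f₁ x) = (f - mulI c) x := congrArg Subtype.val
      ((LinearEquiv.ofInjective _ hinj).apply_symm_apply ⟨(f - mulI c) x, hc' x⟩)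
    rw [LinearMap.add_apply, LinearMap.smul_apply, smul_eq_mul, ← LinearMap.mulLeft_apply (R := A),
      this]
    simp
  rw [hf₁]
  exact Submodule.add_mem_sup ⟨c, rfl⟩
    (Submodule.smul_mem_smul (Ideal.mem_span_singleton_self t) trivial)

/-- The double annihilator theorem over a one-dimensional Gorenstein ring. -/
theorem annihilator_annihilator_le {A : Type*} [CommRing A] [IsLocalRing A] [IsNoetherianRing A]
    {t : A} (htm : t ∈ maximalIdeal A) (ht : t ∈ nonZeroDivisors A)
    (hfin : IsFiniteLength A (A ⧸ Ideal.span {t})) {s : A ⧸ Ideal.span {t}}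
    (hs : ∀ m ∈ maximalIdeal A, m • s = 0)
    (hsoc : ∀ e : A ⧸ Ideal.span {t}, (∀ m ∈ maximalIdeal A, m • e = 0) →
      e ∈ Submodule.span A {s})
    {I : Ideal A} (hI : ∀ x, t * x ∈ I → x ∈ I) :
    I.annihilator.annihilator ≤ I := by
  have hmem : ∀ (I : Ideal A) {x y : A}, x ∈ I.annihilator → y ∈ I → x * y = 0 :=
    fun I x y hx hy => Submodule.mem_annihilator.mp hx y hy
  refine Submodule.le_of_le_smul_of_le_jacobson_bot (I := Ideal.span {t})
    (IsNoetherian.noetherian _) ?_ ?_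
  · refine le_trans ?_ (maximalIdeal_le_jacobson _)
    rwa [Ideal.span_singleton_le_iff_mem]
  -- by Nakayama's lemma, it is enough that `a` lies in `I + t I''`, where `I''` is the double annihilator
  intro a ha
  have hinj : Function.Injective (LinearMap.mulLeft A t) := fun a b h =>
    (mul_cancel_left_mem_nonZeroDivisors ht).mp h
  have haW : Ideal.Quotient.mk (Ideal.span {t}) a ∈
      (Submodule.map (Submodule.mkQ (Ideal.span {t})) I) := by
    refine mem_of_forall_smul_eq_zero hfin hs hsoc fun y hy => ?_
    -- multiplication by `y` on `I` is divisible by `t`; the quotient is a multiplication by `c`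
    have hyI : ∀ x : I, (LinearMap.mulLeft A y).domRestrict I x ∈
        LinearMap.range (LinearMap.mulLeft A t) := by
      intro x
      have h1 := hy _ (Submodule.mem_map_of_mem x.2)
      have h2 : Ideal.Quotient.mk (Ideal.span {t}) (y * x) = 0 := h1
      obtain ⟨z, hz⟩ := Ideal.mem_span_singleton'.mp (Ideal.Quotient.eq_zero_iff_mem.mp h2)
      exact ⟨z, by rw [LinearMap.mulLeft_apply, mul_comm, hz]; rfl⟩
    obtain ⟨c, hc⟩ := exists_mul_eq_of_linearMap htm ht hfin hs hsoc hI
      ((LinearEquiv.ofInjective _ hinj).symm.toLinearMap.comp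
        (((LinearMap.mulLeft A y).domRestrict I).codRestrict _ hyI))
    have h3 : y - t * c ∈ I.annihilator := by
      refine Submodule.mem_annihilator.mpr fun x hx => ?_
      have h4 : LinearMap.mulLeft A t ((LinearEquiv.ofInjective _ hinj).symm
          ⟨_, hyI ⟨x, hx⟩⟩) = y * x := congrArg Subtype.val
        ((LinearEquiv.ofInjective _ hinj).apply_symm_apply ⟨_, hyI ⟨x, hx⟩⟩)
      have h5 : (LinearEquiv.ofInjective _ hinj).symm ⟨_, hyI ⟨x, hx⟩⟩ = c * x := hc ⟨x, hx⟩
      rw [h5, LinearMap.mulLeft_apply] at h4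
      rw [smul_eq_mul, sub_mul, mul_assoc, h4, sub_self]
    have h6 := hmem _ ha h3
    change Ideal.Quotient.mk (Ideal.span {t}) (y * a) = 0
    rw [Ideal.Quotient.eq_zero_iff_mem]
    exact Ideal.mem_span_singleton'.mpr ⟨c * a, by linear_combination -h6⟩
  obtain ⟨i, hi, hia⟩ := haW
  have h7 : a - i ∈ Ideal.span {t} := by
    rw [← Ideal.Quotient.eq_zero_iff_mem, map_sub, sub_eq_zero]
    exact hia.symm
  obtain ⟨b, hb⟩ := Ideal.mem_span_singleton'.mp h7
  have hbI : b ∈ I.annihilator.annihilator := by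
    refine Submodule.mem_annihilator.mpr fun y hy => ?_
    rw [smul_eq_mul]
    apply hinj
    rw [LinearMap.mulLeft_apply, LinearMap.mulLeft_apply, mul_zero]
    linear_combination y * hb + hmem _ ha hy - hmem _ hy hi
  rw [← sub_add_cancel a i, add_comm, ← hb, mul_comm]
  exact Submodule.add_mem_sup hi
    (Submodule.smul_mem_smul (Ideal.mem_span_singleton_self t) hbI)

end GorensteinDuality

/-! ### Modules of finite length over a discrete valuation ring -/

section DVR

variable {O : Type u} [CommRing O] [IsDomain O] [IsDiscreteValuationRing O]

theorem isFiniteLength_of_smul_eq_zero {N : Type*} [AddCommGroup N] [Module O N]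
    [Module.Finite O N] {c : O} (hc : c ≠ 0) (h : ∀ m : N, c • m = 0) : IsFiniteLength O N := by
  obtain ⟨d, f, hf⟩ := Module.Finite.exists_fin' O N
  have h1 : IsFiniteLength O (O ⧸ Ideal.span {c}) := by
    have : Ring.KrullDimLE 1 O := inferInstance
    exact isFiniteLength_quotient_span_singleton O (mem_nonZeroDivisors_of_ne_zero hc)
  obtain ⟨_, _⟩ := isFiniteLength_iff_isNoetherian_isArtinian.mp h1
  have h2 : IsFiniteLength O (Fin d → O ⧸ Ideal.span {c}) :=
    isFiniteLength_iff_isNoetherian_isArtinian.mpr ⟨inferInstance, inferInstance⟩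
  let F : (Fin d → O ⧸ Ideal.span {c}) →ₗ[O] N := LinearMap.lsum O (fun _ => O ⧸ Ideal.span {c}) O
    fun i => Submodule.liftQ _ (LinearMap.toSpanSingleton O N (f (Pi.single i 1))) (by
      rw [Ideal.span, Submodule.span_singleton_le_iff_mem]
      exact h _)
  refine h2.of_surjective (f := F) fun m => ?_
  obtain ⟨v, rfl⟩ := hf m
  refine ⟨fun i => Ideal.Quotient.mk _ (v i), ?_⟩
  conv_rhs => rw [pi_eq_sum_univ' v, map_sum]
  simp only [F, LinearMap.lsum_apply, LinearMap.sum_apply, LinearMap.comp_apply]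
  refine Finset.sum_congr rfl fun i _ => ?_
  rw [map_smul]
  rfl

theorem IsFiniteLength.exists_smul_eq_zero {N : Type*} [AddCommGroup N] [Module O N]
    (h : IsFiniteLength O N) : ∃ c : O, c ≠ 0 ∧ ∀ m : N, c • m = 0 := by
  induction h with
  | of_subsingleton => exact ⟨1, one_ne_zero, fun m => Subsingleton.elim _ _⟩
  | @of_simple_quotient M _ _ N hs _ ih =>
    obtain ⟨c, hc, hN⟩ := ih
    obtain ⟨t, ht⟩ := IsDiscreteValuationRing.exists_irreducible O
    refine ⟨c * t, mul_ne_zero hc ht.ne_zero, fun m => ?_⟩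
    obtain ⟨I, hI, ⟨e⟩⟩ := isSimpleModule_iff_quot_maximal.mp hs
    have hm : t • m ∈ N := by
      rw [← Submodule.Quotient.mk_eq_zero, Submodule.Quotient.mk_smul]
      apply e.injective
      obtain ⟨r, hr⟩ := Ideal.Quotient.mk_surjective (e (Submodule.Quotient.mk m))
      rw [map_smul, map_zero, ← hr, Algebra.smul_def, Ideal.Quotient.algebraMap_eq, ← map_mul,
        Ideal.Quotient.eq_zero_iff_mem, IsLocalRing.eq_maximalIdeal hI]
      exact Ideal.mul_mem_right _ _ ((mem_maximalIdeal _).mpr ht.not_isUnit)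
    rw [mul_smul]
    exact congrArg Subtype.val (hN ⟨t • m, hm⟩)

/-- The length of a quotient of `O^d` is that of `O` modulo the determinants of the matrices of
relations. -/
theorem length_quotient_eq_length_quotient_span_det {d : ℕ} (K : Submodule O (Fin d → O)) {c : O}
    (hc : c ≠ 0) (hK : ∀ v, c • v ∈ K) :
    Module.length O ((Fin d → O) ⧸ K) =
      Module.length O (O ⧸ Ideal.span {r | ∃ V : Matrix (Fin d) (Fin d) O,
        (∀ i, V i ∈ K) ∧ r = V.det}) := by
  classical
  have hrank : Module.finrank O K = Module.finrank O (Fin d → O) := by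
    refine le_antisymm (Submodule.finrank_le K) ?_
    refine LinearMap.finrank_le_finrank_of_injective
      (f := (LinearMap.lsmul O (Fin d → O) c).codRestrict K hK) fun v v' h => ?_
    exact smul_right_injective _ hc (congrArg Subtype.val h)
  -- by the Smith normal form there is a basis `b'` of `O^d` such that the `a i • b' i` are a basis of `K`
  let b := Pi.basisFun O (Fin d)
  let a := Submodule.smithNormalFormCoeffs b hrank
  let b' := Submodule.smithNormalFormTopBasis b hrank
  let ab := Submodule.smithNormalFormBotBasis b hrank
  have hab : ∀ i, (ab i : Fin d → O) = a i • b' i := Submodule.smithNormalFormBotBasis_def b hrank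
  have ha : ∀ i, a i ≠ 0 := Submodule.smithNormalFormCoeffs_ne_zero b hrank
  let P : Matrix (Fin d) (Fin d) O := Matrix.of fun i j => b' i j
  have hP : IsUnit P.det := by
    have h1 := b.isUnit_det b'
    rw [Module.Basis.det_apply, ← Matrix.det_transpose] at h1
    convert h1 using 2
    ext i j
    simp [P, b, Module.Basis.toMatrix_apply]
  have hspan : Ideal.span {r | ∃ V : Matrix (Fin d) (Fin d) O, (∀ i, V i ∈ K) ∧ r = V.det} =
      Ideal.span {∏ i, a i} := by
    apply le_antisymm
    · rw [Ideal.span_le]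
      rintro _ ⟨V, hV, rfl⟩
      have hV' : V = Matrix.of (fun i j => ab.repr ⟨V i, hV i⟩ j) * Matrix.diagonal a * P := by
        ext i k
        have h1 := congrArg Subtype.val (ab.sum_repr ⟨V i, hV i⟩)
        have h2 := congrFun h1 k
        simp only [AddSubmonoidClass.coe_finsetSum, Submodule.coe_smul, hab, Finset.sum_apply,
          Pi.smul_apply, smul_eq_mul] at h2
        rw [Matrix.mul_apply, ← h2]
        refine Finset.sum_congr rfl fun j _ => ?_
        simp only [Matrix.mul_diagonal, Matrix.of_apply, P]
        ring
      rw [SetLike.mem_coe, Ideal.mem_span_singleton, hV', Matrix.det_mul, Matrix.det_mul,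
        Matrix.det_diagonal]
      exact (Dvd.intro_left _ rfl).mul_right _
    · rw [Ideal.span_singleton_le_iff_mem]
      have h1 : (Matrix.diagonal a * P).det ∈ Ideal.span {r | ∃ V : Matrix (Fin d) (Fin d) O,
          (∀ i, V i ∈ K) ∧ r = V.det} := by
        refine Ideal.subset_span ⟨_, fun i => ?_, rfl⟩
        have : (Matrix.diagonal a * P) i = ab i := by
          rw [hab]
          ext j
          simp [P, Matrix.diagonal_mul]
        rw [this]
        exact (ab i).2
      rw [Matrix.det_mul, Matrix.det_diagonal] at h1
      exact (Ideal.mul_unit_mem_iff_mem _ hP).mp h1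
  rw [hspan, (Submodule.quotientEquivPiSpan K b hrank).length_eq, Module.length_pi_of_fintype]
  have hord : ∀ s : Finset (Fin d), Ring.ord O (∏ i ∈ s, a i) = ∑ i ∈ s, Ring.ord O (a i) := by
    intro s
    induction s using Finset.induction_on with
    | empty => simp
    | insert i s hi ih =>
      rw [Finset.prod_insert hi, Finset.sum_insert hi, Ring.ord_mul O
        (mem_nonZeroDivisors_of_ne_zero (Finset.prod_ne_zero_iff.mpr fun j _ => ha j)), ih]
  exact (hord Finset.univ).symm

variable {B : Type v} [CommRing B] [Algebra O B] (π : B →ₐ[O] O)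

/-- `E/O` is divisible. -/
theorem EModO.exists_smul_eq {a : O} (ha : a ≠ 0) (m : EModO π) : ∃ m' : EModO π, a • m' = m := by
  obtain ⟨x, rfl⟩ := Submodule.Quotient.mk_surjective _ m
  refine ⟨Submodule.Quotient.mk ((algebraMap O (FractionRing O) a)⁻¹ * x), ?_⟩
  have h : a • ((algebraMap O (FractionRing O) a)⁻¹ * x) = x := by
    rw [Algebra.smul_def, mul_inv_cancel_left₀]
    exact (map_ne_zero_iff _ (IsFractionRing.injective O (FractionRing O))).mpr ha
  exact (Submodule.Quotient.mk_smul _ a _).symm.trans (congrArg _ h)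

/-- `E/O` is injective. -/
theorem EModO.baer : Module.Baer O (EModO π) := by
  intro I g
  obtain ⟨a, rfl⟩ := IsPrincipalIdealRing.principal I
  by_cases ha : a = 0
  · refine ⟨0, fun x hx => ?_⟩
    have hx0 : (⟨x, hx⟩ : Submodule.span O {a}) = 0 := by
      rw [ha, Submodule.span_zero_singleton, Submodule.mem_bot] at hx
      exact Subtype.ext hx
    rw [hx0, map_zero, LinearMap.zero_apply]
  · obtain ⟨m, hm⟩ := EModO.exists_smul_eq π ha (g ⟨a, Submodule.mem_span_singleton_self a⟩)
    refine ⟨LinearMap.toSpanSingleton O _ m, fun x hx => ?_⟩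
    obtain ⟨r, rfl⟩ := Submodule.mem_span_singleton.mp hx
    have : (⟨r • a, hx⟩ : Submodule.span O {a}) =
        r • ⟨a, Submodule.mem_span_singleton_self a⟩ := rfl
    rw [this, map_smul g, ← hm, LinearMap.toSpanSingleton_apply, smul_assoc]

/-- The functor `Hom(-, E/O)` preserves lengths. -/
theorem length_linearMap_EModO {N : Type*} [AddCommGroup N] [Module O N]
    (hN : IsFiniteLength O N) : Module.length O (N →ₗ[O] EModO π) = Module.length O N := by
  obtain ⟨t, ht⟩ := IsDiscreteValuationRing.exists_irreducible O
  have htK : algebraMap O (FractionRing O) t ≠ 0 :=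
    (map_ne_zero_iff _ (IsFractionRing.injective O (FractionRing O))).mpr ht.ne_zero
  have hmk : ∀ x : FractionRing O, (Submodule.Quotient.mk x : EModO π) = 0 ↔
      ∃ r : O, algebraMap O (FractionRing O) r = x := fun x =>
    (Submodule.Quotient.mk_eq_zero _).trans Iff.rfl
  -- the socle of `E/O` is generated by `1/t`
  let s : EModO π := Submodule.Quotient.mk (algebraMap O (FractionRing O) t)⁻¹
  have hs : ∀ m ∈ maximalIdeal O, m • s = 0 := by
    intro m hm
    rw [ht.maximalIdeal_eq, Ideal.mem_span_singleton'] at hm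
    obtain ⟨r, rfl⟩ := hm
    refine (hmk _).mpr ⟨r, ?_⟩
    change _ = (r * t) • _
    rw [Algebra.smul_def, map_mul, mul_assoc, mul_inv_cancel₀ htK, mul_one]
  have hs0 : s ≠ 0 := by
    intro h
    obtain ⟨r, hr⟩ := (hmk _).mp h
    apply ht.not_isUnit
    refine IsUnit.of_mul_eq_one r (IsFractionRing.injective O (FractionRing O) ?_)
    rw [map_mul, hr, map_one, mul_inv_cancel₀ htK]
  have hsoc : ∀ e : EModO π, (∀ m ∈ maximalIdeal O, m • e = 0) → e ∈ Submodule.span O {s} := by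
    intro e he
    obtain ⟨x, rfl⟩ := Submodule.Quotient.mk_surjective _ e
    obtain ⟨r, hr⟩ := (hmk _).mp (he t ((mem_maximalIdeal _).mpr ht.not_isUnit))
    refine Submodule.mem_span_singleton.mpr ⟨r, ?_⟩
    refine (Submodule.Quotient.mk_smul _ r _).symm.trans (congrArg _ ?_)
    change _ = t • x at hr
    rw [Algebra.smul_def, hr, Algebra.smul_def, mul_comm, inv_mul_cancel_left₀ htK]
  induction hN with
  | of_subsingleton => simp
  | @of_simple_quotient M _ _ N hsimple hN ih =>
    have h1 : Module.length O (M →ₗ[O] EModO π) =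
        Module.length O ((M ⧸ N) →ₗ[O] EModO π) + Module.length O (N →ₗ[O] EModO π) := by
      refine Module.length_eq_add_of_exact (LinearMap.lcomp O _ N.mkQ)
        (LinearMap.lcomp O _ N.subtype) ?_ ?_ ?_
      · intro f g hfg
        exact Submodule.linearMap_qext _ hfg
      · intro f
        exact (EModO.baer π).extension_property N.subtype N.subtype_injective f
      · intro f
        constructor
        · intro hf
          refine ⟨N.liftQ f fun n hn => LinearMap.congr_fun hf ⟨n, hn⟩, ?_⟩
          ext m
          rfl
        · rintro ⟨g, rfl⟩
          ext n
          change g (Submodule.Quotient.mk (n : M)) = 0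
          rw [(Submodule.Quotient.mk_eq_zero N).mpr n.2, map_zero]
    have h2 : Module.length O M = Module.length O (M ⧸ N) + Module.length O N := by
      rw [add_comm]
      exact Module.length_eq_add_of_exact N.subtype N.mkQ N.subtype_injective N.mkQ_surjective
        (LinearMap.exact_subtype_mkQ N)
    have hfl : IsFiniteLength O (M ⧸ N) :=
      isFiniteLength_iff_isNoetherian_isArtinian.mpr ⟨inferInstance, inferInstance⟩
    have h3 := length_linearMap_le hs hsoc hfl
    rw [Module.length_eq_one O (M ⧸ N)] at h3 h2
    have h4 : Module.length O ((M ⧸ N) →ₗ[O] EModO π) ≠ 0 := by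
      rw [Ne, Module.length_eq_zero_iff, not_subsingleton_iff_nontrivial]
      obtain ⟨m, hm, ⟨e⟩⟩ := isSimpleModule_iff_quot_maximal.mp hsimple
      have hmm := IsLocalRing.eq_maximalIdeal hm
      let F : (O ⧸ m) →ₗ[O] EModO π := m.liftQ (LinearMap.toSpanSingleton O _ s)
        fun r hr => hs r (hmm ▸ hr)
      refine ⟨F.comp e.toLinearMap, 0, fun h => hs0 ?_⟩
      have h5 := LinearMap.congr_fun h (e.symm (Ideal.Quotient.mk m 1))
      rw [LinearMap.comp_apply, LinearEquiv.coe_coe, e.apply_symm_apply] at h5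
      have h6 : (1 : O) • s = 0 := h5
      rwa [one_smul] at h6
    rw [h1, h2, ih, le_antisymm h3 (Order.one_le_iff_ne_zero.mpr h4)]

end DVR

/-! ### Power series rings over a discrete valuation ring -/

section PowerSeries

set_option linter.unusedSectionVars false

open RingTheory.Sequence

variable {O : Type u} [CommRing O]

/-- Setting the first variable equal to zero. -/
def setFirstVarZero (n : ℕ) : MvPowerSeries (Fin (n + 1)) O →+* MvPowerSeries (Fin n) O :=
  (PowerSeries.constantCoeff).comp (MvPowerSeries.finSuccEquiv O n : _ →+* _)

theorem setFirstVarZero_surjective (n : ℕ) :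
    Function.Surjective (setFirstVarZero (O := O) n) := by
  intro p
  refine ⟨(MvPowerSeries.finSuccEquiv O n).symm (PowerSeries.C p), ?_⟩
  simp [setFirstVarZero]

theorem setFirstVarZero_X_zero (n : ℕ) :
    setFirstVarZero (O := O) n (MvPowerSeries.X 0) = 0 := by
  simp [setFirstVarZero]

theorem setFirstVarZero_X_succ (n : ℕ) (i : Fin n) :
    setFirstVarZero (O := O) n (MvPowerSeries.X i.succ) = MvPowerSeries.X i := by
  simp [setFirstVarZero]

theorem ker_setFirstVarZero (n : ℕ) :
    RingHom.ker (setFirstVarZero (O := O) n) = Ideal.span {MvPowerSeries.X 0} := by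
  apply le_antisymm
  · intro p hp
    rw [RingHom.mem_ker, setFirstVarZero, RingHom.comp_apply, ← PowerSeries.X_dvd_iff] at hp
    obtain ⟨q, hq⟩ := hp
    rw [Ideal.mem_span_singleton']
    refine ⟨(MvPowerSeries.finSuccEquiv O n).symm q, ?_⟩
    apply (MvPowerSeries.finSuccEquiv O n).injective
    rw [map_mul, AlgEquiv.apply_symm_apply, MvPowerSeries.finSuccEquiv_X_zero, mul_comm]
    exact hq.symm
  · rw [Ideal.span_singleton_le_iff_mem, RingHom.mem_ker, setFirstVarZero_X_zero]

theorem constantCoeff_setFirstVarZero (n : ℕ) (p : MvPowerSeries (Fin (n + 1)) O) :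
    MvPowerSeries.constantCoeff (setFirstVarZero n p) = MvPowerSeries.constantCoeff p := by
  have h := MvPowerSeries.coeff_coeff_finSuccEquiv (R := O) p (k := 0) (x := 0)
  simp only [setFirstVarZero, RingHom.comp_apply]
  rw [← MvPowerSeries.coeff_zero_eq_constantCoeff_apply,
    ← MvPowerSeries.coeff_zero_eq_constantCoeff_apply, ← PowerSeries.coeff_zero_eq_constantCoeff_apply]
  refine Eq.trans h ?_
  congr 2
  simp

theorem ker_constantCoeff_eq_span_X (n : ℕ) :
    RingHom.ker (MvPowerSeries.constantCoeff (σ := Fin n) (R := O)) =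
      Ideal.span (Set.range MvPowerSeries.X) := by
  induction n with
  | zero =>
    rw [Set.range_eq_empty, Ideal.span_empty]
    exact (RingHom.injective_iff_ker_eq_bot _).mp (MvPowerSeries.isEmptyEquiv (Fin 0) O).injective
  | succ n ih =>
    have h1 : RingHom.ker (MvPowerSeries.constantCoeff (σ := Fin (n + 1)) (R := O)) =
        (Ideal.span (Set.range (MvPowerSeries.X (σ := Fin n)))).comap (setFirstVarZero n) := by
      rw [← ih]
      ext p
      rw [RingHom.mem_ker, Ideal.mem_comap, RingHom.mem_ker, constantCoeff_setFirstVarZero]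
    have h2 : Ideal.span (Set.range (MvPowerSeries.X (σ := Fin n))) =
        (Ideal.span (Set.range fun i : Fin n => MvPowerSeries.X (R := O) i.succ)).map
          (setFirstVarZero n) := by
      rw [Ideal.map_span, ← Set.range_comp]
      congr 2
      funext i
      exact (setFirstVarZero_X_succ n i).symm
    rw [h1, h2, Ideal.comap_map_of_surjective _ (setFirstVarZero_surjective n),
      ← RingHom.ker_eq_comap_bot, ker_setFirstVarZero, ← Ideal.span_union]
    congr 1
    ext p
    simp only [Set.mem_union, Set.mem_range, Set.mem_singleton_iff, Fin.exists_fin_succ]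
    tauto

theorem isWeaklyRegular_X (n : ℕ) :
    IsWeaklyRegular (MvPowerSeries (Fin n) O)
      (List.ofFn fun i : Fin n => MvPowerSeries.X (R := O) i) := by
  induction n with
  | zero => simp
  | succ n ih =>
    rw [← isWeaklyRegular_quotient_bot_iff, List.ofFn_succ, isWeaklyRegular_quotient_cons_iff]
    constructor
    · intro a ha
      rw [Ideal.mem_bot] at ha ⊢
      exact (MvPowerSeries.X_mem_nonzeroDivisors (R := O) (i := (0 : Fin (n + 1)))).2 a ha
    · rw [bot_sup_eq, ← ker_setFirstVarZero, RingHom.ker_eq_comap_bot,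
        isWeaklyRegular_quotient_comap_iff _ (setFirstVarZero_surjective n), List.map_ofFn,
        isWeaklyRegular_quotient_bot_iff]
      have h : (setFirstVarZero n ∘ fun i : Fin n => MvPowerSeries.X (R := O) i.succ) =
          fun i => MvPowerSeries.X i := funext fun i => setFirstVarZero_X_succ n i
      rw [h]
      exact ih

variable [IsDomain O] [IsDiscreteValuationRing O]

theorem maximalIdeal_mvPowerSeries (n : ℕ) {t : O} (ht : Irreducible t) :
    maximalIdeal (MvPowerSeries (Fin n) O) =
      Ideal.span (Set.range MvPowerSeries.X) ⊔ Ideal.span {MvPowerSeries.C t} := by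
  have hmem : ∀ p : MvPowerSeries (Fin n) O, p ∈ maximalIdeal (MvPowerSeries (Fin n) O) ↔
      MvPowerSeries.constantCoeff p ∈ maximalIdeal O := by
    intro p
    rw [mem_maximalIdeal, mem_maximalIdeal, mem_nonunits_iff, mem_nonunits_iff,
      MvPowerSeries.isUnit_iff_constantCoeff]
  apply le_antisymm
  · intro p hp
    rw [hmem, ht.maximalIdeal_eq, Ideal.mem_span_singleton'] at hp
    obtain ⟨c, hc⟩ := hp
    have h1 : p - MvPowerSeries.C (c * t) ∈
        RingHom.ker (MvPowerSeries.constantCoeff (σ := Fin n) (R := O)) := by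
      rw [RingHom.mem_ker, map_sub, MvPowerSeries.constantCoeff_C, hc, sub_self]
    rw [ker_constantCoeff_eq_span_X] at h1
    have h2 : p = (p - MvPowerSeries.C (c * t)) + MvPowerSeries.C c * MvPowerSeries.C t := by
      rw [map_mul]; ring
    rw [h2]
    exact Submodule.add_mem_sup h1 (Ideal.mul_mem_left _ _ (Ideal.mem_span_singleton_self _))
  · rw [← ker_constantCoeff_eq_span_X]
    refine sup_le ?_ ?_
    · intro p hp
      rw [hmem, RingHom.mem_ker.mp hp]
      exact zero_mem _
    · rw [Ideal.span_singleton_le_iff_mem, hmem, MvPowerSeries.constantCoeff_C]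
      exact (mem_maximalIdeal _).mpr ht.not_isUnit

theorem isWeaklyRegular_X_append (n : ℕ) {t : O} (ht : Irreducible t) :
    IsWeaklyRegular (MvPowerSeries (Fin n) O)
      (List.ofFn (fun i : Fin n => MvPowerSeries.X (R := O) i) ++ [MvPowerSeries.C t]) := by
  rw [← isWeaklyRegular_quotient_bot_iff, isWeaklyRegular_quotient_append_iff,
    isWeaklyRegular_quotient_bot_iff, ofList_ofFn, bot_sup_eq, ← ker_constantCoeff_eq_span_X,
    isWeaklyRegular_quotient_singleton_iff]
  refine ⟨isWeaklyRegular_X n, fun a ha => ?_⟩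
  rw [RingHom.mem_ker, map_mul, MvPowerSeries.constantCoeff_C] at ha
  exact (mul_eq_zero.mp ha).resolve_right ht.ne_zero

theorem ringKrullDim_mvPowerSeries (n : ℕ) :
    ringKrullDim (MvPowerSeries (Fin n) O) = n + 1 := by
  obtain ⟨t, ht⟩ := IsDiscreteValuationRing.exists_irreducible O
  have hm : Ideal.ofList (List.ofFn (fun i : Fin n => MvPowerSeries.X (R := O) i) ++
      [MvPowerSeries.C (σ := Fin n) t]) =
      maximalIdeal (MvPowerSeries (Fin n) O) := by
    rw [Ideal.ofList_append, ofList_ofFn, Ideal.ofList_singleton, maximalIdeal_mvPowerSeries n ht]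
  have hreg := RingTheory.Sequence.IsRegular.of_isWeaklyRegular_of_mem_maximalIdeal _
    (fun r hr => hm.le (Ideal.subset_span hr)) (isWeaklyRegular_X_append n ht)
  have h := ringKrullDim_add_length_eq_ringKrullDim_of_isRegular _ hreg
  rw [hm, ringKrullDim_eq_zero_of_isField
    ((Ideal.Quotient.maximal_ideal_iff_isField_quotient _).mp (maximalIdeal.isMaximal _))] at h
  rw [← h]
  simp

variable {n : ℕ} (ε : MvPowerSeries (Fin n) O →ₐ[O] O)

/-- The variables of a power series ring, translated so that they are killed by the
augmentation `ε`. -/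
def augVar (i : Fin n) : MvPowerSeries (Fin n) O :=
  MvPowerSeries.X i - MvPowerSeries.C (ε (MvPowerSeries.X i))

theorem aug_C (a : O) : ε (MvPowerSeries.C a) = a := ε.commutes a

theorem aug_augVar (i : Fin n) : ε (augVar ε i) = 0 := by
  rw [augVar, map_sub, aug_C, sub_self]

theorem aug_X_mem_maximalIdeal (i : Fin n) : ε (MvPowerSeries.X i) ∈ maximalIdeal O := by
  rw [mem_maximalIdeal, mem_nonunits_iff]
  intro h
  have h1 : IsUnit (augVar ε i) := by
    rw [MvPowerSeries.isUnit_iff_constantCoeff, augVar, map_sub, MvPowerSeries.constantCoeff_X,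
      MvPowerSeries.constantCoeff_C, zero_sub]
    exact h.neg
  have h2 := h1.map ε
  rw [aug_augVar] at h2
  exact not_isUnit_zero h2

theorem X_sub_augVar_mem (i : Fin n) {t : O} (ht : Irreducible t) :
    MvPowerSeries.X i - augVar ε i ∈ Ideal.span {MvPowerSeries.C (σ := Fin n) t} := by
  have h := aug_X_mem_maximalIdeal ε i
  rw [ht.maximalIdeal_eq, Ideal.mem_span_singleton'] at h
  obtain ⟨c, hc⟩ := h
  rw [augVar, sub_sub_cancel, ← hc, map_mul]
  exact Ideal.mul_mem_left _ _ (Ideal.mem_span_singleton_self _)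

theorem span_augVar_sup {t : O} (ht : Irreducible t) :
    Ideal.span (Set.range (augVar ε)) ⊔ Ideal.span {MvPowerSeries.C t} =
      maximalIdeal (MvPowerSeries (Fin n) O) := by
  rw [maximalIdeal_mvPowerSeries n ht]
  apply le_antisymm <;> refine sup_le ?_ le_sup_right <;> rw [Ideal.span_le] <;>
    rintro _ ⟨i, rfl⟩
  · rw [show augVar ε i = MvPowerSeries.X i - (MvPowerSeries.X i - augVar ε i) by ring]
    exact sub_mem (Ideal.mem_sup_left (Ideal.subset_span ⟨i, rfl⟩))
      (Ideal.mem_sup_right (X_sub_augVar_mem ε i ht))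
  · rw [show MvPowerSeries.X i = augVar ε i + (MvPowerSeries.X i - augVar ε i) by ring]
    exact Submodule.add_mem_sup (Ideal.subset_span ⟨i, rfl⟩) (X_sub_augVar_mem ε i ht)

theorem augVar_mem_maximalIdeal (i : Fin n) :
    augVar ε i ∈ maximalIdeal (MvPowerSeries (Fin n) O) := by
  obtain ⟨t, ht⟩ := IsDiscreteValuationRing.exists_irreducible O
  rw [← span_augVar_sup ε ht]
  exact Ideal.mem_sup_left (Ideal.subset_span ⟨i, rfl⟩)

/-- The translated variables together with a uniformizer form a regular system of parameters. -/
theorem isWeaklyRegular_augVar_append {t : O} (ht : Irreducible t) :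
    IsWeaklyRegular (MvPowerSeries (Fin n) O)
      (List.ofFn (augVar ε) ++ [MvPowerSeries.C t]) := by
  have hX : ∀ r ∈ List.ofFn (fun i : Fin n => MvPowerSeries.X (R := O) i) ++
      [MvPowerSeries.C (σ := Fin n) t],
      r ∈ maximalIdeal (MvPowerSeries (Fin n) O) := by
    intro r hr
    rw [maximalIdeal_mvPowerSeries n ht]
    rw [List.mem_append, List.mem_ofFn, List.mem_singleton] at hr
    rcases hr with ⟨i, rfl⟩ | rfl
    · exact Ideal.mem_sup_left (Ideal.subset_span ⟨i, rfl⟩)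
    · exact Ideal.mem_sup_right (Ideal.mem_span_singleton_self _)
  have h1 := (isWeaklyRegular_quotient_bot_iff _).mpr (isWeaklyRegular_X_append n ht)
  have h2 := IsWeaklyRegular.perm_mod h1 (List.perm_append_singleton _ _) hX
  rw [isWeaklyRegular_quotient_cons_iff] at h2
  have h3 : IsWeaklyRegular (MvPowerSeries (Fin n) O ⧸ (⊥ : Ideal (MvPowerSeries (Fin n) O)))
      (MvPowerSeries.C t :: List.ofFn (augVar ε)) := by
    rw [isWeaklyRegular_quotient_cons_iff]
    refine ⟨h2.1, IsWeaklyRegular.congr_mod ?_ h2.2⟩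
    rw [List.forall₂_iff_get]
    refine ⟨by simp, fun i h h' => ?_⟩
    simp only [List.get_eq_getElem, List.getElem_ofFn]
    exact Ideal.mem_sup_right (X_sub_augVar_mem ε _ ht)
  rw [← isWeaklyRegular_quotient_bot_iff]
  refine IsWeaklyRegular.perm_mod h3 (List.perm_append_singleton _ _).symm ?_
  intro r hr
  rw [List.mem_cons, List.mem_ofFn] at hr
  rcases hr with rfl | ⟨i, rfl⟩
  · exact hX _ (by simp)
  · exact augVar_mem_maximalIdeal ε i

theorem isWeaklyRegular_augVar :
    IsWeaklyRegular (MvPowerSeries (Fin n) O) (List.ofFn (augVar ε)) := by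
  obtain ⟨t, ht⟩ := IsDiscreteValuationRing.exists_irreducible O
  have h := isWeaklyRegular_augVar_append ε ht
  rw [← isWeaklyRegular_quotient_bot_iff, isWeaklyRegular_quotient_append_iff] at h
  exact (isWeaklyRegular_quotient_bot_iff _).mp h.1

/-- The kernel of an augmentation of a power series ring is generated by the translated
variables. -/
theorem ker_aug_eq_span_augVar : RingHom.ker ε = Ideal.span (Set.range (augVar ε)) := by
  obtain ⟨t, ht⟩ := IsDiscreteValuationRing.exists_irreducible O
  have hle : Ideal.span (Set.range (augVar ε)) ≤ RingHom.ker ε := by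
    rw [Ideal.span_le]
    rintro _ ⟨i, rfl⟩
    exact aug_augVar ε i
  refine le_antisymm ?_ hle
  refine Submodule.le_of_le_smul_of_le_jacobson_bot
    (I := Ideal.span {MvPowerSeries.C t}) (IsNoetherian.noetherian _) ?_ ?_
  · rw [jacobson_eq_maximalIdeal _ bot_ne_top, ← span_augVar_sup ε ht]
    exact le_sup_right
  · intro y hy
    have hy2 : y ∈ maximalIdeal (MvPowerSeries (Fin n) O) :=
      le_maximalIdeal (RingHom.ker_ne_top _) hy
    rw [← span_augVar_sup ε ht, Submodule.mem_sup] at hy2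
    obtain ⟨q, hq, z, hz, rfl⟩ := hy2
    obtain ⟨z', rfl⟩ := Ideal.mem_span_singleton'.mp hz
    refine Submodule.add_mem_sup hq ?_
    rw [mul_comm]
    refine Submodule.smul_mem_smul (Ideal.mem_span_singleton_self _) ?_
    have h : ε (q + z' * MvPowerSeries.C t) = 0 := hy
    rw [map_add, RingHom.mem_ker.mp (hle hq), zero_add, map_mul, aug_C] at h
    exact (mul_eq_zero.mp h).resolve_right ht.ne_zero

end PowerSeries

/-! ### Derivations along an augmentation and their extension -/

section AugDer

variable {O : Type u} [CommRing O] {R : Type v} [CommRing R] [Algebra O R]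

/-- The `O`-linear maps `h : J → M` with `h (a j) = χ(a) h(j)`, that is, the homomorphisms from
`J / (ker χ) J` to `M`, for an ideal `J` of an `O`-algebra with an augmentation `χ`. -/
def AugHom (χ : R →ₐ[O] O) (J : Ideal R) (M : Type w) [AddCommGroup M] [Module O M] :
    Submodule O (J →ₗ[O] M) where
  carrier := {h | ∀ (a : R) (j : J), h (a • j) = χ a • h j}
  zero_mem' := fun a j => by simp
  add_mem' := fun {h h'} H H' a j => by
    rw [LinearMap.add_apply, LinearMap.add_apply, H a j, H' a j, smul_add]
  smul_mem' := fun c h H a j => by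
    rw [LinearMap.smul_apply, LinearMap.smul_apply, H a j, smul_comm]

/-- The `O`-linear derivations from an `O`-algebra `R` to an `O`-module `M`, on which `R` acts
through an augmentation `χ`. -/
def AugDer (χ : R →ₐ[O] O) (M : Type w) [AddCommGroup M] [Module O M] :
    Submodule O (R →ₗ[O] M) where
  carrier := {D | ∀ a b : R, D (a * b) = χ a • D b + χ b • D a}
  zero_mem' := fun a b => by simp
  add_mem' := fun {D D'} H H' a b => by
    simp only [LinearMap.add_apply, H a b, H' a b, smul_add]
    abel
  smul_mem' := fun c D H a b => by
    simp only [LinearMap.smul_apply, H a b, smul_add, smul_comm c]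

variable {χ : R →ₐ[O] O} {M : Type w} [AddCommGroup M] [Module O M]

theorem AugDer.map_one {D : R →ₗ[O] M} (hD : D ∈ AugDer χ M) : D 1 = 0 := by
  have h := hD 1 1
  rw [mul_one, _root_.map_one χ, one_smul] at h
  exact left_eq_add.mp h

theorem AugDer.map_algebraMap {D : R →ₗ[O] M} (hD : D ∈ AugDer χ M) (r : O) :
    D (algebraMap O R r) = 0 := by
  rw [Algebra.algebraMap_eq_smul_one, map_smul, AugDer.map_one hD, smul_zero]

/-- Restriction of derivations to an ideal contained in the kernel of the augmentation. -/
def AugDer.restrict {J : Ideal R} (hJ : J ≤ RingHom.ker χ) : AugDer χ M →ₗ[O] AugHom χ J M where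
  toFun D := ⟨D.1.comp (J.subtype.restrictScalars O), fun a j => by
    have h : χ (j : R) = 0 := hJ j.2
    change D.1 (a * (j : R)) = χ a • D.1 (j : R)
    rw [D.2, h, zero_smul, add_zero]⟩
  map_add' D D' := rfl
  map_smul' c D := rfl

/-- A derivation is determined by its restriction to the kernel of the augmentation, which may be
prescribed. -/
def AugDer.equivAugHom : AugDer χ M ≃ₗ[O] AugHom χ (RingHom.ker χ) M where
  __ := AugDer.restrict le_rfl
  invFun h :=
    ⟨{ toFun := fun a => h.1 ⟨a - algebraMap O R (χ a), by simp [RingHom.mem_ker]⟩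
       map_add' := fun a b => by
        rw [← map_add]
        congr 1
        ext
        simp only [map_add, Submodule.coe_add]
        ring
       map_smul' := fun c a => by
        rw [RingHom.id_apply, ← map_smul]
        congr 1
        ext
        simp only [map_mul, Submodule.coe_smul_of_tower, Algebra.smul_def, AlgHom.commutes,
          Algebra.algebraMap_self_apply]
        ring }, fun a b => by
      change h.1 _ = χ a • h.1 _ + χ b • h.1 _
      have h2 : χ b • h.1 ⟨a - algebraMap O R (χ a), by simp [RingHom.mem_ker]⟩ =
        h.1 (algebraMap O R (χ b) • ⟨a - algebraMap O R (χ a), by simp [RingHom.mem_ker]⟩) := by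
          rw [h.2, show χ (algebraMap O R (χ b)) = χ b from χ.commutes _]
      rw [h2, ← h.2, ← map_add]
      congr 1
      ext
      simp only [map_mul, Submodule.coe_add, Submodule.coe_smul, smul_eq_mul]
      ring⟩
  left_inv D := by
    ext a
    change D.1 (a - algebraMap O R (χ a)) = D.1 a
    rw [map_sub, AugDer.map_algebraMap D.2, sub_zero]
  right_inv h := by
    ext a
    change h.1 _ = h.1 a
    congr 1
    ext
    have h : χ (a : R) = 0 := a.2
    simp [h]

/-- Koszul's lemma in degree one: a relation between the members of a regular sequence is a
combination of the Koszul relations. -/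
theorem exists_koszul_of_isWeaklyRegular {R : Type v} [CommRing R] {n : ℕ} {x : Fin n → R}
    (hx : RingTheory.Sequence.IsWeaklyRegular R (List.ofFn x)) {r : Fin n → R}
    (hr : ∑ i, r i * x i = 0) :
    ∃ t : Fin n → Fin n → R, ∀ j, r j = ∑ i, (t i j - t j i) * x i := by
  let W : Submodule R (Fin n → R) :=
    { carrier := {r | ∃ t : Fin n → Fin n → R, ∀ j, r j = ∑ i, (t i j - t j i) * x i}
      zero_mem' := ⟨0, fun j => by simp⟩
      add_mem' := by
        rintro a b ⟨t, ht⟩ ⟨t', ht'⟩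
        refine ⟨t + t', fun j => ?_⟩
        rw [Pi.add_apply, ht, ht', ← Finset.sum_add_distrib]
        refine Finset.sum_congr rfl fun i _ => ?_
        simp only [Pi.add_apply]
        ring
      smul_mem' := by
        rintro c a ⟨t, ht⟩
        refine ⟨c • t, fun j => ?_⟩
        rw [Pi.smul_apply, ht, Finset.smul_sum]
        refine Finset.sum_congr rfl fun i _ => ?_
        simp only [Pi.smul_apply, smul_eq_mul]
        ring }
  have h := sum_smul_eq_zero_of_isWeaklyRegular hx (N := (Fin n → R) ⧸ W)
    (v := fun j => W.mkQ (Pi.single j 1)) (fun i j => by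
      rw [← map_smul, ← map_smul, ← sub_eq_zero, ← map_sub, Submodule.mkQ_apply,
        Submodule.Quotient.mk_eq_zero]
      refine ⟨fun a b => if a = i ∧ b = j then 1 else 0, fun b => ?_⟩
      simp only [Pi.sub_apply, Pi.smul_apply, smul_eq_mul, sub_mul, Finset.sum_sub_distrib,
        Pi.single_apply, ite_and, ite_mul, one_mul, zero_mul, mul_ite, mul_one, mul_zero]
      congr 1 <;> simp) hr
  simp only [← map_smul] at h
  rw [← map_sum, Submodule.mkQ_apply, Submodule.Quotient.mk_eq_zero] at h
  have h3 : ∑ i, r i • (Pi.single i 1 : Fin n → R) = r := by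
    rw [← pi_eq_sum_univ' r]
  rwa [h3] at h

end AugDer

section Extend

variable {O : Type u} [CommRing O] {A P : Type*} [CommRing A] [Algebra O A] [CommRing P]
  [Algebra O P] {R : Type*} [CommRing R] {M : Type w} [AddCommGroup M] [Module O M] {n : ℕ}

/-- A linear system over a domain with nonzero determinant can be solved in a divisible module. -/
theorem exists_sum_smul_eq (hM : ∀ a : O, a ≠ 0 → ∀ m : M, ∃ m', a • m' = m)
    (N : Matrix (Fin n) (Fin n) O) (hN : N.det ≠ 0) (y : Fin n → M) :
    ∃ m : Fin n → M, ∀ i, ∑ j, N i j • m j = y i := by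
  choose z hz using fun i => hM N.det hN (y i)
  refine ⟨fun j => ∑ k, N.adjugate j k • z k, fun i => ?_⟩
  simp only [Finset.smul_sum, smul_smul]
  rw [Finset.sum_comm]
  simp only [← Finset.sum_smul]
  have h : ∀ k, ∑ j, N i j * N.adjugate j k = if i = k then N.det else 0 := by
    intro k
    rw [← Matrix.mul_apply, Matrix.mul_adjugate, Matrix.smul_apply, Matrix.one_apply]
    simp
  simp only [h, ite_smul, zero_smul, Finset.sum_ite_eq, Finset.mem_univ, if_true, hz]

/-- The vanishing of `Der¹_O(A, M)` for a divisible module `M` and a complete intersection `A` with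
finite cotangent space: for any presentation `q : P → A`, every homomorphism from `ker q`
extends to a derivation of `P`. The derivation is prescribed on lifts of the generators of the
kernel of the augmentation by solving the linear system of the Jacobian matrix `N`; it is
well defined because the only relations between the generators of that kernel come from Koszul
relations and from the equations `f = N x`. -/
theorem exists_augDer_extend (hM : ∀ a : O, a ≠ 0 → ∀ m : M, ∃ m', a • m' = m)
    {ψ : R →+* A} (hψ : Function.Surjective ψ) {x f : Fin n → R}
    (hx : RingTheory.Sequence.IsWeaklyRegular R (List.ofFn x))
    (hf : RingHom.ker ψ = Ideal.span (Set.range f)) {N : Matrix (Fin n) (Fin n) R}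
    (hN : ∀ i, f i = ∑ j, N i j * x j) {π : A →ₐ[O] O}
    (hπ : RingHom.ker π = Ideal.span (Set.range (ψ ∘ x))) (hdet : π (ψ N.det) ≠ 0)
    {q : P →ₐ[O] A} (hq : Function.Surjective q) (h : AugHom (π.comp q) (RingHom.ker q) M) :
    ∃ D ∈ AugDer (π.comp q) M, ∀ k : RingHom.ker q, D k = h.1 k := by
  -- lifts of elements of `R` to `P`, compatible with the maps to `A`
  choose ℓ hℓ using fun r : R => hq (ψ r)
  have hχ : ∀ r, (π.comp q) (ℓ r) = π (ψ r) := fun r => by rw [AlgHom.comp_apply, hℓ]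
  have hx0 : ∀ j, π (ψ (x j)) = 0 := fun j => by
    have : ψ (x j) ∈ RingHom.ker π := hπ ▸ Ideal.subset_span ⟨j, rfl⟩
    exact this
  have hf0 : ∀ i, ψ (f i) = 0 := fun i => by
    have : f i ∈ RingHom.ker ψ := hf ▸ Ideal.subset_span ⟨i, rfl⟩
    exact this
  let κ : Fin n → RingHom.ker q := fun i => ⟨∑ j, ℓ (N i j) * ℓ (x j), by
    rw [RingHom.mem_ker, map_sum, ← hf0 i, hN i, map_sum]
    exact Finset.sum_congr rfl fun j _ => by rw [map_mul, map_mul, hℓ, hℓ]⟩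
  -- `m j` is to be the value of the derivation at the lift of `x j`; its values at the lifts `κ i` of
  -- the equations `f i` prescribe a linear system
  obtain ⟨m, hm⟩ := exists_sum_smul_eq hM (N.map fun r => π (ψ r)) (by
    have : (N.map fun r => π (ψ r)) = ((π : A →+* O).comp ψ).mapMatrix N := rfl
    rw [this, ← RingHom.map_det]
    exact hdet) (fun i => h.1 (κ i))
  -- the prescription is compatible with all relations `∑ aⱼ xⱼ + k = 0`
  have hwd : ∀ (a : Fin n → P) (k : RingHom.ker q), ∑ j, a j * ℓ (x j) + k = 0 →
      ∑ j, (π.comp q) (a j) • m j + h.1 k = 0 := by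
    intro a k hak
    choose r hr using fun j => hψ (q (a j))
    have h1 : ∑ j, r j * x j ∈ RingHom.ker ψ := by
      have h2 := congrArg q hak
      rw [map_add, map_sum, map_zero, RingHom.mem_ker.mp k.2, add_zero] at h2
      rw [RingHom.mem_ker, map_sum, ← h2]
      exact Finset.sum_congr rfl fun j _ => by rw [map_mul, map_mul, hr, hℓ]
    rw [hf, Ideal.mem_span_range_iff_exists_fun] at h1
    obtain ⟨c, hc⟩ := h1
    obtain ⟨t, ht⟩ := exists_koszul_of_isWeaklyRegular hx (r := fun j => r j - ∑ i, c i * N i j) (by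
      simp only [sub_mul, Finset.sum_sub_distrib, Finset.sum_mul]
      rw [Finset.sum_comm, ← hc, sub_eq_zero]
      refine Finset.sum_congr rfl fun i _ => ?_
      rw [hN i, Finset.mul_sum]
      exact Finset.sum_congr rfl fun j _ => by ring)
    -- modulo `ker q`, the `aⱼ` are the sum of a Koszul relation and of the relation `∑ cᵢ fᵢ`
    let e : Fin n → RingHom.ker q := fun j => ⟨a j - ((∑ i, (ℓ (t i j) - ℓ (t j i)) * ℓ (x i)) +
      ∑ i, ℓ (c i) * ℓ (N i j)), by
        rw [RingHom.mem_ker, map_sub, ← hr, ← sub_add_cancel (r j) (∑ i, c i * N i j), ht]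
        simp only [map_add, map_sum, map_mul, map_sub, hℓ, sub_self]⟩
    have ha : ∀ j, a j = (∑ i, (ℓ (t i j) - ℓ (t j i)) * ℓ (x i)) +
        ∑ i, ℓ (c i) * ℓ (N i j) + e j := fun j => by simp [e]
    have hkos : ∑ j, (∑ i, (ℓ (t i j) - ℓ (t j i)) * ℓ (x i)) * ℓ (x j) = 0 := by
      simp only [sub_mul, Finset.sum_sub_distrib, Finset.sum_mul]
      rw [sub_eq_zero, Finset.sum_comm]
      exact Finset.sum_congr rfl fun j _ => Finset.sum_congr rfl fun i _ => by ring
    have hk : k = -(∑ i, ℓ (c i) • κ i + ∑ j, ℓ (x j) • e j) := by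
      ext
      rw [eq_neg_of_add_eq_zero_right hak]
      simp only [Submodule.coe_neg, Submodule.coe_add, Submodule.coe_sum, Submodule.coe_smul,
        smul_eq_mul, κ]
      rw [Finset.sum_congr rfl fun j _ => by rw [ha j, add_mul, add_mul]]
      rw [Finset.sum_add_distrib, Finset.sum_add_distrib, hkos, zero_add]
      congr 2
      · simp only [Finset.sum_mul, Finset.mul_sum]
        rw [Finset.sum_comm]
        exact Finset.sum_congr rfl fun j _ => Finset.sum_congr rfl fun i _ => by ring
      · exact Finset.sum_congr rfl fun j _ => by ring
    have hχa : ∀ j, (π.comp q) (a j) = ∑ i, π (ψ (c i)) * π (ψ (N i j)) := fun j => by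
      have he : (π.comp q) (e j : P) = 0 := by
        rw [AlgHom.comp_apply, RingHom.mem_ker.mp (e j).2, map_zero]
      rw [ha j, map_add, map_add, he, add_zero, map_sum, map_sum]
      simp only [map_mul, hχ, hx0, mul_zero, Finset.sum_const_zero, zero_add]
    have hhk : h.1 k = -∑ i, π (ψ (c i)) • h.1 (κ i) := by
      rw [hk, map_neg, map_add, map_sum, map_sum]
      simp only [h.2 _ _, hχ, hx0, zero_smul, Finset.sum_const_zero, add_zero]
    rw [hhk]
    simp only [hχa, ← hm, Finset.sum_smul, Finset.smul_sum, smul_smul, Matrix.map_apply]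
    rw [Finset.sum_comm, add_neg_cancel]
  -- every element of `P` is the sum of a scalar, of a combination of the `xⱼ` and of an element of `ker q`
  have hdec : ∀ y : P, ∃ (a : Fin n → P) (k : RingHom.ker q),
      y - algebraMap O P ((π.comp q) y) = ∑ j, a j * ℓ (x j) + k := by
    intro y
    have h1 : q (y - algebraMap O P ((π.comp q) y)) ∈ RingHom.ker π := by
      rw [RingHom.mem_ker, map_sub, map_sub, AlgHom.commutes, AlgHom.commutes]
      exact sub_self _
    rw [hπ, Ideal.mem_span_range_iff_exists_fun] at h1
    obtain ⟨c, hc⟩ := h1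
    choose a ha using fun j => hq (c j)
    refine ⟨a, ⟨y - algebraMap O P ((π.comp q) y) - ∑ j, a j * ℓ (x j), ?_⟩, by simp⟩
    rw [RingHom.mem_ker, map_sub, ← hc, map_sum, sub_eq_zero]
    exact Finset.sum_congr rfl fun j _ => by rw [map_mul, ha, hℓ]; rfl
  choose a k hak using hdec
  let D : P → M := fun y => ∑ j, (π.comp q) (a y j) • m j + h.1 (k y)
  -- the value of `D` may be computed from any decomposition
  have hD : ∀ (y : P) (b : Fin n → P) (l : RingHom.ker q),
      y - algebraMap O P ((π.comp q) y) = ∑ j, b j * ℓ (x j) + l →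
      D y = ∑ j, (π.comp q) (b j) • m j + h.1 l := by
    intro y b l hb
    have h1 := hwd (a y - b) (k y - l) (by
      have h2 := (hak y).symm.trans hb
      simp only [Pi.sub_apply, sub_mul, Finset.sum_sub_distrib, Submodule.coe_sub]
      linear_combination h2)
    simp only [Pi.sub_apply, map_sub, sub_smul, Finset.sum_sub_distrib] at h1
    rw [← sub_eq_zero, ← h1]
    simp only [D]
    abel
  refine ⟨{ toFun := D, map_add' := fun y z => ?_, map_smul' := fun c y => ?_ }, ?_, ?_⟩
  · rw [hD (y + z) (a y + a z) (k y + k z) (by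
      simp only [Pi.add_apply, add_mul, Finset.sum_add_distrib, Submodule.coe_add, map_add]
      linear_combination hak y + hak z)]
    simp only [Pi.add_apply, map_add, add_smul, Finset.sum_add_distrib, D]
    abel
  · rw [hD (c • y) (c • a y) (c • k y) (by
      have h1 := congrArg (c • ·) (hak y)
      simp only [smul_sub, smul_add, Finset.smul_sum] at h1
      simp only [Pi.smul_apply, smul_mul_assoc, Submodule.coe_smul_of_tower, map_smul,
        smul_eq_mul, map_mul]
      rw [← h1, Algebra.smul_def c (algebraMap O P _)])]
    simp only [Pi.smul_apply, map_smul, RingHom.id_apply, smul_add, Finset.smul_sum, D,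
      smul_eq_mul, mul_smul]
  · intro y z
    change D (y * z) = (π.comp q) y • D z + (π.comp q) z • D y
    rw [hD (y * z) (y • a z + (algebraMap O P ((π.comp q) z)) • a y)
      (y • k z + (algebraMap O P ((π.comp q) z)) • k y) (by
        simp only [Pi.add_apply, Pi.smul_apply, smul_eq_mul, add_mul, Finset.sum_add_distrib,
          Submodule.coe_add, Submodule.coe_smul, map_mul, mul_assoc, ← Finset.mul_sum]
        linear_combination y * hak z + (algebraMap O P ((π.comp q) z)) * hak y)]
    have hc : (π.comp q) (algebraMap O P ((π.comp q) z)) = (π.comp q) z := (π.comp q).commutes _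
    simp only [Pi.add_apply, Pi.smul_apply, smul_eq_mul, map_add, map_mul, add_smul, mul_smul,
      Finset.sum_add_distrib, ← Finset.smul_sum, h.2 _ _, hc, D, smul_add]
    abel
  · intro y
    change D y = h.1 y
    rw [hD y 0 y (by simp [RingHom.mem_ker.mp y.2])]
    simp

end Extend

/-! ### The first André–Quillen cohomology of an augmented algebra -/

section AugHom

variable {O : Type u} [CommRing O] {A B P : Type*} [CommRing A] [Algebra O A] [CommRing B]
  [Algebra O B] [CommRing P] [Algebra O P] {M : Type w} [AddCommGroup M] [Module O M]

/-- Pulling back homomorphisms along a map of augmented algebras. -/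
def AugHom.comap (g : P →ₐ[O] A) {χ : A →ₐ[O] O} {J : Ideal A} {J' : Ideal P}
    (hJ : J' ≤ J.comap g) {χ' : P →ₐ[O] O} (hχ : χ.comp g = χ') :
    AugHom χ J M →ₗ[O] AugHom χ' J' M where
  toFun h := ⟨h.1.comp (((g : P →ₗ[O] A).restrict (p := J'.restrictScalars O)
    (q := J.restrictScalars O) hJ)), fun a j => by
      rw [← hχ]
      refine Eq.trans ?_ (h.2 (g a) ⟨g j, hJ j.2⟩)
      change h.1 _ = h.1 _
      congr 1
      ext
      exact map_mul g a j⟩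
  map_add' h h' := rfl
  map_smul' c h := rfl

/-- If derivations can be extended over the kernel of a presentation `eA` of `A`, then up to
derivations every homomorphism on the kernel of a presentation `eB` of a quotient `B` of `A`
comes from the kernel of `A → B`. Here `eB` is a retract of `eA`, by maps `ρ` and `s`. -/
theorem exists_augHom_add_augDer {P' : Type*} [CommRing P'] [Algebra O P']
    {φ : A →ₐ[O] B} {π : B →ₐ[O] O} {eA : P' →ₐ[O] A} (heA : Function.Surjective eA)
    {eB : P →ₐ[O] B} {ρ : P' →ₐ[O] P} {s : P →ₐ[O] P'} (hρ : eB.comp ρ = φ.comp eA)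
    (hs : ρ.comp s = AlgHom.id O P)
    (hA : ∀ h : AugHom ((π.comp φ).comp eA) (RingHom.ker eA) M,
      ∃ D ∈ AugDer ((π.comp φ).comp eA) M, ∀ k : RingHom.ker eA, D k.1 = h.1 k)
    (hJ : RingHom.ker eB ≤ (RingHom.ker φ).comap (eA.comp s))
    (v : AugHom (π.comp eB) (RingHom.ker eB) M) :
    ∃ h : AugHom (π.comp φ) (RingHom.ker φ) M,
      ∃ D ∈ AugDer (π.comp eB) M,
        ∀ k : RingHom.ker eB, v.1 k = h.1 ⟨eA.comp s k.1, hJ k.2⟩ + D k.1 := by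
  have hρ' : ∀ p, eB (ρ p) = φ (eA p) := fun p => DFunLike.congr_fun hρ p
  have hs' : ∀ p, ρ (s p) = p := fun p => DFunLike.congr_fun hs p
  choose ℓ hℓ using heA
  have hχ : (π.comp eB).comp ρ = (π.comp φ).comp eA := by
    rw [AlgHom.comp_assoc, hρ, AlgHom.comp_assoc]
  -- the pullback of `v` to the kernel of the presentation of `B` by the polynomial ring on `A`
  have hK : (RingHom.ker φ).comap eA ≤ (RingHom.ker eB).comap ρ := fun p hp => by
    rw [Ideal.mem_comap, RingHom.mem_ker, hρ']
    exact hp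
  let v' : AugHom ((π.comp φ).comp eA) ((RingHom.ker φ).comap eA) M := AugHom.comap ρ hK hχ v
  have hv' : ∀ k, v'.1 k = v.1 ⟨ρ k.1, hK k.2⟩ := fun k => rfl
  have hKA : RingHom.ker eA ≤ (RingHom.ker φ).comap eA := fun p hp => by
    rw [Ideal.mem_comap, RingHom.mem_ker, RingHom.mem_ker.mp hp, map_zero]
  obtain ⟨D, hD, hDv⟩ := hA ⟨v'.1.comp (Submodule.inclusion
    (p := (RingHom.ker eA).restrictScalars O) (p' := ((RingHom.ker φ).comap eA).restrictScalars O)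
    hKA), fun a j => v'.2 a ⟨j.1, hKA j.2⟩⟩
  have hDv' : ∀ p (hp : p ∈ (RingHom.ker φ).comap eA), eA p = 0 → v'.1 ⟨p, hp⟩ = D p :=
    fun p hp h0 => (hDv ⟨p, h0⟩).symm
  -- the difference of `v'` and of the derivation `D` extending it from `ker eA` descends to `ker φ`
  have hwd : ∀ p (hp : p ∈ (RingHom.ker φ).comap eA) p' (hp' : p' ∈ (RingHom.ker φ).comap eA),
      eA p = eA p' → v'.1 ⟨p, hp⟩ - D p = v'.1 ⟨p', hp'⟩ - D p' := by
    intro p hp p' hp' h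
    have h1 := hDv' (p - p') (sub_mem hp hp') (by rw [map_sub, h, sub_self])
    rw [map_sub] at h1
    have h2 : v'.1 ⟨p - p', sub_mem hp hp'⟩ = v'.1 ⟨p, hp⟩ - v'.1 ⟨p', hp'⟩ := by
      rw [← map_sub v'.1]; rfl
    rw [sub_eq_sub_iff_sub_eq_sub, ← h2, h1]
  have hX : ∀ j : RingHom.ker φ, ℓ j.1 ∈ (RingHom.ker φ).comap eA := fun j => by
    rw [Ideal.mem_comap, hℓ]
    exact j.2
  refine ⟨⟨{ toFun := fun j => v'.1 ⟨ℓ j.1, hX j⟩ - D (ℓ j.1),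
             map_add' := fun i j => ?_, map_smul' := fun c j => ?_ }, fun a j => ?_⟩,
    D.comp s.toLinearMap, ?_, fun k => ?_⟩
  · rw [hwd _ (hX (i + j)) _ (add_mem (hX i) (hX j)) (by simp [hℓ]), map_add]
    have : v'.1 ⟨_, add_mem (hX i) (hX j)⟩ = v'.1 ⟨_, hX i⟩ + v'.1 ⟨_, hX j⟩ := by
      rw [← map_add v'.1]; rfl
    rw [this]; abel
  · have hc := Submodule.smul_mem (((RingHom.ker φ).comap eA).restrictScalars O) c (hX j)
    have h1 : v'.1 ⟨_, hc⟩ = c • v'.1 ⟨_, hX j⟩ := v'.1.map_smul c ⟨_, hX j⟩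
    rw [hwd _ (hX (c • j)) _ hc (by rw [hℓ, map_smul, hℓ]; rfl), h1, map_smul,
      RingHom.id_apply, smul_sub]
  · change v'.1 _ - D _ = (π.comp φ) a • (v'.1 _ - D _)
    have hc := ((RingHom.ker φ).comap eA).smul_mem (ℓ a) (hX j)
    have hz : ((π.comp φ).comp eA) (ℓ j.1) = 0 := by
      rw [AlgHom.comp_apply, hℓ, AlgHom.comp_apply, RingHom.mem_ker.mp j.2, map_zero]
    have hXa : ((π.comp φ).comp eA) (ℓ a) = (π.comp φ) a := by
      rw [AlgHom.comp_apply, hℓ]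
    have h1 : v'.1 ⟨_, hc⟩ = (π.comp φ) a • v'.1 ⟨_, hX j⟩ := by
      rw [← hXa]
      exact v'.2 (ℓ a) ⟨_, hX j⟩
    have h2 : D (ℓ a • ℓ j.1) =
        (π.comp φ) a • D (ℓ j.1) := by
      rw [smul_eq_mul, hD, hz, zero_smul, add_zero, hXa]
    rw [hwd _ (hX (a • j)) _ hc (by rw [hℓ, smul_eq_mul, map_mul, hℓ, hℓ]; rfl), h1, h2,
      smul_sub]
  · intro a b
    have h1 : ∀ p, ((π.comp φ).comp eA) (s p) = (π.comp eB) p := fun p => by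
      rw [← hχ, AlgHom.comp_apply, hs']
    change D (s (a * b)) = _
    rw [map_mul, hD, h1, h1]
    rfl
  · have hk : s k.1 ∈ (RingHom.ker φ).comap eA := by
      exact hJ k.2
    change v.1 k = v'.1 _ - D _ + D (s k.1)
    rw [hwd _ (hX ⟨eA.comp s k.1, hJ k.2⟩) (s k.1) hk (by rw [hℓ]; rfl), sub_add_cancel, hv']
    congr 1
    ext1
    exact (hs' _).symm

/-- A homomorphism on the kernel of `φ : A → B` whose pullback to a presentation of `B` extends to a
derivation extends itself to a derivation. -/
theorem exists_augDer_of_comap {φ : A →ₐ[O] B} {π : B →ₐ[O] O} {q : P →ₐ[O] B}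
    (hq : Function.Surjective q) {g : P →ₐ[O] A} (hg : φ.comp g = q)
    (hJ : RingHom.ker q ≤ (RingHom.ker φ).comap g) (h : AugHom (π.comp φ) (RingHom.ker φ) M)
    {D : P →ₗ[O] M} (hD : D ∈ AugDer (π.comp q) M)
    (hDh : ∀ k : RingHom.ker q, h.1 ⟨g k.1, hJ k.2⟩ = D k.1) :
    ∃ δ ∈ AugDer (π.comp φ) M, ∀ j : RingHom.ker φ, δ j.1 = h.1 j := by
  have hg' : ∀ p, φ (g p) = q p := fun p => DFunLike.congr_fun hg p
  choose ℓ hℓ using fun a : A => hq (φ a)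
  have hm : ∀ (a : A) (p : P), q p = φ a → a - g p ∈ RingHom.ker φ := fun a p hp => by
    rw [RingHom.mem_ker, map_sub, hg', hp, sub_self]
  let δ : A → M := fun a => D (ℓ a) + h.1 ⟨a - g (ℓ a), hm a _ (hℓ a)⟩
  -- `δ` does not depend on the lift
  have hδ : ∀ (a : A) (p : P) (hp : q p = φ a), δ a = D p + h.1 ⟨a - g p, hm a p hp⟩ := by
    intro a p hp
    have hk : p - ℓ a ∈ RingHom.ker q := by rw [RingHom.mem_ker, map_sub, hp, hℓ, sub_self]
    have h1 := hDh ⟨p - ℓ a, hk⟩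
    have h2 : h.1 ⟨a - g (ℓ a), hm a _ (hℓ a)⟩ =
        h.1 ⟨g (p - ℓ a), hJ hk⟩ + h.1 ⟨a - g p, hm a p hp⟩ := by
      rw [← map_add h.1]
      congr 1
      ext1
      change _ = g (p - ℓ a) + (a - g p)
      rw [map_sub]
      ring
    simp only [δ]
    rw [h2, h1, map_sub]
    abel
  refine ⟨{ toFun := δ, map_add' := fun a b => ?_, map_smul' := fun c a => ?_ }, fun a b => ?_,
    fun j => ?_⟩
  · rw [hδ (a + b) (ℓ a + ℓ b) (by rw [map_add, map_add, hℓ, hℓ]), map_add]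
    have : h.1 ⟨a + b - g (ℓ a + ℓ b), hm _ _ (by rw [map_add, map_add, hℓ, hℓ])⟩ =
        h.1 ⟨a - g (ℓ a), hm a _ (hℓ a)⟩ + h.1 ⟨b - g (ℓ b), hm b _ (hℓ b)⟩ := by
      rw [← map_add h.1]
      congr 1
      ext1
      change a + b - g (ℓ a + ℓ b) = (a - g (ℓ a)) + (b - g (ℓ b))
      rw [map_add]
      ring
    rw [this]
    simp only [δ]
    abel
  · rw [hδ (c • a) (c • ℓ a) (by rw [map_smul, map_smul, hℓ]), map_smul, RingHom.id_apply]
    simp only [δ]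
    rw [smul_add, ← map_smul h.1]
    congr 2
    ext1
    change c • a - g (c • ℓ a) = c • (a - g (ℓ a))
    rw [map_smul, smul_sub]
  · have hx : ∀ x : A, (π.comp q) (ℓ x) = (π.comp φ) x := fun x => by
      rw [AlgHom.comp_apply, hℓ, AlgHom.comp_apply]
    have hgx : ∀ x : A, (π.comp φ) (g (ℓ x)) = (π.comp φ) x := fun x => by
      rw [AlgHom.comp_apply, hg', hℓ, AlgHom.comp_apply]
    change δ (a * b) = (π.comp φ) a • δ b + (π.comp φ) b • δ a
    rw [hδ (a * b) (ℓ a * ℓ b) (by rw [map_mul, map_mul, hℓ, hℓ]), hD, hx, hx]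
    have : h.1 ⟨a * b - g (ℓ a * ℓ b), hm _ _ (by rw [map_mul, map_mul, hℓ, hℓ])⟩ =
        (π.comp φ) a • h.1 ⟨b - g (ℓ b), hm b _ (hℓ b)⟩ +
          (π.comp φ) b • h.1 ⟨a - g (ℓ a), hm a _ (hℓ a)⟩ := by
      rw [← hgx b, ← h.2, ← h.2, ← map_add h.1]
      congr 1
      ext1
      change a * b - g (ℓ a * ℓ b) = a * (b - g (ℓ b)) + g (ℓ b) * (a - g (ℓ a))
      rw [map_mul]
      ring
    rw [this]
    simp only [δ, smul_add]
    abel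
  · change δ j.1 = _
    rw [hδ j.1 0 (by rw [map_zero]; exact j.2.symm), map_zero, zero_add]
    congr 1
    ext1
    change j.1 - g 0 = j.1
    rw [map_zero, sub_zero]

end AugHom

section Der

variable {O : Type u} {B : Type v} [CommRing O] [CommRing B] [Algebra O B] (π : B →ₐ[O] O)

/-- Derivations into `E/O` are derivations along the augmentation. -/
def derZeroEquiv : Der0 O B (EModO π) ≃ₗ[O] AugDer π (EModO π) where
  toFun D := ⟨D.toLinearMap, fun a b => D.leibniz a b⟩
  invFun D := Derivation.mk' D.1 D.2
  map_add' D D' := rfl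
  map_smul' c D := rfl
  left_inv D := by ext; rfl
  right_inv D := by ext; rfl

variable (E : Algebra.Extension O B)

/-- The structure map of an extension of algebras. -/
abbrev extHom : E.Ring →ₐ[O] B := IsScalarTower.toAlgHom O E.Ring B

/-- A homomorphism on the cotangent module of an extension, viewed as a homomorphism on the
kernel of the extension. -/
def ofCotangentHom : (E.Cotangent →ₗ[B] EModO π) →ₗ[O]
    AugHom (π.comp (extHom E)) (RingHom.ker (extHom E)) (EModO π) where
  toFun u :=
    ⟨{ toFun := fun k => u (Algebra.Extension.Cotangent.mk k)
       map_add' := fun k l => by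
         rw [← map_add]
         exact congrArg u (map_add Algebra.Extension.Cotangent.mk k l)
       map_smul' := fun c k => by
         have h : c • k = algebraMap O E.Ring c • k := by
           ext
           simp [Algebra.smul_def]
         rw [h, RingHom.id_apply]
         refine (congrArg u (Algebra.Extension.Cotangent.mk.map_smul _ _)).trans ?_
         rw [← algebraMap_smul B (algebraMap O E.Ring c), map_smul, EModO.smul_def,
           ← IsScalarTower.algebraMap_apply, AlgHom.commutes]
         rfl }, fun a k => by
        refine (congrArg u (Algebra.Extension.Cotangent.mk.map_smul a k)).trans ?_
        rw [← algebraMap_smul B a, map_smul, EModO.smul_def]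
        rfl⟩
  map_add' u u' := rfl
  map_smul' c u := rfl

theorem ofCotangentHom_apply (u : E.Cotangent →ₗ[B] EModO π) (k : RingHom.ker (extHom E)) :
    (ofCotangentHom π E u).1 k = u (Algebra.Extension.Cotangent.mk k) := rfl

theorem ofCotangentHom_bijective : Function.Bijective (ofCotangentHom π E) := by
  constructor
  · intro u u' h
    ext x
    obtain ⟨k, rfl⟩ := Algebra.Extension.Cotangent.mk_surjective x
    exact LinearMap.congr_fun (congrArg Subtype.val h) k
  · intro h
    have hsq : ∀ k : RingHom.ker (extHom E), (k : E.Ring) ∈ RingHom.ker (extHom E) ^ 2 →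
        h.1 k = 0 := by
      have key : ∀ x ∈ RingHom.ker (extHom E) ^ 2, ∃ hx : x ∈ RingHom.ker (extHom E),
          h.1 ⟨x, hx⟩ = 0 := by
        intro x hx
        rw [pow_two] at hx
        refine Submodule.mul_induction_on hx (fun a ha b hb => ?_) fun a b ha hb => ?_
        · refine ⟨Ideal.mul_mem_left _ _ hb, (h.2 a ⟨b, hb⟩).trans ?_⟩
          rw [AlgHom.comp_apply, RingHom.mem_ker.mp ha, map_zero, zero_smul]
        · obtain ⟨ha, ha'⟩ := ha
          obtain ⟨hb, hb'⟩ := hb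
          refine ⟨add_mem ha hb, ?_⟩
          rw [← add_zero (0 : EModO π)]
          nth_rw 1 [← ha']
          rw [← hb', ← map_add]
          rfl
      intro k hk
      exact (key _ hk).2
    have hwd : ∀ k l : RingHom.ker (extHom E), Algebra.Extension.Cotangent.mk k =
        Algebra.Extension.Cotangent.mk (P := E) l → h.1 k = h.1 l := by
      intro k l hkl
      rw [← sub_eq_zero, ← map_sub]
      exact hsq _ ((Algebra.Extension.Cotangent.mk_eq_mk_iff_sub_mem k l).mp hkl)
    choose s hs using Algebra.Extension.Cotangent.mk_surjective (P := E)
    refine ⟨{ toFun := fun x => h.1 (s x), map_add' := fun x y => ?_, map_smul' := fun b x => ?_ },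
      ?_⟩
    · refine Eq.trans ?_ (map_add h.1 (s x) (s y))
      apply hwd
      refine (hs _).trans (Eq.symm ?_)
      refine (map_add Algebra.Extension.Cotangent.mk _ _).trans ?_
      rw [hs, hs]
    · obtain ⟨a, rfl⟩ := E.algebraMap_surjective b
      rw [RingHom.id_apply, EModO.smul_def]
      refine Eq.trans ?_ (h.2 a (s x))
      apply hwd
      refine (hs _).trans (Eq.symm ?_)
      refine (Algebra.Extension.Cotangent.mk.map_smul _ _).trans ?_
      rw [hs, algebraMap_smul]
    · ext k
      exact hwd _ _ (hs _)

open scoped TensorProduct in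
/-- The coboundaries are the restrictions of derivations. -/
theorem exists_comp_cotangentComplex_iff (u : E.Cotangent →ₗ[B] EModO π) :
    (∃ g : E.CotangentSpace →ₗ[B] EModO π, g.comp E.cotangentComplex = u) ↔
      ∃ D ∈ AugDer (π.comp (extHom E)) (EModO π), ∀ k : RingHom.ker (extHom E),
        (ofCotangentHom π E u).1 k = D k.1 := by
  let _ : Module E.Ring (EModO π) := Module.compHom _ (algebraMap E.Ring B)
  have hs : ∀ (r : E.Ring) (m : EModO π), r • m = π (algebraMap E.Ring B r) • m :=
    fun _ _ => rfl
  have : IsScalarTower E.Ring B (EModO π) := ⟨fun r b m => by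
    rw [Algebra.smul_def, mul_smul]; rfl⟩
  have : IsScalarTower O E.Ring (EModO π) := ⟨fun r b m => by
    rw [hs, hs, smul_smul, Algebra.smul_def, map_mul, map_mul, ← IsScalarTower.algebraMap_apply,
      AlgHom.commutes]
    rfl⟩
  constructor
  · rintro ⟨g, rfl⟩
    have hg : ∀ (a : E.Ring) (w : Ω[E.Ring⁄O]), g ((1 : B) ⊗ₜ[E.Ring] (a • w)) =
        π (algebraMap E.Ring B a) • g ((1 : B) ⊗ₜ[E.Ring] w) := by
      intro a w
      rw [TensorProduct.tmul_smul, ← algebraMap_smul B a, map_smul]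
      rfl
    refine ⟨{ toFun := fun p => g (1 ⊗ₜ[E.Ring] KaehlerDifferential.D O E.Ring p),
              map_add' := ?_, map_smul' := ?_ }, ?_, ?_⟩
    · intro a b
      rw [map_add, TensorProduct.tmul_add, map_add]
    · intro c a
      rw [Derivation.map_smul, ← algebraMap_smul E.Ring c (KaehlerDifferential.D O E.Ring a), hg,
        ← IsScalarTower.algebraMap_apply, AlgHom.commutes]
      rfl
    · intro a b
      change g _ = _ • g _ + _ • g _
      rw [Derivation.leibniz, TensorProduct.tmul_add, map_add, hg, hg]
      rfl
    · intro k
      rw [ofCotangentHom_apply, LinearMap.comp_apply]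
      exact congrArg g (E.cotangentComplex_mk k)
  · rintro ⟨D, hD, hDk⟩
    let D' : Derivation O E.Ring (EModO π) := Derivation.mk' D fun a b => hD a b
    refine ⟨D'.liftKaehlerDifferential.liftBaseChange B, ?_⟩
    ext x
    obtain ⟨k, rfl⟩ := Algebra.Extension.Cotangent.mk_surjective x
    rw [LinearMap.comp_apply]
    refine (congrArg _ (E.cotangentComplex_mk k)).trans ?_
    rw [LinearMap.liftBaseChange_tmul, one_smul, Derivation.liftKaehlerDifferential_comp_D]
    exact (hDk k).symm

end Der

section ExactSequence

variable {O : Type u} {B : Type v} {A : Type w} [CommRing O] [CommRing B] [Algebra O B]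
  [CommRing A] [Algebra O A] {M : Type*} [AddCommGroup M] [Module O M]

/-- Derivations of a quotient `B` of `A`, viewed as derivations of `A` that vanish on the
kernel of `A → B`. -/
def AugDer.pullback (φ : A →ₐ[O] B) (π : B →ₐ[O] O)
    (hle : RingHom.ker φ ≤ RingHom.ker (π.comp φ)) :
    AugDer π M →ₗ[O] LinearMap.ker (AugDer.restrict (M := M) hle) where
  toFun D := ⟨⟨D.1.comp φ.toLinearMap, fun a b => by
    change D.1 (φ (a * b)) = _
    rw [map_mul, D.2]
    rfl⟩, by
      rw [LinearMap.mem_ker]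
      ext j
      change D.1 (φ j) = 0
      rw [RingHom.mem_ker.mp j.2, map_zero]⟩
  map_add' D D' := rfl
  map_smul' c D := rfl

theorem AugDer.pullback_bijective {φ : A →ₐ[O] B} (hφ : Function.Surjective φ) (π : B →ₐ[O] O)
    (hle : RingHom.ker φ ≤ RingHom.ker (π.comp φ)) :
    Function.Bijective (AugDer.pullback (M := M) φ π hle) := by
  constructor
  · intro D D' h
    ext b
    obtain ⟨a, rfl⟩ := hφ b
    exact LinearMap.congr_fun (congrArg (fun x => x.1.1) h) a
  · rintro ⟨D, hD⟩
    have h0 : ∀ j : RingHom.ker φ, D.1 j = 0 := fun j =>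
      LinearMap.congr_fun (congrArg Subtype.val (LinearMap.mem_ker.mp hD)) j
    obtain ⟨s, hs⟩ := hφ.hasRightInverse
    have hwd : ∀ a a', φ a = φ a' → D.1 a = D.1 a' := by
      intro a a' h
      have := h0 ⟨a - a', by rw [RingHom.mem_ker, map_sub, h, sub_self]⟩
      rwa [map_sub, sub_eq_zero] at this
    refine ⟨⟨{ toFun := fun b => D.1 (s b)
               map_add' := fun b b' => ?_
               map_smul' := fun c b => ?_ }, fun b b' => ?_⟩, ?_⟩
    · rw [← map_add]
      exact hwd _ _ (by simp [hs _])
    · rw [RingHom.id_apply, ← map_smul]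
      exact hwd _ _ (by simp [hs _])
    · change D.1 (s (b * b')) = π b • D.1 (s b') + π b' • D.1 (s b)
      have h1 : ∀ b, (π.comp φ) (s b) = π b := fun b => by
        rw [AlgHom.comp_apply, hs]
      rw [← h1 b, ← h1 b', ← D.2]
      exact hwd _ _ (by simp [hs _])
    · ext a
      exact hwd _ _ (hs _)

theorem AugDer.mem_range_restrict_iff {χ : A →ₐ[O] O} {J : Ideal A} (hJ : J ≤ RingHom.ker χ)
    (h : AugHom χ J M) :
    h ∈ LinearMap.range (AugDer.restrict (M := M) hJ) ↔
      ∃ D ∈ AugDer χ M, ∀ j : J, D j.1 = h.1 j := by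
  constructor
  · rintro ⟨D, rfl⟩
    exact ⟨D.1, D.2, fun j => rfl⟩
  · rintro ⟨D, hD, hj⟩
    exact ⟨⟨D, hD⟩, by ext j; exact hj j⟩

/-- If `Der¹(A, E/O)` vanishes, in the form of the extension property of derivations, then
`Der¹(B, E/O)` is the cokernel of the restriction of derivations of `A` to the kernel of `A → B`. -/
theorem exists_surjective_der_one {φ : A →ₐ[O] B} (hφ : Function.Surjective φ)
    (π : B →ₐ[O] O) (hle : RingHom.ker φ ≤ RingHom.ker (π.comp φ))
    (hA : ∀ h : AugHom ((π.comp φ).comp (MvPolynomial.aeval (R := O) (id : A → A)))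
      (RingHom.ker (MvPolynomial.aeval (R := O) (id : A → A))) (EModO π),
      ∃ D ∈ AugDer ((π.comp φ).comp (MvPolynomial.aeval (R := O) (id : A → A))) (EModO π),
        ∀ k : RingHom.ker (MvPolynomial.aeval (R := O) (id : A → A)), D k.1 = h.1 k) :
    ∃ T : AugHom (π.comp φ) (RingHom.ker φ) (EModO π) →ₗ[O] Der1 O B (EModO π),
      Function.Surjective T ∧
        LinearMap.ker T = LinearMap.range (AugDer.restrict (M := EModO π) hle) := by
  let E := (Algebra.Generators.self O B).toExtension
  choose σ hσ using hφ
  let eA : MvPolynomial A O →ₐ[O] A := MvPolynomial.aeval id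
  let ρ : MvPolynomial A O →ₐ[O] E.Ring :=
    (MvPolynomial.rename φ : MvPolynomial A O →ₐ[O] MvPolynomial B O)
  let s : E.Ring →ₐ[O] MvPolynomial A O :=
    (MvPolynomial.rename σ : MvPolynomial B O →ₐ[O] MvPolynomial A O)
  have hρ0 : (MvPolynomial.aeval id : MvPolynomial B O →ₐ[O] B).comp (MvPolynomial.rename φ) =
      φ.comp eA := by
    ext a; simp [eA]
  have hs0 : (MvPolynomial.rename φ : MvPolynomial A O →ₐ[O] MvPolynomial B O).comp
      (MvPolynomial.rename σ) = AlgHom.id O _ := by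
    ext b; simp [hσ]
  have hρ : (extHom E).comp ρ = φ.comp eA := hρ0
  have hs : ρ.comp s = AlgHom.id O E.Ring := hs0
  have hJ : RingHom.ker (extHom E) ≤ (RingHom.ker φ).comap (eA.comp s) := by
    intro p hp
    have h1 : φ (eA (s p)) = extHom E (ρ (s p)) := (DFunLike.congr_fun hρ (s p)).symm
    have h2 : ρ (s p) = p := DFunLike.congr_fun hs p
    rw [Ideal.mem_comap, RingHom.mem_ker, AlgHom.comp_apply, h1, h2]
    exact hp
  have hg : φ.comp (eA.comp s) = extHom E := by
    rw [← AlgHom.comp_assoc, ← hρ, AlgHom.comp_assoc, hs, AlgHom.comp_id]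
  have hχ : (π.comp φ).comp (eA.comp s) = π.comp (extHom E) := by
    rw [AlgHom.comp_assoc, hg]
  let c := LinearEquiv.ofBijective _ (ofCotangentHom_bijective π E)
  have hc : ∀ v, ofCotangentHom π E (c.symm v) = v := fun v => c.apply_symm_apply v
  have hcob : ∀ v, c.symm v ∈ LinearMap.range (derCoboundary O B (EModO π)) ↔
      ∃ D ∈ AugDer (π.comp (extHom E)) (EModO π), ∀ k : RingHom.ker (extHom E), v.1 k = D k.1 := by
    intro v
    have h := exists_comp_cotangentComplex_iff π E (c.symm v)
    rw [hc] at h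
    exact h
  let T0 := c.symm.toLinearMap.comp (AugHom.comap (M := EModO π) (eA.comp s) hJ hχ)
  refine ⟨(LinearMap.range (derCoboundary O B (EModO π))).mkQ.comp T0, ?_, ?_⟩
  · intro y
    obtain ⟨u, rfl⟩ := Submodule.mkQ_surjective _ y
    obtain ⟨v, rfl⟩ := c.symm.surjective u
    have heA : Function.Surjective eA := fun a => ⟨MvPolynomial.X a, by simp [eA]⟩
    obtain ⟨h, D, hD, hDv⟩ := exists_augHom_add_augDer heA hρ hs hA hJ v
    refine ⟨h, ?_⟩
    rw [LinearMap.comp_apply, ← sub_eq_zero, ← map_sub, Submodule.mkQ_apply,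
      Submodule.Quotient.mk_eq_zero]
    have h1 : T0 h - c.symm v = c.symm (AugHom.comap (eA.comp s) hJ hχ h - v) := by
      rw [map_sub]
      rfl
    rw [h1, hcob]
    refine ⟨-D, neg_mem hD, fun k => ?_⟩
    change h.1 ⟨eA.comp s k.1, hJ k.2⟩ - v.1 k = - D k.1
    rw [hDv k, sub_add_cancel_left]
  · ext h
    rw [LinearMap.mem_ker, LinearMap.comp_apply, Submodule.mkQ_apply,
      Submodule.Quotient.mk_eq_zero, AugDer.mem_range_restrict_iff]
    refine (hcob _).trans ⟨?_, ?_⟩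
    · rintro ⟨D, hD, hDk⟩
      exact exists_augDer_of_comap E.algebraMap_surjective hg hJ h hD hDk
    · rintro ⟨δ, hδ, hδj⟩
      refine ⟨δ.comp (eA.comp s).toLinearMap, fun a b => ?_, fun k => (hδj _).symm⟩
      rw [← hχ]
      refine Eq.trans ?_ (hδ ((eA.comp s) a) ((eA.comp s) b))
      exact congrArg δ (map_mul (eA.comp s) a b)

end ExactSequence

section Lengths

variable {O : Type u} {B : Type v} {A : Type w} [CommRing O] [CommRing B] [Algebra O B]
  [CommRing A] [Algebra O A] {M : Type*} [AddCommGroup M] [Module O M]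

/-- The long exact sequence `0 → Der(B) → Der(A) → Hom(ker φ, E/O) → Der¹(B) → 0`, in terms of
lengths. -/
theorem length_der_one_add_length_augDer {φ : A →ₐ[O] B} (hφ : Function.Surjective φ)
    (π : B →ₐ[O] O) (hle : RingHom.ker φ ≤ RingHom.ker (π.comp φ))
    (hA : ∀ h : AugHom ((π.comp φ).comp (MvPolynomial.aeval (R := O) (id : A → A)))
      (RingHom.ker (MvPolynomial.aeval (R := O) (id : A → A))) (EModO π),
      ∃ D ∈ AugDer ((π.comp φ).comp (MvPolynomial.aeval (R := O) (id : A → A))) (EModO π),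
        ∀ k : RingHom.ker (MvPolynomial.aeval (R := O) (id : A → A)), D k.1 = h.1 k) :
    Module.length O (Der1 O B (EModO π)) + Module.length O (AugDer (π.comp φ) (EModO π)) =
      Module.length O (AugDer π (EModO π)) +
        Module.length O (AugHom (π.comp φ) (RingHom.ker φ) (EModO π)) := by
  obtain ⟨T, hT, hker⟩ := exists_surjective_der_one hφ π hle hA
  set res := AugDer.restrict (M := EModO π) hle with hres
  have h1 : Module.length O (AugHom (π.comp φ) (RingHom.ker φ) (EModO π)) =
      Module.length O (LinearMap.ker T) + Module.length O (Der1 O B (EModO π)) :=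
    Module.length_eq_add_of_exact (Submodule.subtype (LinearMap.ker T)) T
      (Submodule.subtype_injective _) hT (LinearMap.exact_iff.mpr (by
        rw [Submodule.range_subtype]))
  have h2 : Module.length O (AugDer (π.comp φ) (EModO π)) =
      Module.length O (LinearMap.ker res) + Module.length O (LinearMap.range res) :=
    Module.length_eq_add_of_exact (Submodule.subtype (LinearMap.ker res)) res.rangeRestrict
      (Submodule.subtype_injective _) res.surjective_rangeRestrict (LinearMap.exact_iff.mpr (by
        rw [LinearMap.ker_rangeRestrict, Submodule.range_subtype]))
  have h3 : Module.length O (AugDer π (EModO π)) = Module.length O (LinearMap.ker res) :=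
    LinearEquiv.length_eq (R := O) (M := AugDer π (EModO π)) (N := LinearMap.ker res)
      (LinearEquiv.ofBijective _ (AugDer.pullback_bijective (M := EModO π) hφ π hle))
  rw [h1, h2, hker, h3]
  ring

/-- The images under an augmentation of the relations between the elements `x₁, …, x_d`. -/
def augRelations {d : ℕ} (χ : A →ₐ[O] O) (x : Fin d → A) : Submodule O (Fin d → O) where
  carrier := {w | ∃ v : Fin d → A, ∑ i, v i * x i = 0 ∧ w = fun i => χ (v i)}
  zero_mem' := ⟨0, by simp, by ext; simp⟩
  add_mem' := by
    rintro _ _ ⟨v, hv, rfl⟩ ⟨v', hv', rfl⟩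
    refine ⟨v + v', ?_, by ext; simp⟩
    simp only [Pi.add_apply, add_mul, Finset.sum_add_distrib, hv, hv', add_zero]
  smul_mem' := by
    rintro c _ ⟨v, hv, rfl⟩
    refine ⟨c • v, ?_, by ext; simp⟩
    simp only [Pi.smul_apply, smul_mul_assoc, ← Finset.smul_sum, hv, smul_zero]

theorem span_det_augRelations {d : ℕ} (χ : A →ₐ[O] O) (x : Fin d → A) :
    Ideal.span {r | ∃ V : Matrix (Fin d) (Fin d) O,
      (∀ i, V i ∈ augRelations χ x) ∧ r = V.det} = (fittingIdeal x).map χ := by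
  rw [fittingIdeal, Ideal.map_span]
  congr 1
  ext r
  constructor
  · rintro ⟨V, hV, rfl⟩
    choose W hW hVW using hV
    refine ⟨(Matrix.of W).det, ⟨Matrix.of W, funext hW, rfl⟩, ?_⟩
    have h : V = (χ : A →+* O).mapMatrix (Matrix.of W) := by
      ext i j
      exact congrFun (hVW i) j
    rw [h, ← RingHom.map_det]
    rfl
  · rintro ⟨_, ⟨W, hW, rfl⟩, rfl⟩
    exact ⟨(χ : A →+* O).mapMatrix W, fun i => ⟨W i, congrFun hW i, rfl⟩,
      RingHom.map_det (χ : A →+* O) W⟩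

/-- Homomorphisms on the ideal `(x₁, …, x_d)` along an augmentation, in terms of their
values on the generators. -/
def AugHom.ofGenerators {d : ℕ} (χ : A →ₐ[O] O) (x : Fin d → A) :
    AugHom χ (Ideal.span (Set.range x)) M →ₗ[O] ((Fin d → O) ⧸ augRelations χ x) →ₗ[O] M where
  toFun h := (augRelations χ x).liftQ (Fintype.linearCombination O fun i =>
      h.1 ⟨x i, Ideal.subset_span ⟨i, rfl⟩⟩) (by
    rintro _ ⟨v, hv, rfl⟩
    rw [LinearMap.mem_ker, Fintype.linearCombination_apply]
    rw [Finset.sum_congr rfl fun i _ => (h.2 (v i) ⟨x i, Ideal.subset_span ⟨i, rfl⟩⟩).symm,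
      ← map_sum]
    refine (congrArg h.1 ?_).trans (map_zero h.1)
    ext
    simpa using hv)
  map_add' h h' := by
    ext i
    simp
  map_smul' c h := by
    ext i
    simp

theorem AugHom.ofGenerators_bijective {d : ℕ} (χ : A →ₐ[O] O) (x : Fin d → A) :
    Function.Bijective (AugHom.ofGenerators (M := M) χ x) := by
  have hsp : ∀ j : Ideal.span (Set.range x), ∃ a : Fin d → A,
      j = ∑ i, a i • (⟨x i, Ideal.subset_span ⟨i, rfl⟩⟩ : Ideal.span (Set.range x)) := by
    intro j
    obtain ⟨a, ha⟩ := Ideal.mem_span_range_iff_exists_fun.mp j.2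
    refine ⟨a, ?_⟩
    ext
    simp [← ha]
  have hap : ∀ (h : AugHom χ (Ideal.span (Set.range x)) M) (a : Fin d → A),
      h.1 (∑ i, a i • (⟨x i, Ideal.subset_span ⟨i, rfl⟩⟩ : Ideal.span (Set.range x))) =
        AugHom.ofGenerators χ x h (Submodule.Quotient.mk fun i => χ (a i)) := by
    intro h a
    rw [map_sum]
    simp only [h.2 _ _]
    rfl
  constructor
  · intro h h' hh
    ext j
    obtain ⟨a, rfl⟩ := hsp j
    rw [hap, hap, hh]
  · intro f
    choose a ha using hsp
    have hwd : ∀ b c : Fin d → A, ∑ i, b i * x i = ∑ i, c i * x i →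
        f (Submodule.Quotient.mk fun i => χ (b i)) =
          f (Submodule.Quotient.mk fun i => χ (c i)) := by
      intro b c hbc
      congr 1
      rw [Submodule.Quotient.eq]
      refine ⟨b - c, ?_, by ext; simp⟩
      simp [sub_mul, hbc]
    have ha' : ∀ j, ∑ i, a j i * x i = j := fun j => by
      conv_rhs => rw [ha j]
      simp
    refine ⟨⟨{ toFun := fun j => f (Submodule.Quotient.mk fun i => χ (a j i))
               map_add' := fun j k => ?_
               map_smul' := fun c j => ?_ }, fun b j => ?_⟩, ?_⟩
    · rw [← map_add, ← Submodule.Quotient.mk_add, hwd _ (a j + a k)]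
      · congr 2
        ext
        simp
      · simp [add_mul, Finset.sum_add_distrib, ha']
    · rw [RingHom.id_apply, ← map_smul, ← Submodule.Quotient.mk_smul, hwd _ (c • a j)]
      · congr 2
        ext
        simp
      · simp [← Finset.smul_sum, ha']
    · change f _ = χ b • f _
      rw [← map_smul, ← Submodule.Quotient.mk_smul, hwd _ (b • a j)]
      · congr 2
        ext
        simp
      · simp [mul_assoc, ← Finset.mul_sum, ha']
    · ext i
      simp only [LinearMap.comp_apply, LinearMap.single_apply, Submodule.mkQ_apply]
      have h1 : (Pi.single i 1 : Fin d → O) = fun k => χ ((Pi.single i 1 : Fin d → A) k) := by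
        ext k
        by_cases hk : k = i
        · subst hk; simp
        · simp [Pi.single_eq_of_ne hk]
      rw [h1, ← hap]
      change f (Submodule.Quotient.mk fun k => χ (a _ k)) = _
      exact hwd _ _ (by rw [ha']; simp)

end Lengths

section DVR

variable {O : Type u} {B : Type v} {A : Type w} [CommRing O] [IsDomain O]
  [IsDiscreteValuationRing O] [CommRing B] [Algebra O B] [CommRing A] [Algebra O A]

/-- If some element `σ` of `A` kills `ker χ` and has nonzero image in `O`, then
the length of the dual of `J / (ker χ) J` is given by the Fitting ideal of `J = (x₁, …, x_d)`. -/
theorem length_augHom {d : ℕ} (χ : A →ₐ[O] O) (x : Fin d → A) (hx : ∀ i, χ (x i) = 0) (π : B →ₐ[O] O)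
    {σ : A} (hσ : ∀ a, χ a = 0 → σ * a = 0) (hσ0 : χ σ ≠ 0) :
    Module.length O (AugHom χ (Ideal.span (Set.range x)) (EModO π)) =
      Module.length O (O ⧸ (fittingIdeal x).map χ) := by
  have hK : ∀ v : Fin d → O, χ σ • v ∈ augRelations χ x := by
    intro v
    refine ⟨fun i => algebraMap O A (v i) * σ, Finset.sum_eq_zero fun i _ => ?_, ?_⟩
    · rw [mul_assoc, hσ _ (hx i), mul_zero]
    · ext i
      rw [map_mul, AlgHom.commutes, Pi.smul_apply, smul_eq_mul, mul_comm]
      rfl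
  have hfin : IsFiniteLength O ((Fin d → O) ⧸ augRelations χ x) :=
    isFiniteLength_of_smul_eq_zero hσ0 fun m => by
      obtain ⟨v, rfl⟩ := Submodule.mkQ_surjective _ m
      rw [← map_smul, Submodule.mkQ_apply, Submodule.Quotient.mk_eq_zero]
      exact hK v
  rw [(LinearEquiv.ofBijective _ (AugHom.ofGenerators_bijective (M := EModO π) χ x)).length_eq,
    length_linearMap_EModO π hfin, length_quotient_eq_length_quotient_span_det _ hσ0 hK,
    span_det_augRelations]

end DVR

/-! ### The top degree of the Koszul complex -/

section Koszul

variable {A : Type w} [CommRing A] {d : ℕ}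

/-- The generator `e₁ ∧ … ∧ e_d` of the top exterior power of `A^d`. -/
def volumeForm (A : Type w) [CommRing A] (d : ℕ) : ExteriorAlgebra A (Fin d → A) :=
  ExteriorAlgebra.ιMulti A d fun i => Pi.single i 1

theorem ιMulti_eq_det_smul (v : Fin d → Fin d → A) :
    ExteriorAlgebra.ιMulti A d v = (Matrix.of v).det • volumeForm A d := by
  have h : ExteriorAlgebra.ιMulti A d (M := Fin d → A) =
      (LinearMap.toSpanSingleton A _ (volumeForm A d)).compAlternatingMap
        Matrix.detRowAlternating := by
    refine Module.Basis.ext_alternating (Pi.basisFun A (Fin d)) fun i hi => ?_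
    let σ : Equiv.Perm (Fin d) := Equiv.ofBijective i (Finite.injective_iff_bijective.1 hi)
    have hσ : (fun k => Pi.basisFun A (Fin d) (i k)) =
        (fun k => (Pi.single k 1 : Fin d → A)) ∘ σ := by
      funext k
      rw [Pi.basisFun_apply]
      rfl
    have h1 : Matrix.detRowAlternating (R := A) (n := Fin d) (fun k => Pi.single k 1) = 1 := by
      refine (congrArg Matrix.det (?_ : _ = (1 : Matrix (Fin d) (Fin d) A))).trans Matrix.det_one
      ext i j
      simp [Matrix.one_apply, Pi.single_apply, eq_comm]
    rw [hσ, AlternatingMap.map_perm, AlternatingMap.map_perm,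
      LinearMap.compAlternatingMap_apply, h1, LinearMap.toSpanSingleton_apply, one_smul]
    rfl
  exact DFunLike.congr_fun h v

/-- The coefficient of the generator of the top exterior power. -/
def volumeCoeff (A : Type w) [CommRing A] (d : ℕ) :
    ExteriorAlgebra A (Fin d → A) →ₗ[A] A :=
  ExteriorAlgebra.liftAlternating fun i =>
    if h : i = d then (Matrix.detRowAlternating (R := A) (n := Fin d)).domDomCongr
      (finCongr h.symm) else 0

theorem volumeCoeff_smul (a : A) : volumeCoeff A d (a • volumeForm A d) = a := by
  rw [map_smul, volumeCoeff, volumeForm, ExteriorAlgebra.liftAlternating_apply_ιMulti,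
    dif_pos rfl]
  have : (Matrix.of fun i : Fin d => (Pi.single i 1 : Fin d → A)) = 1 := by
    ext i j
    simp [Matrix.one_apply, Pi.single_apply, eq_comm]
  refine (congrArg (a • ·) ((congrArg Matrix.det this).trans Matrix.det_one)).trans ?_
  simp

theorem mem_exteriorPower_iff {y : ExteriorAlgebra A (Fin d → A)} :
    y ∈ ⋀[A]^d (Fin d → A) ↔ ∃ a : A, y = a • volumeForm A d := by
  rw [← ExteriorAlgebra.ιMulti_span_fixedDegree]
  constructor
  · intro h
    induction h using Submodule.span_induction with
    | mem y h =>
      obtain ⟨v, rfl⟩ := h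
      exact ⟨_, ιMulti_eq_det_smul v⟩
    | zero => exact ⟨0, by simp⟩
    | add y z _ _ hy hz =>
      obtain ⟨a, rfl⟩ := hy
      obtain ⟨b, rfl⟩ := hz
      exact ⟨a + b, (add_smul _ _ _).symm⟩
    | smul c y _ hy =>
      obtain ⟨a, rfl⟩ := hy
      exact ⟨c * a, (mul_smul _ _ _).symm⟩
  · rintro ⟨a, rfl⟩
    exact Submodule.smul_mem _ _ (Submodule.subset_span ⟨_, rfl⟩)

theorem koszulD_ι_mul (x : Fin d → A) (v : Fin d → A) (y : ExteriorAlgebra A (Fin d → A)) :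
    koszulD x (ExteriorAlgebra.ι A v * y) =
      (∑ i, v i * x i) • y - ExteriorAlgebra.ι A v * koszulD x y := by
  refine (CliffordAlgebra.contractLeft_ι_mul (Q := 0) (Fintype.linearCombination A x) v y).trans ?_
  rw [Fintype.linearCombination_apply]
  rfl

theorem smul_koszulD_eq_zero {x : Fin d → A} {a : A} (ha : ∀ i, a * x i = 0)
    (y : ExteriorAlgebra A (Fin d → A)) : a • koszulD x y = 0 := by
  have h : a • Fintype.linearCombination A x = 0 := by
    ext i
    simp [ha]
  rw [koszulD, ← LinearMap.smul_apply, ← map_smul, h, map_zero, LinearMap.zero_apply]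

theorem ι_mul_volumeForm (i : Fin d) :
    ExteriorAlgebra.ι A (Pi.single i 1 : Fin d → A) * volumeForm A d = 0 := by
  have h : ExteriorAlgebra.ι A (Pi.single i 1 : Fin d → A) * volumeForm A d =
      ExteriorAlgebra.ιMulti A (d + 1) (Fin.cons (Pi.single i 1) fun i => Pi.single i 1) := by
    rw [ExteriorAlgebra.ιMulti_succ_apply]
    rfl
  rw [h]
  refine AlternatingMap.map_eq_zero_of_eq _ _ (i := 0) (j := i.succ) ?_ (Fin.succ_ne_zero i).symm
  rw [Fin.cons_zero, Fin.cons_succ]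

/-- The cycles of top degree correspond to the annihilator of `(x₁, …, x_d)`. -/
theorem mem_koszulTop_iff {x : Fin d → A} {y : ExteriorAlgebra A (Fin d → A)} :
    y ∈ koszulTop x ↔
      ∃ a ∈ (Ideal.span (Set.range x)).annihilator, y = a • volumeForm A d := by
  rw [koszulTop, koszulCycles, Submodule.mem_inf, mem_exteriorPower_iff, LinearMap.mem_ker]
  have hann : ∀ a, a ∈ (Ideal.span (Set.range x)).annihilator ↔ ∀ i, a * x i = 0 := fun a => by
    rw [Ideal.span, Submodule.mem_annihilator_span]
    simp
  constructor
  · rintro ⟨h0, a, rfl⟩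
    refine ⟨a, (hann a).mpr fun i => ?_, rfl⟩
    have h1 := koszulD_ι_mul x (Pi.single i 1) (a • volumeForm A d)
    rw [h0, mul_zero, sub_zero, mul_smul_comm, ι_mul_volumeForm, smul_zero, map_zero,
      smul_smul] at h1
    have h2 := congrArg (volumeCoeff A d) h1
    rw [volumeCoeff_smul, map_zero] at h2
    rw [h2]
    simp [Pi.single_apply, mul_comm]
  · rintro ⟨a, ha, rfl⟩
    refine ⟨?_, a, rfl⟩
    rw [map_smul]
    exact smul_koszulD_eq_zero ((hann a).mp ha) _

theorem mem_koszulCycles_one_iff {x : Fin d → A} {y : ExteriorAlgebra A (Fin d → A)} :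
    y ∈ koszulCycles x 1 ↔ ∃ v : Fin d → A, ∑ i, v i * x i = 0 ∧ y = ExteriorAlgebra.ι A v := by
  have hd : ∀ v, koszulD x (ExteriorAlgebra.ι A v) = algebraMap A _ (∑ i, v i * x i) := by
    intro v
    have h := koszulD_ι_mul x v 1
    have h1 : koszulD x 1 = 0 := CliffordAlgebra.contractLeft_one (Q := 0) _
    rwa [mul_one, h1, mul_zero, sub_zero, ← Algebra.algebraMap_eq_smul_one] at h
  rw [koszulCycles, Submodule.mem_inf, LinearMap.mem_ker,
    ExteriorAlgebra.exteriorPower, pow_one]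
  constructor
  · rintro ⟨h0, v, rfl⟩
    refine ⟨v, ?_, rfl⟩
    rw [hd] at h0
    exact (ExteriorAlgebra.algebraMap_leftInverse _).injective (h0.trans (map_zero _).symm)
  · rintro ⟨v, hv, rfl⟩
    exact ⟨by rw [hd, hv, map_zero], v, rfl⟩

/-- The products of cycles of degree one correspond to the Fitting ideal. -/
theorem mem_koszulTopProducts_iff {x : Fin d → A} {y : ExteriorAlgebra A (Fin d → A)} :
    y ∈ koszulTopProducts x ↔ ∃ a ∈ fittingIdeal x, y = a • volumeForm A d := by
  have h : {ω | ∃ z : Fin d → ExteriorAlgebra A (Fin d → A),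
      (∀ j, z j ∈ koszulCycles x 1) ∧ ω = (List.ofFn z).prod} =
      (LinearMap.toSpanSingleton A _ (volumeForm A d)) ''
        {r | ∃ V : Matrix (Fin d) (Fin d) A, V.mulVec x = 0 ∧ r = V.det} := by
    ext ω
    constructor
    · rintro ⟨z, hz, rfl⟩
      choose V hV hzV using fun j => mem_koszulCycles_one_iff.mp (hz j)
      refine ⟨_, ⟨Matrix.of V, funext hV, rfl⟩, ?_⟩
      rw [LinearMap.toSpanSingleton_apply, ← ιMulti_eq_det_smul, ExteriorAlgebra.ιMulti_apply,
        funext hzV]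
    · rintro ⟨_, ⟨V, hV, rfl⟩, rfl⟩
      refine ⟨fun j => ExteriorAlgebra.ι A (V j), fun j =>
        mem_koszulCycles_one_iff.mpr ⟨V j, congrFun hV j, rfl⟩, ?_⟩
      rw [LinearMap.toSpanSingleton_apply]
      exact (ιMulti_eq_det_smul V).symm.trans (ExteriorAlgebra.ιMulti_apply _)
  rw [koszulTopProducts, h, Submodule.span_image, Submodule.mem_map, fittingIdeal]
  simp only [LinearMap.toSpanSingleton_apply, eq_comm]

variable {O : Type u} [CommRing O]

theorem koszulMap_smul_volumeForm (f : A →+* O) (a : A) :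
    koszulMap f d (a • volumeForm A d) = f a • volumeForm O d := by
  let _ : Algebra A O := f.toAlgebra
  have hι : ∀ v, koszulMap f d (ExteriorAlgebra.ι A v) = ExteriorAlgebra.ι O fun i => f (v i) :=
    fun v => ExteriorAlgebra.lift_ι_apply A _ _ v
  have hC : koszulMap f d (algebraMap A _ a) = algebraMap O _ (f a) :=
    AlgHom.commutes (ExteriorAlgebra.lift A _) a
  rw [Algebra.smul_def, map_mul, hC, ← Algebra.smul_def, volumeForm, volumeForm,
    ExteriorAlgebra.ιMulti_apply, ExteriorAlgebra.ιMulti_apply, map_list_prod, List.map_ofFn]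
  congr 3
  funext i
  rw [Function.comp_apply, hι]
  congr 1
  ext j
  by_cases h : j = i
  · subst h; simp
  · simp [Pi.single_eq_of_ne h]

variable [Algebra O A]

theorem koszulImage_eq_map (π : A →ₐ[O] O) {N : Submodule A (ExteriorAlgebra A (Fin d → A))}
    {I : Ideal A} (h : ∀ y, y ∈ N ↔ ∃ a ∈ I, y = a • volumeForm A d) :
    koszulImage π N = Submodule.map (LinearMap.toSpanSingleton O _ (volumeForm O d)) (I.map π) := by
  rw [koszulImage, Ideal.map, Ideal.span, Submodule.map_span]
  congr 1
  ext y
  constructor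
  · rintro ⟨z, hz, rfl⟩
    obtain ⟨a, ha, rfl⟩ := (h z).mp hz
    exact ⟨π a, ⟨a, ha, rfl⟩, (koszulMap_smul_volumeForm (π : A →+* O) a).symm⟩
  · rintro ⟨_, ⟨a, ha, rfl⟩, rfl⟩
    exact ⟨a • volumeForm A d, (h _).mpr ⟨a, ha, rfl⟩, koszulMap_smul_volumeForm (π : A →+* O) a⟩

/-- The Koszul definition of `c₁` agrees with the length of Venkatesh's module. -/
theorem c1_eq_length_C1 (π : A →ₐ[O] O) (x : Fin d → A) :
    c1 π x = Module.length O (C1 π x) := by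
  have hinj : Function.Injective (LinearMap.toSpanSingleton O _ (volumeForm O d)) := fun a b h => by
    have h1 := congrArg (volumeCoeff O d) h
    rwa [LinearMap.toSpanSingleton_apply, LinearMap.toSpanSingleton_apply, volumeCoeff_smul,
      volumeCoeff_smul] at h1
  rw [c1, koszulImage_eq_map π fun y => mem_koszulTop_iff (x := x),
    koszulImage_eq_map π fun y => mem_koszulTopProducts_iff (x := x)]
  refine (LinearEquiv.length_eq (Submodule.Quotient.equiv _ _
    (Submodule.equivMapOfInjective _ hinj ((Ideal.span (Set.range x)).annihilator.map π)) ?_)).symm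
  ext ⟨y, hy⟩
  constructor
  · rintro ⟨z, hz, hzy⟩
    have : y = LinearMap.toSpanSingleton O _ (volumeForm O d) z := (congrArg Subtype.val hzy).symm
    subst this
    exact ⟨z.1, hz, rfl⟩
  · rintro ⟨z, hz, hzy⟩
    obtain ⟨z', hz', hzy'⟩ := hy
    have : z = z' := hinj (hzy.trans hzy'.symm)
    subst this
    exact ⟨⟨z, hz'⟩, hz, Subtype.ext hzy⟩

end Koszul

section Cotangent

variable {O : Type u} {B : Type v} [CommRing O] [CommRing B] [Algebra O B] (π : B →ₐ[O] O)
  (M : Type w) [AddCommGroup M] [Module O M]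

/-- Homomorphisms on the cotangent space, viewed as homomorphisms on the kernel of the
augmentation. -/
def AugHom.ofCotSpaceHom : (CotSpace π →ₗ[O] M) →ₗ[O] AugHom π (RingHom.ker π) M where
  toFun u := ⟨u.comp ((RingHom.ker π).toCotangent.restrictScalars O), fun b k => by
    have h : (b - algebraMap O B (π b)) • (RingHom.ker π).toCotangent k = 0 :=
      Ideal.Cotangent.smul_eq_zero_of_mem (by
        rw [RingHom.mem_ker, map_sub, AlgHom.commutes]
        exact sub_self _) _
    rw [sub_smul, sub_eq_zero, algebraMap_smul] at h
    change u ((RingHom.ker π).toCotangent (b • k)) = π b • u ((RingHom.ker π).toCotangent k)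
    rw [map_smul, h, map_smul]⟩
  map_add' u u' := rfl
  map_smul' c u := rfl

theorem AugHom.ofCotSpaceHom_bijective : Function.Bijective (AugHom.ofCotSpaceHom π M) := by
  constructor
  · intro u u' h
    ext x
    obtain ⟨k, rfl⟩ := (RingHom.ker π).toCotangent_surjective x
    exact LinearMap.congr_fun (congrArg Subtype.val h) k
  · intro h
    refine ⟨Ideal.Cotangent.lift h.1 fun x y => ?_, ?_⟩
    · refine (h.2 x.1 y).trans ?_
      rw [RingHom.mem_ker.mp x.2, zero_smul]
    · ext k
      rfl

end Cotangent

/-- The length of `Der⁰(B, E/O)` is that of the cotangent space. -/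
theorem length_derZero {O : Type u} {B : Type v} [CommRing O] [IsDomain O]
    [IsDiscreteValuationRing O] [CommRing B] [Algebra O B] {π : B →ₐ[O] O}
    (h : IsFiniteLength O (CotSpace π)) :
    Module.length O (Der0 O B (EModO π)) = Module.length O (CotSpace π) := by
  rw [← length_linearMap_EModO π h]
  exact LinearEquiv.length_eq (R := O) (M := Der0 O B (EModO π)) (N := CotSpace π →ₗ[O] EModO π)
    ((derZeroEquiv π).trans (AugDer.equivAugHom.trans
      (LinearEquiv.ofBijective _ (AugHom.ofCotSpaceHom_bijective π (EModO π))).symm))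

/-! ### Augmented complete intersections of dimension one -/

section Presentation

variable {O : Type u} [CommRing O] [IsDomain O] [IsDiscreteValuationRing O]
  {A : Type w} [CommRing A] [Algebra O A]

open RingTheory.Sequence

/-- A presentation of an augmented `O`-algebra `π : A → O` as the quotient of a power series ring
in `n` variables by a regular sequence of length `n`, together with a matrix `N` that expresses this
sequence in the translated variables, which generate the kernel of the augmentation of the
power series ring. -/
structure CIPresentation (π : A →ₐ[O] O) where
  /-- the number of variables -/
  n : ℕ
  /-- the map from the power series ring -/
  ψ : MvPowerSeries (Fin n) O →ₐ[O] A
  /-- the regular sequence -/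
  f : Fin n → MvPowerSeries (Fin n) O
  /-- the coefficients of the regular sequence in the translated variables -/
  N : Matrix (Fin n) (Fin n) (MvPowerSeries (Fin n) O)
  surjective : Function.Surjective ψ
  isWeaklyRegular : IsWeaklyRegular (MvPowerSeries (Fin n) O) (List.ofFn f)
  ker_eq : RingHom.ker ψ = Ideal.span (Set.range f)
  f_eq : ∀ i, f i = ∑ j, N i j * augVar (π.comp ψ) j

/-- The regular sequence in the definition of a complete intersection cover has as many members as
there are variables, by dimension. -/
theorem IsCICover.nonempty_ciPresentation {B : Type v} [CommRing B] [Algebra O B] {π : B →ₐ[O] O}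
    {φ : A →ₐ[O] B} (h : IsCICover π φ) : Nonempty (CIPresentation (π.comp φ)) := by
  obtain ⟨n, ψ, rs, hψ, hrs, hker⟩ := h.completeIntersection
  have hlen : rs.length = n := by
    have h1 := ringKrullDim_add_length_eq_ringKrullDim_of_isRegular rs hrs
    rw [ringKrullDim_mvPowerSeries, ← hker,
      ringKrullDim_eq_of_ringEquiv (Ideal.quotientKerAlgEquivOfSurjective hψ).toRingEquiv,
      h.dim_eq_one] at h1
    have h2 : ((1 + rs.length : ℕ) : WithBot ℕ∞) = ((n + 1 : ℕ) : WithBot ℕ∞) := by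
      push_cast
      exact h1
    have h3 : 1 + rs.length = n + 1 := by exact_mod_cast h2
    omega
  let f : Fin n → MvPowerSeries (Fin n) O := fun i => rs.get (Fin.cast hlen.symm i)
  have hf : List.ofFn f = rs := List.ext_getElem (by simp [hlen]) (by simp [f])
  have hmem : ∀ i, f i ∈ RingHom.ker ((π.comp φ).comp ψ) := fun i => by
    have h1 : f i ∈ RingHom.ker ψ := by
      rw [hker]
      exact Ideal.subset_span (List.get_mem rs _)
    rw [RingHom.mem_ker, AlgHom.comp_apply, RingHom.mem_ker.mp h1, map_zero]
  rw [ker_aug_eq_span_augVar] at hmem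
  choose N hN using fun i => Ideal.mem_span_range_iff_exists_fun.mp (hmem i)
  exact ⟨{ n := _, ψ := ψ, f := f, N := Matrix.of N, surjective := hψ
           isWeaklyRegular := by rw [hf]; exact hrs.toIsWeaklyRegular
           ker_eq := by rw [hker, ← ofList_ofFn, hf]
           f_eq := fun i => (hN i).symm }⟩

namespace CIPresentation

set_option linter.unusedSectionVars false

variable {π : A →ₐ[O] O}

/-- The generators of the kernel of the augmentation given by a presentation. -/
def gen (c : CIPresentation π) (i : Fin c.n) : A := c.ψ (augVar (π.comp c.ψ) i)

theorem ker_eq_span_gen (c : CIPresentation π) : RingHom.ker π = Ideal.span (Set.range c.gen) := by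
  have h1 : (RingHom.ker (π.comp c.ψ)).map c.ψ = RingHom.ker π := by
    have : RingHom.ker (π.comp c.ψ) = (RingHom.ker π).comap c.ψ := rfl
    rw [this, Ideal.map_comap_of_surjective _ c.surjective]
  rw [← h1, ker_aug_eq_span_augVar, Ideal.map_span, ← Set.range_comp]
  rfl

theorem aug_gen (c : CIPresentation π) (i : Fin c.n) : π (c.gen i) = 0 := by
  have : c.gen i ∈ RingHom.ker π := c.ker_eq_span_gen ▸ Ideal.subset_span ⟨i, rfl⟩
  exact this

theorem f_mem_maximalIdeal (c : CIPresentation π) (i : Fin c.n) :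
    c.f i ∈ maximalIdeal (MvPowerSeries (Fin c.n) O) := by
  rw [c.f_eq]
  exact sum_mem fun j _ => Ideal.mul_mem_left _ _ (augVar_mem_maximalIdeal _ _)

theorem ψ_eq_zero_iff (c : CIPresentation π) {r : MvPowerSeries (Fin c.n) O} :
    c.ψ r = 0 ↔ r ∈ Ideal.span (Set.range c.f) := by
  rw [← c.ker_eq, RingHom.mem_ker]

/-- The annihilator of the kernel of the augmentation is generated by the Jacobian determinant. -/
theorem annihilator_ker (c : CIPresentation π) :
    (RingHom.ker π).annihilator = Ideal.span {c.ψ c.N.det} := by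
  have hann : ∀ a, a ∈ (RingHom.ker π).annihilator ↔ ∀ j, a * c.gen j = 0 := fun a => by
    rw [c.ker_eq_span_gen, Ideal.span, Submodule.mem_annihilator_span]
    simp
  apply le_antisymm
  · intro a ha
    rw [hann] at ha
    obtain ⟨r, rfl⟩ := c.surjective a
    have h := mem_of_forall_mul_mem_of_isWeaklyRegular (b := ⊥) (x := augVar (π.comp c.ψ))
      (f := c.f) (augVar_mem_maximalIdeal _) c.f_mem_maximalIdeal
      ((isWeaklyRegular_quotient_bot_iff _).mpr (isWeaklyRegular_augVar _))
      ((isWeaklyRegular_quotient_bot_iff _).mpr c.isWeaklyRegular) (M := c.N)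
      (fun i => by
        rw [c.f_eq, Ideal.mem_bot]
        exact sub_self _) (a := r) (fun j => by
        rw [bot_sup_eq, ← c.ψ_eq_zero_iff, map_mul]
        exact ha j)
    rw [bot_sup_eq, Submodule.mem_sup] at h
    obtain ⟨y, hy, z, hz, rfl⟩ := h
    obtain ⟨z', rfl⟩ := Ideal.mem_span_singleton'.mp hz
    rw [map_add, c.ψ_eq_zero_iff.mpr hy, zero_add, map_mul]
    exact Ideal.mul_mem_left _ _ (Ideal.mem_span_singleton_self _)
  · rw [Ideal.span_singleton_le_iff_mem, hann]
    intro j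
    have h := det_mul_mem_of_mulVec_mem (b := Ideal.span (Set.range c.f)) (M := c.N)
      (x := augVar (π.comp c.ψ)) (fun i => by
        have : c.N.mulVec (augVar (π.comp c.ψ)) i = c.f i := (c.f_eq i).symm
        rw [this]
        exact Ideal.subset_span ⟨i, rfl⟩) j
    rw [gen, ← map_mul, c.ψ_eq_zero_iff]
    exact h

theorem fittingIdeal_le_annihilator {d : ℕ} (x : Fin d → A) :
    fittingIdeal x ≤ (Ideal.span (Set.range x)).annihilator := by
  rw [fittingIdeal, Ideal.span_le]
  rintro _ ⟨V, hV, rfl⟩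
  rw [SetLike.mem_coe, Ideal.span, Submodule.mem_annihilator_span]
  rintro ⟨_, ⟨j, rfl⟩⟩
  have h := det_mul_mem_of_mulVec_mem (b := ⊥) (M := V) (x := x) (fun i => by
    rw [hV]; exact zero_mem _) j
  exact h

theorem fittingIdeal_gen (c : CIPresentation π) :
    fittingIdeal c.gen = (RingHom.ker π).annihilator := by
  apply le_antisymm
  · rw [c.ker_eq_span_gen]
    exact fittingIdeal_le_annihilator _
  · rw [c.annihilator_ker, Ideal.span_singleton_le_iff_mem]
    refine Ideal.subset_span ⟨(c.ψ : MvPowerSeries (Fin c.n) O →+* A).mapMatrix c.N, ?_,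
      RingHom.map_det (c.ψ : MvPowerSeries (Fin c.n) O →+* A) c.N⟩
    funext i
    have h : c.ψ (c.f i) = 0 := c.ψ_eq_zero_iff.mpr (Ideal.subset_span ⟨i, rfl⟩)
    rw [c.f_eq, map_sum] at h
    simp only [map_mul] at h
    exact h

/-- If the cotangent space is of finite length, then some element that kills the kernel of the
augmentation has nonzero image in `O`. -/
theorem exists_mem_annihilator (c : CIPresentation π) (h : IsFiniteLength O (CotSpace π)) :
    ∃ s ∈ (RingHom.ker π).annihilator, π s ≠ 0 := by
  obtain ⟨a, ha, hΦ⟩ := IsFiniteLength.exists_smul_eq_zero h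
  have hy : ∀ i, ∃ y : Fin c.n → A, (∀ j, π (y j) = 0) ∧
      algebraMap O A a * c.gen i = ∑ j, y j * c.gen j := by
    intro i
    have h1 : algebraMap O A a * c.gen i ∈ RingHom.ker π ^ 2 := by
      have h2 := hΦ ((RingHom.ker π).toCotangent ⟨c.gen i, c.aug_gen i⟩)
      rw [← LinearMap.map_smul_of_tower, Ideal.toCotangent_eq_zero] at h2
      simpa [Algebra.smul_def] using h2
    rw [pow_two] at h1
    nth_rw 2 [c.ker_eq_span_gen] at h1
    rw [← smul_eq_mul, Ideal.span, Submodule.mem_ideal_smul_span_iff_exists_sum] at h1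
    obtain ⟨y, hy, hsum⟩ := h1
    refine ⟨y, hy, ?_⟩
    rw [← hsum, Finsupp.sum_fintype _ _ (by simp)]
    rfl
  -- the generators `ξ` satisfy `a ξ = Y ξ` with entries of `Y` in the kernel, so that `det (a - Y)` kills
  -- them, and its image in `O` is a power of `a`
  choose Y hY0 hY using hy
  refine ⟨(algebraMap O A a • (1 : Matrix (Fin c.n) (Fin c.n) A) - Matrix.of Y).det, ?_, ?_⟩
  · rw [c.ker_eq_span_gen, Ideal.span, Submodule.mem_annihilator_span]
    rintro ⟨_, ⟨j, rfl⟩⟩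
    refine det_mul_mem_of_mulVec_mem (b := ⊥) (x := c.gen) (fun i => ?_) j
    rw [Ideal.mem_bot, Matrix.sub_mulVec, Matrix.smul_mulVec, Matrix.one_mulVec, Pi.sub_apply,
      Pi.smul_apply, smul_eq_mul, hY, sub_eq_zero]
    rfl
  · have h1 : (π : A →+* O).mapMatrix
        (algebraMap O A a • (1 : Matrix (Fin c.n) (Fin c.n) A) - Matrix.of Y) =
        a • (1 : Matrix (Fin c.n) (Fin c.n) O) := by
      ext i j
      by_cases hij : i = j
      · subst hij; simp [hY0]
      · simp [hY0, hij]
    have h2 := RingHom.map_det (π : A →+* O)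
      (algebraMap O A a • (1 : Matrix (Fin c.n) (Fin c.n) A) - Matrix.of Y)
    rw [h1, Matrix.det_smul, Matrix.det_one, mul_one] at h2
    intro h0
    exact pow_ne_zero _ ha (h2.symm.trans h0)

theorem aug_det_ne_zero (c : CIPresentation π) (h : IsFiniteLength O (CotSpace π)) :
    π (c.ψ c.N.det) ≠ 0 := by
  obtain ⟨s, hs, hs0⟩ := c.exists_mem_annihilator h
  rw [c.annihilator_ker] at hs
  obtain ⟨a, rfl⟩ := Ideal.mem_span_singleton'.mp hs
  rw [map_mul] at hs0
  exact right_ne_zero_of_mul hs0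

/-- The Fitting ideal of the kernel of the augmentation is its annihilator, so the module of
derivations, the dual of the cotangent space, has the length of the congruence module. -/
theorem length_augDer (c : CIPresentation π) {B : Type v} [CommRing B] [Algebra O B]
    (π' : B →ₐ[O] O) (h : IsFiniteLength O (CotSpace π)) :
    Module.length O (AugDer π (EModO π')) = Module.length O (O ⧸ congruenceIdeal π) := by
  obtain ⟨s, hs, hs0⟩ := c.exists_mem_annihilator h
  have h1 := length_augHom π c.gen c.aug_gen π' (σ := s)
    (fun a ha => Submodule.mem_annihilator.mp hs a ha) hs0
  rw [c.fittingIdeal_gen, ← c.ker_eq_span_gen] at h1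
  refine Eq.trans ?_ h1
  exact LinearEquiv.length_eq (R := O) (M := AugDer π (EModO π'))
    (N := AugHom π (RingHom.ker π) (EModO π')) AugDer.equivAugHom

/-- The extension property of derivations for an augmented complete intersection. -/
theorem exists_augDer (c : CIPresentation π) (h : IsFiniteLength O (CotSpace π)) {B : Type v}
    [CommRing B] [Algebra O B] (π' : B →ₐ[O] O) {P : Type*} [CommRing P] [Algebra O P] {q : P →ₐ[O] A}
    (hq : Function.Surjective q) (g : AugHom (π.comp q) (RingHom.ker q) (EModO π')) :
    ∃ D ∈ AugDer (π.comp q) (EModO π'), ∀ k : RingHom.ker q, D k = g.1 k :=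
  exists_augDer_extend (fun _ ha m => EModO.exists_smul_eq π' ha m)
    (ψ := (c.ψ : MvPowerSeries (Fin c.n) O →+* A)) c.surjective (isWeaklyRegular_augVar _)
    c.ker_eq c.f_eq c.ker_eq_span_gen (c.aug_det_ne_zero h) hq g

end CIPresentation

end Presentation

section Gorenstein

variable {O : Type u} [CommRing O] [IsDomain O] [IsDiscreteValuationRing O]
  {A : Type w} [CommRing A] [Algebra O A]

open RingTheory.Sequence

set_option linter.unusedSectionVars false

theorem CIPresentation.isNoetherianRing {π : A →ₐ[O] O} (c : CIPresentation π) :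
    IsNoetherianRing A :=
  isNoetherianRing_of_surjective _ A (c.ψ : MvPowerSeries (Fin c.n) O →+* A) c.surjective

theorem CIPresentation.isLocalRing {π : A →ₐ[O] O} (c : CIPresentation π) : IsLocalRing A := by
  have : Nontrivial A := π.toRingHom.domain_nontrivial
  exact IsLocalRing.of_surjective' (c.ψ : MvPowerSeries (Fin c.n) O →+* A) c.surjective

theorem map_mem_maximalIdeal_iff {R S : Type*} [CommRing R] [CommRing S] [IsLocalRing R]
    [IsLocalRing S] {f : R →+* S} (hf : Function.Surjective f) {r : R} :
    f r ∈ maximalIdeal S ↔ r ∈ maximalIdeal R := by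
  have : IsLocalHom f := IsLocalHom.of_surjective f hf
  rw [mem_maximalIdeal, mem_maximalIdeal, mem_nonunits_iff, mem_nonunits_iff, isUnit_map_iff]

variable [IsLocalRing A] {π : A →ₐ[O] O}

/-- No nonzero element of a one-dimensional complete intersection is killed by the maximal ideal. -/
theorem CIPresentation.eq_zero_of_forall_mul_eq_zero (c : CIPresentation π) {a : A}
    (ha : ∀ m ∈ maximalIdeal A, a * m = 0) : a = 0 := by
  obtain ⟨t, ht⟩ := IsDiscreteValuationRing.exists_irreducible O
  -- the power series ring has depth `n + 1`, so that its quotient `A` has positive depth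
  obtain ⟨l, hl, hlm, hreg⟩ := exists_isWeaklyRegular_quotient_sup (b := ⊥) bot_ne_top
    ((isWeaklyRegular_quotient_bot_iff _).mpr c.isWeaklyRegular)
    (fun r hr => by
      obtain ⟨i, rfl⟩ := (List.mem_ofFn' _ _).mp hr
      exact c.f_mem_maximalIdeal i) (n := 1)
    ⟨_, by simp, fun r hr => (span_augVar_sup (π.comp c.ψ) ht).le (by
      rw [List.mem_append, List.mem_ofFn, List.mem_singleton] at hr
      rcases hr with ⟨i, rfl⟩ | rfl
      · exact Ideal.mem_sup_left (Ideal.subset_span ⟨i, rfl⟩)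
      · exact Ideal.mem_sup_right (Ideal.mem_span_singleton_self _)),
      (isWeaklyRegular_quotient_bot_iff _).mpr (isWeaklyRegular_augVar_append (π.comp c.ψ) ht)⟩
  obtain ⟨τ, rfl⟩ := List.length_eq_one_iff.mp hl
  rw [isWeaklyRegular_quotient_singleton_iff, bot_sup_eq, ofList_ofFn] at hreg
  obtain ⟨r, rfl⟩ := c.surjective a
  rw [c.ψ_eq_zero_iff]
  refine hreg r ?_
  rw [← c.ψ_eq_zero_iff, map_mul]
  exact ha _ ((map_mem_maximalIdeal_iff (f := (c.ψ : MvPowerSeries (Fin c.n) O →+* A))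
    c.surjective).mpr (hlm τ (by simp)))

/-- A simultaneous parameter: an element of the maximal ideal regular on `A` and on `A ⧸ I`, when no
nonzero element of either is killed by the maximal ideal. -/
theorem exists_regular_mem_maximalIdeal [IsNoetherianRing A]
    (h : ∀ a : A, (∀ m ∈ maximalIdeal A, a * m = 0) → a = 0) {I : Ideal A}
    (hI : ∀ a : A, (∀ m ∈ maximalIdeal A, a * m ∈ I) → a ∈ I) :
    ∃ t ∈ maximalIdeal A, t ∈ nonZeroDivisors A ∧ ∀ a, t * a ∈ I → a ∈ I := by
  -- the associated primes of `A × (A ⧸ I)` are those of `A` and of `A ⧸ I`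
  obtain ⟨t, ht, hreg⟩ := exists_add_isSMulRegular (A × (A ⧸ I)) (x := 0) (J := maximalIdeal A) (by
    intro P hP hle
    have hPm : maximalIdeal A ≤ P := le_sup_right.trans hle
    obtain ⟨hprime, ⟨a, b⟩, hab⟩ := isAssociatedPrime_iff.mp hP
    obtain ⟨b, rfl⟩ := Ideal.Quotient.mk_surjective b
    have hk : ∀ m ∈ maximalIdeal A, m • ((a, Ideal.Quotient.mk I b) : A × (A ⧸ I)) = 0 := by
      intro m hm
      have h1 := hPm hm
      rwa [hab, Submodule.mem_colon_singleton, Submodule.mem_bot] at h1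
    have ha : a = 0 := h a fun m hm => by
      have := congrArg Prod.fst (hk m hm)
      rw [mul_comm]
      exact this
    have hb : b ∈ I := hI b fun m hm => by
      have := congrArg Prod.snd (hk m hm)
      rw [mul_comm, ← Ideal.Quotient.eq_zero_iff_mem, map_mul]
      exact this
    apply hprime.ne_top
    rw [Ideal.eq_top_iff_one, hab, Submodule.mem_colon_singleton, one_smul, Submodule.mem_bot, ha,
      Ideal.Quotient.eq_zero_iff_mem.mpr hb]
    rfl)
  rw [zero_add] at hreg
  refine ⟨t, ht, ?_, fun a ha => ?_⟩
  · rw [mem_nonZeroDivisors_iff_right]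
    intro a ha
    have := @hreg (a, 0) (0, 0) (by
      ext
      · simpa [mul_comm] using ha
      · simp)
    exact congrArg Prod.fst this
  · have := @hreg (0, Ideal.Quotient.mk I a) (0, 0) (by
      ext
      · simp
      · change Ideal.Quotient.mk I (t * a) = t • 0
        rw [smul_zero, Ideal.Quotient.eq_zero_iff_mem]
        exact ha)
    exact Ideal.Quotient.eq_zero_iff_mem.mp (congrArg Prod.snd this)

/-- The quotient of a one-dimensional complete intersection by a parameter has simple socle,
generated by the determinant of a matrix that expresses the equations in a regular system
of parameters. -/
theorem CIPresentation.exists_socle_generator (c : CIPresentation π) {t : A}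
    (htm : t ∈ maximalIdeal A) (ht : t ∈ nonZeroDivisors A) :
    ∃ s : A ⧸ Ideal.span {t}, (∀ m ∈ maximalIdeal A, m • s = 0) ∧
      ∀ e : A ⧸ Ideal.span {t}, (∀ m ∈ maximalIdeal A, m • e = 0) →
        e ∈ Submodule.span A {s} := by
  obtain ⟨ϖ, hϖ⟩ := IsDiscreteValuationRing.exists_irreducible O
  obtain ⟨τ, rfl⟩ := c.surjective t
  have hmm : ∀ r, c.ψ r ∈ maximalIdeal A ↔ r ∈ maximalIdeal _ := fun r =>
    map_mem_maximalIdeal_iff (f := (c.ψ : MvPowerSeries (Fin c.n) O →+* A)) c.surjective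
  have hτ := (hmm τ).mp htm
  let X : Fin (c.n + 1) → MvPowerSeries (Fin c.n) O :=
    Fin.snoc (augVar (π.comp c.ψ)) (MvPowerSeries.C ϖ)
  let F : Fin (c.n + 1) → MvPowerSeries (Fin c.n) O := Fin.snoc c.f τ
  have hofFn : ∀ (g : Fin c.n → MvPowerSeries (Fin c.n) O) r,
      List.ofFn (Fin.snoc g r : Fin (c.n + 1) → MvPowerSeries (Fin c.n) O) =
        List.ofFn g ++ [r] := fun g r => by
    rw [List.ofFn_succ', List.concat_eq_append]
    simp
  have hspan : ∀ (g : Fin c.n → MvPowerSeries (Fin c.n) O) r,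
      Ideal.span (Set.range (Fin.snoc g r : Fin (c.n + 1) → MvPowerSeries (Fin c.n) O)) =
        Ideal.span (Set.range g) ⊔ Ideal.span {r} := fun g r => by
    rw [← ofList_ofFn, hofFn, Ideal.ofList_append, ofList_ofFn, Ideal.ofList_singleton]
  have hXm : Ideal.span (Set.range X) = maximalIdeal _ := by
    rw [hspan, span_augVar_sup _ hϖ]
  have hF : ∀ r, r ∈ Ideal.span (Set.range F) ↔ c.ψ r ∈ Ideal.span {c.ψ τ} := by
    intro r
    rw [hspan, ← c.ker_eq, sup_comm]
    have h1 := Ideal.comap_map_of_surjective' (c.ψ : _ →+* A) c.surjective (Ideal.span {τ})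
    rw [Ideal.map_span, Set.image_singleton] at h1
    exact (Ideal.ext_iff.mp h1 r).symm
  have hFm : ∀ i, F i ∈ maximalIdeal _ := fun i => by
    refine Fin.lastCases ?_ (fun j => ?_) i
    · simpa [F] using hτ
    · simpa [F] using c.f_mem_maximalIdeal j
  have hM : ∀ i, ∃ m : Fin (c.n + 1) → MvPowerSeries (Fin c.n) O, ∑ j, m j * X j = F i :=
    fun i => Ideal.mem_span_range_iff_exists_fun.mp (hXm.ge (hFm i))
  choose M hM using hM
  have hXreg : IsWeaklyRegular (MvPowerSeries (Fin c.n) O) (List.ofFn X) := by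
    rw [hofFn]
    exact isWeaklyRegular_augVar_append _ hϖ
  have hFreg : IsWeaklyRegular (MvPowerSeries (Fin c.n) O) (List.ofFn F) := by
    rw [hofFn, ← isWeaklyRegular_quotient_bot_iff, isWeaklyRegular_quotient_append_iff,
      isWeaklyRegular_quotient_bot_iff, isWeaklyRegular_quotient_singleton_iff, bot_sup_eq,
      ofList_ofFn]
    refine ⟨c.isWeaklyRegular, fun a ha => ?_⟩
    rw [← c.ψ_eq_zero_iff] at ha ⊢
    rw [map_mul] at ha
    exact (mul_right_mem_nonZeroDivisors_eq_zero_iff ht).mp ha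
  -- `A ⧸ t` is the quotient by `F = M X`; Wiebe's theorem computes `(F) : (X)`, the preimage of the socle
  refine ⟨Ideal.Quotient.mk _ (c.ψ (Matrix.of M).det), fun m hm => ?_, fun e he => ?_⟩
  · obtain ⟨r, rfl⟩ := c.surjective m
    have hr : r ∈ Ideal.span (Set.range X) := hXm.ge ((hmm r).mp hm)
    change Ideal.Quotient.mk _ (c.ψ r * c.ψ (Matrix.of M).det) = 0
    rw [Ideal.Quotient.eq_zero_iff_mem, ← map_mul, ← hF]
    obtain ⟨y, rfl⟩ := Ideal.mem_span_range_iff_exists_fun.mp hr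
    rw [Finset.sum_mul]
    refine sum_mem fun j _ => ?_
    rw [mul_assoc, mul_comm (X j)]
    refine Ideal.mul_mem_left _ _ (det_mul_mem_of_mulVec_mem (fun i => ?_) j)
    have : (Matrix.of M).mulVec X i = F i := hM i
    rw [this]
    exact Ideal.subset_span ⟨i, rfl⟩
  · obtain ⟨a, rfl⟩ := Ideal.Quotient.mk_surjective e
    obtain ⟨r, rfl⟩ := c.surjective a
    have h := mem_of_forall_mul_mem_of_isWeaklyRegular (b := ⊥) (x := X) (f := F)
      (fun i => hXm.le (Ideal.subset_span ⟨i, rfl⟩)) hFm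
      ((isWeaklyRegular_quotient_bot_iff _).mpr hXreg)
      ((isWeaklyRegular_quotient_bot_iff _).mpr hFreg) (M := Matrix.of M) (fun i => by
        rw [Ideal.mem_bot, sub_eq_zero]
        exact (hM i).symm) (a := r) (fun j => by
        rw [bot_sup_eq, hF, mul_comm, map_mul, ← Ideal.Quotient.eq_zero_iff_mem]
        exact he _ ((hmm _).mpr (hXm.le (Ideal.subset_span ⟨j, rfl⟩))))
    rw [bot_sup_eq, Submodule.mem_sup] at h
    obtain ⟨y, hy, z, hz, rfl⟩ := h
    obtain ⟨z', rfl⟩ := Ideal.mem_span_singleton'.mp hz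
    rw [Submodule.mem_span_singleton]
    refine ⟨c.ψ z', ?_⟩
    rw [map_add, map_add, Ideal.Quotient.eq_zero_iff_mem.mpr ((hF y).mp hy), zero_add,
      map_mul c.ψ]
    rfl

end Gorenstein

section Congruence

set_option linter.unusedSectionVars false

variable {O : Type u} [CommRing O] [IsDomain O] [IsDiscreteValuationRing O]
  {A : Type w} [CommRing A] [Algebra O A] {B : Type v} [CommRing B] [Algebra O B]

/-- For a surjection, the image of an ideal is its set-theoretic image. -/
theorem mem_map_aug_iff {π : A →ₐ[O] O} {I : Ideal A} {r : O} :
    r ∈ I.map π ↔ ∃ a ∈ I, π a = r :=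
  Ideal.mem_map_iff_of_surjective (π : A →+* O) fun r => ⟨algebraMap O A r, π.commutes r⟩

/-- The congruence ideal of the largest Cohen–Macaulay quotient of `B`, in terms of a surjection
`A → B`. -/
theorem mem_congruenceIdeal_quotAug_iff [IsLocalRing B] {φ : A →ₐ[O] B}
    (hφ : Function.Surjective φ) (π : B →ₐ[O] O) {r : O} :
    r ∈ congruenceIdeal (quotAug π (cmKernel B) (cmKernel_le_ker π)) ↔
      ∃ a : A, (∀ p, (π.comp φ) p = 0 → φ (a * p) ∈ cmKernel B) ∧ (π.comp φ) a = r := by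
  rw [congruenceIdeal, mem_map_aug_iff]
  constructor
  · rintro ⟨y, hy, rfl⟩
    obtain ⟨b, rfl⟩ := Ideal.Quotient.mk_surjective y
    obtain ⟨a, rfl⟩ := hφ b
    refine ⟨a, fun p hp => ?_, rfl⟩
    have h := Submodule.mem_annihilator.mp hy (Ideal.Quotient.mk _ (φ p)) hp
    rw [smul_eq_mul, ← map_mul, ← map_mul] at h
    exact Ideal.Quotient.eq_zero_iff_mem.mp h
  · rintro ⟨a, ha, rfl⟩
    refine ⟨Ideal.Quotient.mk _ (φ a), ?_, rfl⟩
    rw [Submodule.mem_annihilator]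
    intro y hy
    obtain ⟨b, rfl⟩ := Ideal.Quotient.mk_surjective y
    obtain ⟨p, rfl⟩ := hφ b
    rw [smul_eq_mul, ← map_mul, ← map_mul]
    exact Ideal.Quotient.eq_zero_iff_mem.mpr (ha p hy)

/-- The congruence ideal of a complete intersection cover `A` of `B` is the product of `π (Ann J)`,
where `J` is the kernel of `A → B`, and the congruence ideal of the largest Cohen–Macaulay
quotient of `B`. By Gorenstein duality over `A`, the map `z ↦ (π z / π y) s` on `Ann J`, with
`y ∈ Ann J` and `s` killing the kernel of `π`, is the multiplication by an element `a`, which satisfies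
`a y = s`, and `a` kills the kernel of `π` modulo the double annihilator of `J`. -/
theorem congruenceIdeal_eq_mul [IsLocalRing A] [IsNoetherianRing A] [IsLocalRing B]
    [IsNoetherianRing B] (hA : ringKrullDim A = 1) (hB : ringKrullDim B = 1) {φ : A →ₐ[O] B}
    (hφ : Function.Surjective φ) {π : B →ₐ[O] O} (c : CIPresentation (π.comp φ))
    (hfin : IsFiniteLength O (CotSpace (π.comp φ))) :
    congruenceIdeal (π.comp φ) = (RingHom.ker φ).annihilator.map (π.comp φ) *
      congruenceIdeal (quotAug π (cmKernel B) (cmKernel_le_ker π)) := by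
  set χ := π.comp φ with hχ
  set J := RingHom.ker φ with hJ
  have hann : ∀ (I : Ideal A) {x y : A}, x ∈ I.annihilator → y ∈ I → x * y = 0 :=
    fun I x y hx hy => Submodule.mem_annihilator.mp hx y hy
  have hmax : ∀ a : A, φ a ∈ maximalIdeal B ↔ a ∈ maximalIdeal A := fun a =>
    map_mem_maximalIdeal_iff (f := (φ : A →+* B)) hφ
  set J' : Ideal A := (cmKernel B).comap φ with hJ'
  have hJJ' : J ≤ J' := fun j hj => by
    rw [hJ', Ideal.mem_comap, RingHom.mem_ker.mp hj]
    exact zero_mem _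
  -- `A ⧸ J'` is the largest Cohen–Macaulay quotient of `B`
  have hsoc : ∀ a : A, (∀ m ∈ maximalIdeal A, a * m ∈ J') → a ∈ J' := by
    intro a ha
    obtain ⟨-, x, hx, hxreg⟩ := (cmKernel_isLeast B hB).1
    obtain ⟨m, rfl⟩ := hφ x
    have h1 := ha m ((hmax m).mp hx)
    rw [hJ', Ideal.mem_comap, map_mul, ← Ideal.Quotient.eq_zero_iff_mem, map_mul] at h1
    have h2 : φ a ∈ cmKernel B := Ideal.Quotient.eq_zero_iff_mem.mp
      ((mul_right_mem_nonZeroDivisors_eq_zero_iff hxreg).mp h1)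
    exact h2
  obtain ⟨t, htm, ht, htJ'⟩ := exists_regular_mem_maximalIdeal
    (fun a ha => c.eq_zero_of_forall_mul_eq_zero ha) hsoc
  have ht0 : ∀ {a : A}, t * a = 0 → a = 0 := fun {a} h =>
    (mul_left_mem_nonZeroDivisors_eq_zero_iff ht).mp h
  have hKdim : Ring.KrullDimLE 1 A := by
    rw [Ring.krullDimLE_iff, hA]
    rfl
  have hAt := isFiniteLength_quotient_span_singleton A ht
  obtain ⟨s₀, hs₀, hs₀'⟩ := c.exists_socle_generator htm ht
  have hdd : J'.annihilator.annihilator ≤ J' :=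
    annihilator_annihilator_le htm ht hAt hs₀ hs₀' htJ'
  -- `J` and `J'` have the same annihilator
  have hAnn : ∀ z ∈ J.annihilator, ∀ j ∈ J', z * j = 0 := by
    rintro z hz j ⟨k, hk⟩
    have h1 : t ^ k * j ∈ J := by
      rw [hJ, RingHom.mem_ker, map_mul, map_pow]
      exact hk _ (Ideal.pow_mem_pow ((hmax t).mpr htm) k)
    have h2 : t ^ k * (z * j) = 0 := by
      rw [mul_left_comm]
      exact hann J hz h1
    exact (mul_left_mem_nonZeroDivisors_eq_zero_iff (pow_mem ht k)).mp h2
  obtain ⟨σ, hσ, hσ0⟩ := c.exists_mem_annihilator hfin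
  have hJχ : ∀ j ∈ J, χ j = 0 := fun j hj => by
    rw [hχ, AlgHom.comp_apply, RingHom.mem_ker.mp hj, map_zero]
  have hσJ : ∀ s ∈ (RingHom.ker χ).annihilator, s ∈ J.annihilator := fun s hs =>
    Submodule.mem_annihilator.mpr fun j hj => hann _ hs (hJχ j hj)
  apply le_antisymm
  · intro r hr
    obtain ⟨s, hs, rfl⟩ := mem_map_aug_iff.mp hr
    obtain ⟨g, hg⟩ := (IsPrincipalIdealRing.principal (J.annihilator.map χ)).principal
    obtain ⟨y, hy, hyg⟩ := mem_map_aug_iff.mp (hg.ge (Ideal.mem_span_singleton_self g))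
    have hdiv : ∀ z : J.annihilator, ∃ r, χ z = r * g := fun z => by
      have h1 : χ z ∈ J.annihilator.map χ := Ideal.mem_map_of_mem _ z.2
      rw [hg] at h1
      obtain ⟨r, hr⟩ := Ideal.mem_span_singleton'.mp h1
      exact ⟨r, hr.symm⟩
    have hg0 : g ≠ 0 := by
      rintro rfl
      obtain ⟨r, hr⟩ := hdiv ⟨σ, hσJ σ hσ⟩
      rw [mul_zero] at hr
      exact hσ0 hr
    -- `g = χ y` generates `χ (Ann J)`, and `q z = χ z / χ y`
    choose q hq using hdiv
    have hqu : ∀ z r, χ z.1 = r * g → q z = r := fun z r h =>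
      mul_right_cancel₀ hg0 ((hq z).symm.trans h)
    have hsmul : ∀ a : A, a * s = algebraMap O A (χ a) * s := fun a => by
      have h1 := hann _ hs (y := a - algebraMap O A (χ a)) (by
        rw [RingHom.mem_ker, map_sub, AlgHom.commutes]
        exact sub_self _)
      rw [mul_sub, sub_eq_zero] at h1
      rw [mul_comm, h1, mul_comm]
    let F : J.annihilator →ₗ[A] A :=
      { toFun := fun z => algebraMap O A (q z) * s
        map_add' := fun z z' => by
          rw [hqu (z + z') (q z + q z') (by
            rw [Submodule.coe_add, map_add, hq, hq, add_mul]), map_add, add_mul]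
        map_smul' := fun a z => by
          rw [hqu (a • z) (χ a * q z) (by
            rw [Submodule.coe_smul, smul_eq_mul, map_mul, hq, mul_assoc]), RingHom.id_apply,
            smul_eq_mul, mul_left_comm, hsmul a, map_mul]
          ring }
    obtain ⟨a, ha⟩ := exists_mul_eq_of_linearMap htm ht hAt hs₀ hs₀' (I := J.annihilator)
      (fun x hx => Submodule.mem_annihilator.mpr fun j hj => ht0 (by
        have := hann J hx hj
        rwa [mul_assoc] at this)) F
    have hay : a * y = s := by
      rw [← ha ⟨y, hy⟩]
      change algebraMap O A (q _) * s = s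
      rw [hqu ⟨y, hy⟩ 1 (by rw [one_mul, hyg]), map_one, one_mul]
    have haC : χ a ∈ congruenceIdeal (quotAug π (cmKernel B) (cmKernel_le_ker π)) := by
      rw [mem_congruenceIdeal_quotAug_iff hφ]
      refine ⟨a, fun p hp => ?_, rfl⟩
      have h1 : a * p ∈ J'.annihilator.annihilator := Submodule.mem_annihilator.mpr fun z hz => by
        have hz' : z ∈ J.annihilator := Submodule.mem_annihilator.mpr fun j hj =>
          hann J' hz (hJJ' hj)
        have h2 : a * z = algebraMap O A (q ⟨z, hz'⟩) * s := (ha ⟨z, hz'⟩).symm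
        rw [smul_eq_mul, mul_right_comm, h2, mul_assoc, hann _ hs hp, mul_zero]
      exact hdd h1
    rw [← hay, map_mul, mul_comm (χ a)]
    exact Ideal.mul_mem_mul (Ideal.mem_map_of_mem χ hy) haC
  · rw [Ideal.mul_le]
    intro r hr r' hr'
    obtain ⟨z, hz, rfl⟩ := mem_map_aug_iff.mp hr
    obtain ⟨a, ha, rfl⟩ := (mem_congruenceIdeal_quotAug_iff hφ π).mp hr'
    rw [← map_mul]
    refine Ideal.mem_map_of_mem χ (Submodule.mem_annihilator.mpr fun p hp => ?_)
    rw [smul_eq_mul, mul_assoc]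
    exact hAnn z hz _ (ha p hp)

end Congruence

section Formula

set_option linter.unusedSectionVars false

variable {O : Type u} [CommRing O] [IsDomain O] [IsDiscreteValuationRing O]

theorem length_quotient_mul {I J : Ideal O} (hJ : J ≠ ⊥) :
    Module.length O (O ⧸ I * J) = Module.length O (O ⧸ I) + Module.length O (O ⧸ J) := by
  obtain ⟨a, rfl⟩ := (IsPrincipalIdealRing.principal I).principal
  obtain ⟨b, rfl⟩ := (IsPrincipalIdealRing.principal J).principal
  have hb : b ≠ 0 := by
    rintro rfl
    exact hJ (Submodule.span_zero_singleton O)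
  have h := Ring.ord_mul O (a := a) (mem_nonZeroDivisors_of_ne_zero hb)
  simp only [Ring.ord] at h
  rw [← h, ← Ideal.span_singleton_mul_span_singleton]

theorem isFiniteLength_quotient_ideal {I : Ideal O} (hI : I ≠ ⊥) : IsFiniteLength O (O ⧸ I) := by
  obtain ⟨a, haI, ha⟩ := Submodule.exists_mem_ne_zero_of_ne_bot hI
  refine isFiniteLength_of_smul_eq_zero ha fun m => ?_
  obtain ⟨b, rfl⟩ := Ideal.Quotient.mk_surjective m
  change Ideal.Quotient.mk I (a * b) = 0
  exact Ideal.Quotient.eq_zero_iff_mem.mpr (I.mul_mem_right b haI)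

theorem length_quotient_eq_add {P Q : Ideal O} (h : Q ≤ P) :
    Module.length O (O ⧸ Q) =
      Module.length O (P ⧸ Submodule.submoduleOf Q P) + Module.length O (O ⧸ P) := by
  have hz : ∀ x : P, (Submodule.Quotient.mk x : P ⧸ Submodule.submoduleOf Q P) = 0 ↔ x.1 ∈ Q :=
    fun x => Submodule.Quotient.mk_eq_zero _
  have hz' : ∀ (I : Ideal O) (x : O), (Submodule.Quotient.mk x : O ⧸ I) = 0 ↔ x ∈ I :=
    fun I x => Submodule.Quotient.mk_eq_zero I
  let F : (P ⧸ Submodule.submoduleOf Q P) →ₗ[O] O ⧸ Q :=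
    Submodule.liftQ _ ((Submodule.mkQ Q).comp P.subtype) fun x hx => (hz' Q x.1).mpr hx
  let G : (O ⧸ Q) →ₗ[O] O ⧸ P := Submodule.factor h
  have hF : ∀ x : P, F (Submodule.Quotient.mk x) = Submodule.Quotient.mk x.1 := fun x => rfl
  have hG : ∀ x : O, G (Submodule.Quotient.mk x) = Submodule.Quotient.mk x := fun x => rfl
  refine Module.length_eq_add_of_exact F G ?_ (Submodule.factor_surjective h) ?_
  · rw [injective_iff_map_eq_zero]
    intro y hy
    obtain ⟨x, rfl⟩ := Submodule.Quotient.mk_surjective _ y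
    rw [hF, hz'] at hy
    exact (hz x).mpr hy
  · intro y
    obtain ⟨x, rfl⟩ := Submodule.Quotient.mk_surjective _ y
    rw [hG, hz']
    constructor
    · exact fun hx => ⟨Submodule.Quotient.mk ⟨x, hx⟩, hF _⟩
    · rintro ⟨z, hz⟩
      obtain ⟨w, rfl⟩ := Submodule.Quotient.mk_surjective _ z
      rw [hF, Submodule.Quotient.eq] at hz
      have := P.sub_mem w.2 (h hz)
      rwa [sub_sub_cancel] at this

variable {A : Type w} [CommRing A] [Algebra O A] {B : Type v} [CommRing B] [Algebra O B]

/-- The relation between the lengths of the invariants of `B`, computed from a complete intersection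
cover `A`: the exact sequence of derivations gives
`ℓ(Der¹(B)) + ℓ(Der⁰(A)) = ℓ(Hom(J, E/O)) + ℓ(Der⁰(B))`, where `ℓ(Hom(J, E/O))` is the colength of
`π (Fitt J)` and `ℓ(Der⁰(A))` that of the congruence ideal of `A`, which is the product of
`π (Ann J)` and of the congruence ideal of the largest Cohen–Macaulay quotient of `B`. -/
theorem IsCICover.length_formula [IsLocalRing B] [IsNoetherianRing B]
    (hB : ringKrullDim B = 1) {π : B →ₐ[O] O} (hπ : IsFiniteLength O (CotSpace π)) {φ : A →ₐ[O] B}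
    (h : IsCICover π φ) {d : ℕ} {x : Fin d → A} (hx : Ideal.span (Set.range x) = RingHom.ker φ) :
    IsFiniteLength O (C0 π) ∧ IsFiniteLength O (Der0 O B (EModO π)) ∧
      IsFiniteLength O (Der1 O B (EModO π)) ∧ IsFiniteLength O (C1 (π.comp φ) x) ∧
      Module.length O (C0 π) + Module.length O (Der1 O B (EModO π)) =
        Module.length O (Der0 O B (EModO π)) + Module.length O (C1 (π.comp φ) x) := by
  obtain ⟨c⟩ := h.nonempty_ciPresentation
  have := c.isNoetherianRing
  have := c.isLocalRing
  have hfin := h.finite_cotSpace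
  obtain ⟨σ, hσ, hσ0⟩ := c.exists_mem_annihilator hfin
  set χ := π.comp φ with hχ
  have hle : RingHom.ker φ ≤ RingHom.ker χ := fun j hj => by
    rw [RingHom.mem_ker, hχ, AlgHom.comp_apply, RingHom.mem_ker.mp hj, map_zero]
  have hχx : ∀ i, χ (x i) = 0 := fun i => hle (hx ▸ Ideal.subset_span ⟨i, rfl⟩)
  have hσ' : ∀ a, χ a = 0 → σ * a = 0 := fun a ha => Submodule.mem_annihilator.mp hσ a ha
  -- the exact sequence for `A → B`
  have hseq := length_der_one_add_length_augDer h.surjective π hle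
    (fun g => c.exists_augDer hfin π
      (fun a => ⟨MvPolynomial.X a, by rw [MvPolynomial.aeval_X]; rfl⟩) g)
  have hder : Module.length O (Der0 O B (EModO π)) = Module.length O (AugDer π (EModO π)) :=
    LinearEquiv.length_eq (R := O) (M := Der0 O B (EModO π)) (N := AugDer π (EModO π))
      (derZeroEquiv π)
  have hmul := congruenceIdeal_eq_mul h.dim_eq_one hB h.surjective c hfin
  have hcong : congruenceIdeal χ ≠ ⊥ := fun h0 => hσ0 (by
    have h1 : χ σ ∈ congruenceIdeal χ := Ideal.mem_map_of_mem _ hσ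
    rwa [h0, Ideal.mem_bot] at h1)
  have hC0 : congruenceIdeal (quotAug π (cmKernel B) (cmKernel_le_ker π)) ≠ ⊥ := fun h0 => by
    rw [h0, Ideal.mul_bot] at hmul
    exact hcong hmul
  have hAnn : (RingHom.ker φ).annihilator.map χ ≠ ⊥ := fun h0 => by
    rw [← hχ, h0, Ideal.bot_mul] at hmul
    exact hcong hmul
  -- `σ` kills all `x i`, so that the scalar matrix `σ` consists of relations
  have hFitt : (fittingIdeal x).map χ ≠ ⊥ := fun h0 => by
    have h1 : σ ^ d ∈ fittingIdeal x := Ideal.subset_span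
      ⟨σ • (1 : Matrix (Fin d) (Fin d) A), by
        ext i
        simp [Matrix.smul_mulVec, hσ' _ (hχx i)], by simp⟩
    have h2 := Ideal.mem_map_of_mem χ h1
    rw [h0, Ideal.mem_bot, map_pow] at h2
    exact pow_ne_zero d hσ0 h2
  have hhom := length_augHom χ x hχx π hσ' hσ0
  have hC1 : Module.length O (O ⧸ (fittingIdeal x).map χ) = Module.length O (C1 χ x) +
      Module.length O (O ⧸ (RingHom.ker φ).annihilator.map χ) := by
    rw [← hx]
    exact length_quotient_eq_add (Ideal.map_mono (CIPresentation.fittingIdeal_le_annihilator x))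
  rw [hx] at hhom
  have hΦ := c.length_augDer π hfin
  rw [← hder, hhom, hΦ, hmul, length_quotient_mul hC0, hC1] at hseq
  have f1 := Module.length_ne_top_iff.mpr (isFiniteLength_quotient_ideal hAnn)
  have f2 := Module.length_ne_top_iff.mpr (isFiniteLength_quotient_ideal hC0)
  have f3 : Module.length O (Der0 O B (EModO π)) ≠ ⊤ := by
    rw [length_derZero hπ]
    exact Module.length_ne_top_iff.mpr hπ
  have f4 : Module.length O (C1 χ x) ≠ ⊤ := by
    have := Module.length_ne_top_iff.mpr (isFiniteLength_quotient_ideal hFitt)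
    rw [hC1] at this
    exact fun h0 => this (by rw [h0, top_add])
  have f5 : Module.length O (Der1 O B (EModO π)) ≠ ⊤ := fun h0 => by
    rw [h0, top_add] at hseq
    exact WithTop.add_ne_top.mpr ⟨f3, WithTop.add_ne_top.mpr ⟨f4, f1⟩⟩ hseq.symm
  refine ⟨Module.length_ne_top_iff.mp f2, Module.length_ne_top_iff.mp f3,
    Module.length_ne_top_iff.mp f5, Module.length_ne_top_iff.mp f4, ?_⟩
  apply ENat.add_left_injective_of_ne_top f1
  change _ + _ = _ + _
  rw [add_assoc (Module.length O (Der0 O B (EModO π))), ← hseq]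
  ring

end Formula

/-! ### Existence of complete intersection covers -/

section Evaluation

variable {O : Type u} [CommRing O] {B : Type v} [CommRing B] [Algebra O B]

/-- Power series can be evaluated at elements of an ideal for whose powers `B` is complete. -/
theorem exists_mvPowerSeries_algHom (I : Ideal B) [IsAdicComplete I B] {n : ℕ} (y : Fin n → B)
    (hy : ∀ i, y i ∈ I) :
    ∃ Φ : MvPowerSeries (Fin n) O →ₐ[O] B, ∀ i, Φ (MvPowerSeries.X i) = y i := by
  -- polynomials can be evaluated, and the truncations of a power series give compatible values modulo
  -- the powers of `I`
  have hle : ∀ m, MvPolynomial.idealOfVars (Fin n) O ^ m ≤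
      (I ^ m).comap (MvPolynomial.aeval y : MvPolynomial (Fin n) O →ₐ[O] B) := by
    intro m
    refine le_trans (Ideal.pow_right_mono ?_ m) (Ideal.le_comap_pow _ m)
    rw [MvPolynomial.idealOfVars, Ideal.span_le]
    rintro _ ⟨i, rfl⟩
    change MvPolynomial.aeval y (MvPolynomial.X i) ∈ I
    rw [MvPolynomial.aeval_X]
    exact hy i
  let g : ∀ m, (MvPolynomial (Fin n) O ⧸ MvPolynomial.idealOfVars (Fin n) O ^ m) →ₐ[O] B ⧸ I ^ m :=
    fun m => Ideal.Quotient.liftₐ _ ((Ideal.Quotient.mkₐ O (I ^ m)).comp (MvPolynomial.aeval y))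
      fun a ha => Ideal.Quotient.eq_zero_iff_mem.mpr (hle m ha)
  let f : ∀ m, MvPowerSeries (Fin n) O →ₐ[O] B ⧸ I ^ m := fun m =>
    (g m).comp ((MvPowerSeries.truncTotalAlgHom (Fin n) O m).restrictScalars O)
  have hf0 : ∀ m p, f m p =
      Ideal.Quotient.mk (I ^ m) (MvPolynomial.aeval y (MvPowerSeries.truncTotal m p)) :=
    fun m p => rfl
  have hf : ∀ {m k : ℕ} (h : m ≤ k),
      (Ideal.Quotient.factorₐ O (Ideal.pow_le_pow_right h)).comp (f k) = f m := by
    intro m k h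
    ext p
    change Ideal.Quotient.mk (I ^ m) (MvPolynomial.aeval y (MvPowerSeries.truncTotal k p)) =
      Ideal.Quotient.mk (I ^ m) (MvPolynomial.aeval y (MvPowerSeries.truncTotal m p))
    rw [Ideal.Quotient.eq, ← map_sub]
    exact hle m (MvPowerSeries.truncTotal_sub_truncTotal_mem_pow_idealOfVars h le_rfl p)
  refine ⟨IsAdicComplete.liftAlgHom I f hf, fun i => ?_⟩
  rw [← sub_eq_zero]
  refine IsHausdorff.haus (I := I) inferInstance _ fun m => ?_
  rw [SModEq.zero, smul_eq_mul, Ideal.mul_top, ← Ideal.Quotient.eq_zero_iff_mem, map_sub,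
    IsAdicComplete.mk_liftAlgHom, sub_eq_zero]
  have h1 : (MvPowerSeries.truncTotalAlgHom (Fin n) O m) (MvPowerSeries.X i) =
      Ideal.Quotient.mk _ (MvPolynomial.X i) := by
    have h := (MvPowerSeries.truncTotalAlgHom (Fin n) O m).commutes (MvPolynomial.X i)
    rw [← MvPolynomial.coe_X]
    exact h
  change g m ((MvPowerSeries.truncTotalAlgHom (Fin n) O m) (MvPowerSeries.X i)) = _
  rw [h1]
  change Ideal.Quotient.mk (I ^ m) (MvPolynomial.aeval y (MvPolynomial.X i)) = _
  rw [MvPolynomial.aeval_X]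

end Evaluation

section Avoidance

open RingTheory.Sequence

variable {R : Type u} [CommRing R] [IsLocalRing R] [IsNoetherianRing R]

/-- If the depth of `R/b` is at least `n + e` and `R/P` has dimension at most `e` for all primes `P`
that contain `b` and `H`, each sequence of length `n` becomes regular on `R/b` after adding
suitable elements of `H`. -/
theorem exists_add_isWeaklyRegular {b H : Ideal R} (hb : b ≠ ⊤) (hH : H ≤ maximalIdeal R) {n e : ℕ}
    (hdepth : ∃ l : List R, l.length = n + e ∧ (∀ r ∈ l, r ∈ maximalIdeal R) ∧
      IsWeaklyRegular (R ⧸ b) l)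
    (hdim : ∀ P : Ideal R, P.IsPrime → b ≤ P → H ≤ P → ringKrullDim (R ⧸ P) ≤ e)
    (g : Fin n → R) (hg : ∀ i, g i ∈ maximalIdeal R) :
    ∃ h : Fin n → R, (∀ i, h i ∈ H) ∧ IsWeaklyRegular (R ⧸ b) (List.ofFn fun i => g i + h i) := by
  induction n generalizing e with
  | zero => exact ⟨fun i => i.elim0, fun i => i.elim0, by simp⟩
  | succ n ih =>
    obtain ⟨h, hhH, hreg⟩ := ih (e := e + 1) (by
        obtain ⟨l, hl⟩ := hdepth
        exact ⟨l, by rw [hl.1]; omega, hl.2⟩)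
      (fun P hP hbP hHP => (hdim P hP hbP hHP).trans (by exact_mod_cast Nat.le_succ e))
      (fun i => g i.castSucc) (fun i => hg _)
    set l := List.ofFn fun i => g i.castSucc + h i with hl
    have hlm : ∀ r ∈ l, r ∈ maximalIdeal R := by
      intro r hr
      rw [hl, List.mem_ofFn] at hr
      obtain ⟨i, rfl⟩ := hr
      exact add_mem (hg _) (hH (hhH i))
    obtain ⟨l', hl', hm', hreg'⟩ := exists_isWeaklyRegular_quotient_sup hb hreg hlm (n := e + 1) (by
      obtain ⟨l0, h0⟩ := hdepth
      exact ⟨l0, by rw [h0.1, hl, List.length_ofFn]; omega, h0.2⟩)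
    -- the quotient by the first `n` members has depth at least `e + 1`, so that no associated prime
    -- contains `H`
    obtain ⟨j, hj, hjreg⟩ := exists_add_isSMulRegular (R ⧸ (b ⊔ Ideal.ofList l))
      (x := g (Fin.last n)) (J := H) fun P hP hle => by
        have h1 := length_le_ringKrullDim_quotient_of_mem_associatedPrimes hreg' hm' hP
        have hPann : b ⊔ Ideal.ofList l ≤ P := by
          have := hP.annihilator_le
          rwa [Submodule.annihilator_top, Ideal.annihilator_quotient] at this
        have h2 := hdim P hP.isPrime (le_sup_left.trans hPann) (le_sup_right.trans hle)
        have h3 := h1.trans h2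
        rw [hl'] at h3
        have h4 : e + 1 ≤ e := by exact_mod_cast h3
        omega
    refine ⟨Fin.snoc h j, fun i => ?_, ?_⟩
    · refine Fin.lastCases ?_ (fun i => ?_) i
      · rwa [Fin.snoc_last]
      · rw [Fin.snoc_castSucc]
        exact hhH i
    · rw [List.ofFn_succ', List.concat_eq_append, isWeaklyRegular_quotient_append_iff]
      have h1 : (List.ofFn fun i : Fin n => g i.castSucc +
          (Fin.snoc h j : Fin (n + 1) → R) i.castSucc) = l := by
        simp only [Fin.snoc_castSucc, hl]
      rw [h1, Fin.snoc_last]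
      refine ⟨hreg, ?_⟩
      rw [isWeaklyRegular_quotient_singleton_iff]
      exact (isSMulRegular_quotient_iff _ _).mp hjreg

end Avoidance

section Existence

open RingTheory.Sequence

variable {O : Type u} [CommRing O] [IsDomain O] [IsDiscreteValuationRing O]
  {B : Type v} [CommRing B] [Algebra O B]

/-- A complete Noetherian local augmented `O`-algebra is a quotient of a power series ring. -/
theorem exists_mvPowerSeries_algHom_surjective [IsLocalRing B] [IsNoetherianRing B]
    [IsAdicComplete (maximalIdeal B) B] (π : B →ₐ[O] O) :
    ∃ (n : ℕ) (Φ : MvPowerSeries (Fin n) O →ₐ[O] B), Function.Surjective Φ := by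
  obtain ⟨n, y, hy⟩ := Submodule.fg_iff_exists_fin_generating_family.mp
    (IsNoetherian.noetherian (RingHom.ker π))
  have hne : RingHom.ker π ≠ ⊤ := RingHom.ker_ne_top _
  have hyk : ∀ i, y i ∈ RingHom.ker π := fun i => hy ▸ Submodule.subset_span ⟨i, rfl⟩
  obtain ⟨Φ, hΦ⟩ := exists_mvPowerSeries_algHom (O := O) (maximalIdeal B) y
    fun i => le_maximalIdeal hne (hyk i)
  refine ⟨n, Φ, ?_⟩
  have hmap : (Ideal.span (Set.range (MvPowerSeries.X (σ := Fin n) (R := O)))).map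
      (Φ : MvPowerSeries (Fin n) O →+* B) = RingHom.ker π := by
    rw [Ideal.map_span, ← Set.range_comp, ← hy]
    exact congrArg (fun z => Ideal.span (Set.range z)) (funext hΦ)
  have : IsHausdorff ((Ideal.span (Set.range (MvPowerSeries.X (σ := Fin n) (R := O)))).map
      (Φ : MvPowerSeries (Fin n) O →+* B)) B := by
    rw [hmap]
    exact IsHausdorff.of_isLocalRing _ _ hne
  refine surjective_of_mk_map_comp_surjective (Φ : MvPowerSeries (Fin n) O →+* B)
    (I := Ideal.span (Set.range (MvPowerSeries.X (σ := Fin n) (R := O)))) fun b => ?_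
  obtain ⟨b, rfl⟩ := Ideal.Quotient.mk_surjective b
  refine ⟨algebraMap O _ (π b), ?_⟩
  rw [RingHom.comp_apply, Ideal.Quotient.eq, hmap, RingHom.mem_ker]
  change π (Φ (algebraMap O _ (π b)) - b) = 0
  rw [map_sub, AlgHom.commutes, AlgHom.commutes, Algebra.algebraMap_self_apply, sub_self]

/-- The cotangent space of a Noetherian augmented algebra is finitely generated. -/
theorem finite_cotSpace {O : Type u} [CommRing O] {B : Type v} [CommRing B] [Algebra O B]
    [IsNoetherianRing B] (π : B →ₐ[O] O) : Module.Finite O (CotSpace π) := by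
  have hfin : Module.Finite B (CotSpace π) :=
    Module.Finite.of_surjective (RingHom.ker π).toCotangent (RingHom.ker π).toCotangent_surjective
  obtain ⟨S, hS⟩ := hfin.fg_top
  refine ⟨⟨S, eq_top_iff.mpr fun m _ => ?_⟩⟩
  have hm : m ∈ Submodule.span B (S : Set (CotSpace π)) := hS ▸ trivial
  induction hm using Submodule.span_induction with
  | mem m h => exact Submodule.subset_span h
  | zero => exact zero_mem _
  | add m m' _ _ h h' => exact add_mem (h trivial) (h' trivial)
  | smul b m _ h =>
    have hb : b - algebraMap O B (π b) ∈ RingHom.ker π := by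
      rw [RingHom.mem_ker, map_sub, AlgHom.commutes, Algebra.algebraMap_self_apply, sub_self]
    have h0 : (b - algebraMap O B (π b)) • m = 0 := by
      obtain ⟨k, rfl⟩ := (RingHom.ker π).toCotangent_surjective m
      rw [← map_smul, Ideal.toCotangent_eq_zero, pow_two]
      exact Ideal.mul_mem_mul hb k.2
    rw [sub_smul, algebraMap_smul, sub_eq_zero] at h0
    rw [h0]
    exact Submodule.smul_mem _ _ (h trivial)

theorem isFiniteLength_cotSpace_of_mul_mem [IsNoetherianRing B] {π : B →ₐ[O] O} {c : O} (hc : c ≠ 0)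
    (h : ∀ b ∈ RingHom.ker π, algebraMap O B c * b ∈ RingHom.ker π ^ 2) :
    IsFiniteLength O (CotSpace π) := by
  have := finite_cotSpace π
  refine isFiniteLength_of_smul_eq_zero hc fun m => ?_
  obtain ⟨b, rfl⟩ := (RingHom.ker π).toCotangent_surjective m
  rw [← LinearMap.map_smul_of_tower, Ideal.toCotangent_eq_zero]
  have h1 := h b b.2
  rw [← Algebra.smul_def] at h1
  exact h1

variable {n : ℕ} {Φ : MvPowerSeries (Fin n) O →ₐ[O] B} {π : B →ₐ[O] O}

/-- If `c` kills the cotangent space of `B`, the elements `c ξᵢ`, where the `ξᵢ` are the translated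
variables, are congruent to relations of `B` modulo the square of the ideal of the `ξᵢ`. -/
theorem exists_mem_ker_sub_mem_sq (hΦ : Function.Surjective Φ) {c : O}
    (hc : ∀ m : CotSpace π, c • m = 0) (i : Fin n) :
    ∃ g ∈ RingHom.ker Φ,
      g - MvPowerSeries.C c * augVar (π.comp Φ) i ∈ RingHom.ker (π.comp Φ) ^ 2 := by
  have hker : RingHom.ker π = (RingHom.ker (π.comp Φ)).map (Φ : MvPowerSeries (Fin n) O →+* B) := by
    have h : RingHom.ker (π.comp Φ) = (RingHom.ker π).comap (Φ : MvPowerSeries (Fin n) O →+* B) :=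
      rfl
    rw [h, Ideal.map_comap_of_surjective (Φ : MvPowerSeries (Fin n) O →+* B) hΦ]
  have hmem : Φ (augVar (π.comp Φ) i) ∈ RingHom.ker π := aug_augVar (π.comp Φ) i
  have h := hc ((RingHom.ker π).toCotangent ⟨_, hmem⟩)
  have h1 : Φ (MvPowerSeries.C c * augVar (π.comp Φ) i) ∈ RingHom.ker π ^ 2 := by
    rw [← LinearMap.map_smul_of_tower, Ideal.toCotangent_eq_zero] at h
    have h2 : Φ (MvPowerSeries.C c * augVar (π.comp Φ) i) = c • Φ (augVar (π.comp Φ) i) := by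
      rw [map_mul, Algebra.smul_def]
      congr 1
      exact Φ.commutes c
    rw [h2]
    exact h
  rw [hker, ← Ideal.map_pow] at h1
  obtain ⟨r, hr, hr2⟩ := (Ideal.mem_map_iff_of_surjective (Φ : MvPowerSeries (Fin n) O →+* B) hΦ).mp h1
  refine ⟨MvPowerSeries.C c * augVar (π.comp Φ) i - r, ?_, ?_⟩
  · rw [RingHom.mem_ker, map_sub, sub_eq_zero]
    exact hr2.symm
  · rw [sub_sub_cancel_left]
    exact neg_mem hr

/-- Regular sequences of relations that are congruent to `c ξ₁, …, c ξₙ` modulo the square of the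
ideal of the translated variables `ξᵢ` define complete intersection covers. -/
theorem isCICover_liftₐ [Nontrivial B] (hΦ : Function.Surjective Φ) {c : O} (hc : c ≠ 0)
    {f : Fin n → MvPowerSeries (Fin n) O}
    (hreg : IsWeaklyRegular (MvPowerSeries (Fin n) O) (List.ofFn f))
    (hf : ∀ a ∈ Ideal.span (Set.range f), Φ a = 0)
    (hfc : ∀ i, f i - MvPowerSeries.C c * augVar (π.comp Φ) i ∈ RingHom.ker (π.comp Φ) ^ 2) :
    IsCICover π (Ideal.Quotient.liftₐ (Ideal.span (Set.range f)) Φ hf) := by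
  have hfm : ∀ r ∈ List.ofFn f, r ∈ maximalIdeal (MvPowerSeries (Fin n) O) := by
    intro r hr
    rw [List.mem_ofFn] at hr
    exact le_maximalIdeal (RingHom.ker_ne_top Φ) (hf r (Ideal.subset_span hr))
  have hreg' := IsRegular.of_isWeaklyRegular_of_mem_maximalIdeal _ hfm hreg
  refine ⟨Ideal.Quotient.lift_surjective_of_surjective _ hf hΦ,
    ⟨n, Ideal.Quotient.mkₐ O _, List.ofFn f, Ideal.Quotient.mkₐ_surjective O _, hreg', ?_⟩, ?_, ?_⟩
  · rw [ofList_ofFn]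
    exact Ideal.Quotient.mkₐ_ker O _
  · have h := ringKrullDim_add_length_eq_ringKrullDim_of_isRegular _ hreg'
    rw [ringKrullDim_mvPowerSeries, ofList_ofFn, List.length_ofFn, add_comm (n : WithBot ℕ∞)] at h
    exact (ENat.WithBot.add_natCast_cancel).mp h
  · set χ := π.comp (Ideal.Quotient.liftₐ (Ideal.span (Set.range f)) Φ hf) with hχ
    have hle : ∀ q ∈ RingHom.ker (π.comp Φ) ^ 2,
        Ideal.Quotient.mk (Ideal.span (Set.range f)) q ∈ RingHom.ker χ ^ 2 := by
      intro q hq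
      have h := Ideal.mem_map_of_mem (Ideal.Quotient.mk (Ideal.span (Set.range f))) hq
      rw [Ideal.map_pow] at h
      refine Ideal.pow_right_mono (Ideal.map_le_iff_le_comap.mpr ?_) 2 h
      exact fun q hq => hq
    have hmul : ∀ q ∈ RingHom.ker (π.comp Φ),
        Ideal.Quotient.mk (Ideal.span (Set.range f)) (MvPowerSeries.C c * q) ∈ RingHom.ker χ ^ 2 := by
      intro q hq
      rw [ker_aug_eq_span_augVar] at hq
      induction hq using Submodule.span_induction with
      | mem q h =>
        obtain ⟨i, rfl⟩ := h
        have h1 := hle _ (hfc i)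
        rw [map_sub, Ideal.Quotient.eq_zero_iff_mem.mpr (Ideal.subset_span (Set.mem_range_self i)), zero_sub,
          neg_mem_iff] at h1
        exact h1
      | zero => rw [mul_zero, map_zero]; exact zero_mem _
      | add q q' _ _ h h' => rw [mul_add, map_add]; exact add_mem h h'
      | smul r q _ h =>
        rw [smul_eq_mul, mul_left_comm, map_mul]
        exact Ideal.mul_mem_left _ _ h
    refine isFiniteLength_cotSpace_of_mul_mem hc fun a ha => ?_
    obtain ⟨p, rfl⟩ := Ideal.Quotient.mk_surjective a
    exact hmul p ha

/-- The ring of power series modulo a prime that contains the kernel of an augmentation is a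
quotient of `O`. -/
theorem algebraMap_quotient_surjective {O : Type u} [CommRing O] {n : ℕ}
    (ε : MvPowerSeries (Fin n) O →ₐ[O] O)
    {P : Ideal (MvPowerSeries (Fin n) O)} (hP : RingHom.ker ε ≤ P) :
    Function.Surjective (algebraMap O (MvPowerSeries (Fin n) O ⧸ P)) := by
  intro y
  obtain ⟨p, rfl⟩ := Ideal.Quotient.mk_surjective y
  refine ⟨ε p, ?_⟩
  change Ideal.Quotient.mk P (algebraMap O _ (ε p)) = _
  rw [Ideal.Quotient.eq]
  apply hP
  rw [RingHom.mem_ker, map_sub, AlgHom.commutes, Algebra.algebraMap_self_apply, sub_self]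

/-- There are `n` relations of `B` that form a regular sequence on the ring `R/b`, where `R` is the
ring of power series, and that are congruent to `c ξ₁, …, c ξₙ` modulo the square of the ideal of
the translated variables `ξᵢ`. -/
theorem exists_relations_isWeaklyRegular [Nontrivial B] (hΦ : Function.Surjective Φ) {c : O}
    (hc : ∀ m : CotSpace π, c • m = 0) {b : Ideal (MvPowerSeries (Fin n) O)} (hb : b ≠ ⊤) {e : ℕ}
    (hdepth : ∃ l : List (MvPowerSeries (Fin n) O), l.length = n + e ∧
      (∀ r ∈ l, r ∈ maximalIdeal (MvPowerSeries (Fin n) O)) ∧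
      IsWeaklyRegular (MvPowerSeries (Fin n) O ⧸ b) l)
    (hdim : ∀ P : Ideal (MvPowerSeries (Fin n) O), P.IsPrime → b ≤ P →
      RingHom.ker (π.comp Φ) ≤ P ∨ RingHom.ker Φ ≤ P →
      ringKrullDim (MvPowerSeries (Fin n) O ⧸ P) ≤ e) :
    ∃ f : Fin n → MvPowerSeries (Fin n) O, (∀ a ∈ Ideal.span (Set.range f), Φ a = 0) ∧
      (∀ i, f i - MvPowerSeries.C c * augVar (π.comp Φ) i ∈ RingHom.ker (π.comp Φ) ^ 2) ∧
      IsWeaklyRegular (MvPowerSeries (Fin n) O ⧸ b) (List.ofFn f) := by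
  choose g hg hgc using exists_mem_ker_sub_mem_sq hΦ hc
  have hle : RingHom.ker Φ ≤ RingHom.ker (π.comp Φ) := fun a ha => by
    rw [RingHom.mem_ker, AlgHom.comp_apply, RingHom.mem_ker.mp ha, map_zero]
  have hΦm := le_maximalIdeal (RingHom.ker_ne_top Φ)
  have hH : RingHom.ker (π.comp Φ) * RingHom.ker Φ ≤ RingHom.ker Φ := Ideal.mul_le_right
  -- adding elements of `ker (π ∘ Φ) · ker Φ` changes neither property of the `gᵢ`, and a prime that
  -- contains this product contains one of its factors
  obtain ⟨h, hh, hreg⟩ := exists_add_isWeaklyRegular hb (hH.trans hΦm) hdepth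
    (fun P hP hbP hP' => hdim P hP hbP (hP.mul_le.mp hP')) g (fun i => hΦm (hg i))
  refine ⟨fun i => g i + h i, fun a ha => ?_, fun i => ?_, hreg⟩
  · refine (Ideal.span_le (I := RingHom.ker Φ)).mpr ?_ ha
    rintro _ ⟨i, rfl⟩
    exact (RingHom.ker Φ).add_mem (hg i) (hH (hh i))
  · rw [add_sub_right_comm, pow_two]
    rw [pow_two] at hgc
    exact (RingHom.ker (π.comp Φ) * _).add_mem (hgc i) (Ideal.mul_mono_right hle (hh i))

/-- A one-dimensional complete Noetherian local augmented `O`-algebra with a cotangent space of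
finite length has a complete intersection cover. -/
theorem exists_isCICover [IsLocalRing B] [IsNoetherianRing B] [IsAdicComplete (maximalIdeal B) B]
    (hdim : ringKrullDim B = 1) (π : B →ₐ[O] O) (hπ : IsFiniteLength O (CotSpace π)) :
    ∃ (A : Type u) (_ : CommRing A) (_ : Algebra O A) (φ : A →ₐ[O] B), IsCICover π φ := by
  obtain ⟨n, Φ, hΦ⟩ := exists_mvPowerSeries_algHom_surjective π
  obtain ⟨c, hc, hc0⟩ := IsFiniteLength.exists_smul_eq_zero hπ
  obtain ⟨t, ht⟩ := IsDiscreteValuationRing.exists_irreducible O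
  obtain ⟨f, hf, hfc, hreg⟩ := exists_relations_isWeaklyRegular hΦ hc0 (b := ⊥) bot_ne_top (e := 1)
    ⟨_, by simp, fun r hr => by
        rw [List.mem_append, List.mem_ofFn, List.mem_singleton] at hr
        rcases hr with ⟨i, rfl⟩ | rfl
        · exact augVar_mem_maximalIdeal (π.comp Φ) i
        · rw [← span_augVar_sup (π.comp Φ) ht]
          exact Ideal.mem_sup_right (Ideal.mem_span_singleton_self _),
      (isWeaklyRegular_quotient_bot_iff _).mpr (isWeaklyRegular_augVar_append (π.comp Φ) ht)⟩
    (fun P hP _ hle => by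
      rcases hle with h1 | h1
      · refine (ringKrullDim_le_of_surjective _
          (algebraMap_quotient_surjective (π.comp Φ) h1)).trans ?_
        rw [IsDiscreteValuationRing.ringKrullDim_eq_one O]
        rfl
      · refine (ringKrullDim_le_of_surjective _ (Ideal.Quotient.factor_surjective h1)).trans ?_
        rw [ringKrullDim_eq_of_ringEquiv
          (Ideal.quotientKerAlgEquivOfSurjective hΦ).toRingEquiv, hdim]
        rfl)
  exact ⟨MvPowerSeries (Fin n) O ⧸ Ideal.span (Set.range f), inferInstance, inferInstance,
    Ideal.Quotient.liftₐ _ Φ hf,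
    isCICover_liftₐ hΦ hc ((isWeaklyRegular_quotient_bot_iff _).mp hreg) hf hfc⟩

end Existence

section Finite

open RingTheory.Sequence

theorem isPrecomplete_pi {R : Type*} [CommRing R] (I : Ideal R) [IsPrecomplete I R] (d : ℕ) :
    IsPrecomplete I (Fin d → R) := by
  have hle : ∀ (n : ℕ) (x : Fin d → R),
      x ∈ (I ^ n • ⊤ : Submodule R (Fin d → R)) ↔ ∀ i, x i ∈ I ^ n := by
    intro n x
    constructor
    · intro hx i
      induction hx using Submodule.smul_induction_on' with
      | smul r hr y _ => exact Ideal.mul_mem_right _ _ hr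
      | add y _ z _ hy hz => exact add_mem hy hz
    · intro hx
      rw [pi_eq_sum_univ' x]
      exact sum_mem fun i _ => Submodule.smul_mem_smul (hx i) trivial
  refine ⟨fun f hf => ?_⟩
  have h1 : ∀ i, ∃ L, ∀ n, f n i ≡ L [SMOD I ^ n • (⊤ : Submodule R R)] := fun i =>
    IsPrecomplete.prec' (I := I) (fun n => f n i) fun {m n} hmn => by
      have h := hf hmn
      rw [SModEq.sub_mem, hle] at h
      rw [SModEq.sub_mem, smul_eq_mul, Ideal.mul_top]
      exact h i
  choose L hL using h1
  refine ⟨L, fun n => ?_⟩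
  rw [SModEq.sub_mem, hle]
  intro i
  have h := hL i n
  rwa [SModEq.sub_mem, smul_eq_mul, Ideal.mul_top] at h

variable {O : Type u} [CommRing O] {A : Type w} [CommRing A] [Algebra O A] [IsLocalRing A]

/-- Modules of finite length over a local augmented `O`-algebra are finitely generated over `O`, as
the residue field is a quotient of `O`. -/
theorem finite_of_isFiniteLength (χ : A →ₐ[O] O) [Nontrivial O] {M : Type*} [AddCommGroup M]
    [Module A M] [Module O M] [IsScalarTower O A M] (h : IsFiniteLength A M) :
    Module.Finite O M := by
  suffices H : ∀ (_ : Module O M) (_ : IsScalarTower O A M), Module.Finite O M from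
    H inferInstance inferInstance
  induction h with
  | of_subsingleton => intros; infer_instance
  | @of_simple_quotient M _ _ N hs _ ih =>
    intro _ _
    have h1 : Module.Finite O (N.restrictScalars O) :=
      ih (inferInstanceAs (Module O N)) (inferInstanceAs (IsScalarTower O A N))
    obtain ⟨I, hI, ⟨e⟩⟩ := isSimpleModule_iff_quot_maximal.mp hs
    have h2 : Module.Finite O (A ⧸ I) := by
      refine Module.Finite.of_surjective (Algebra.linearMap O (A ⧸ I)) fun y => ?_
      obtain ⟨a, rfl⟩ := Ideal.Quotient.mk_surjective y
      refine ⟨χ a, ?_⟩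
      change Ideal.Quotient.mk I (algebraMap O A (χ a)) = _
      rw [Ideal.Quotient.eq, IsLocalRing.eq_maximalIdeal hI]
      refine le_maximalIdeal (RingHom.ker_ne_top χ) ?_
      rw [RingHom.mem_ker, map_sub, AlgHom.commutes, Algebra.algebraMap_self_apply, sub_self]
    have h3 : Module.Finite O (M ⧸ N.restrictScalars O) :=
      Module.Finite.equiv (e.symm.restrictScalars O)
    exact Module.Finite.of_submodule_quotient (N.restrictScalars O)

variable [IsDomain O] [IsDiscreteValuationRing O]

/-- A Noetherian local augmented algebra over a complete discrete valuation ring is finite if it is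
finite modulo a uniformizer. -/
theorem finite_of_finite_quotient_span [IsAdicComplete (maximalIdeal O) O] [IsNoetherianRing A]
    (χ : A →ₐ[O] O) {t : O} (ht : Irreducible t)
    (h : Module.Finite O (A ⧸ Ideal.span {algebraMap O A t})) : Module.Finite O A := by
  obtain ⟨d, f, hf⟩ := Module.Finite.exists_fin' O (A ⧸ Ideal.span {algebraMap O A t})
  have := isPrecomplete_pi (maximalIdeal O) d
  have htm : t ∈ maximalIdeal O := (mem_maximalIdeal _).mpr ht.not_isUnit
  have hmap : (maximalIdeal O).map (algebraMap O A) ≤ maximalIdeal A := by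
    rw [Ideal.map_le_iff_le_comap]
    intro r hr
    rw [Ideal.mem_comap, mem_maximalIdeal, mem_nonunits_iff]
    intro hu
    have h1 := hu.map χ
    rw [AlgHom.commutes] at h1
    exact (mem_maximalIdeal _).mp hr h1
  have hhaus : IsHausdorff (maximalIdeal O) A := by
    refine ⟨fun x hx => IsHausdorff.haus (I := maximalIdeal A) inferInstance x fun n => ?_⟩
    have h1 := hx n
    rw [SModEq.zero] at h1
    rw [SModEq.zero, smul_eq_mul, Ideal.mul_top]
    have h2 : (maximalIdeal O ^ n • ⊤ : Submodule O A) ≤ (maximalIdeal A ^ n).restrictScalars O := by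
      rw [Submodule.smul_le]
      intro r hr a _
      rw [Algebra.smul_def]
      refine Ideal.mul_mem_right _ _ (Ideal.pow_right_mono hmap n ?_)
      rw [← Ideal.map_pow]
      exact Ideal.mem_map_of_mem _ hr
    exact h2 h1
  choose a ha using fun i => Ideal.Quotient.mk_surjective (f (Pi.single i 1))
  let F : (Fin d → O) →ₗ[O] A := Fintype.linearCombination O a
  refine Module.Finite.of_surjective F (surjective_of_mkQ_comp_surjective (I := maximalIdeal O) ?_)
  intro y
  obtain ⟨y, rfl⟩ := Submodule.mkQ_surjective _ y
  obtain ⟨v, hv⟩ := hf (Ideal.Quotient.mk _ y)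
  refine ⟨v, ?_⟩
  have h1 : Ideal.Quotient.mk (Ideal.span {algebraMap O A t}) (F v) = f v := by
    conv_rhs => rw [pi_eq_sum_univ' v, map_sum]
    rw [Fintype.linearCombination_apply, map_sum]
    refine Finset.sum_congr rfl fun i _ => ?_
    rw [f.map_smul, ← ha]
    rfl
  rw [hv, Ideal.Quotient.eq, Ideal.mem_span_singleton'] at h1
  obtain ⟨z, hz⟩ := h1
  rw [LinearMap.comp_apply, Submodule.mkQ_apply, Submodule.mkQ_apply, Submodule.Quotient.eq, ← hz,
    mul_comm, ← Algebra.smul_def]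
  exact Submodule.smul_mem_smul htm trivial

theorem isTorsionFree_of_uniformizer {A : Type w} [CommRing A] [Algebra O A] {t : O}
    (ht : Irreducible t) (h : algebraMap O A t ∈ nonZeroDivisors A) : Module.IsTorsionFree O A := by
  refine ⟨fun r hr => ?_⟩
  obtain ⟨n, u, rfl⟩ := IsDiscreteValuationRing.eq_unit_mul_pow_irreducible hr.ne_zero ht
  intro x y hxy
  simp only [Algebra.smul_def, map_mul, map_pow, mul_assoc] at hxy
  have h1 := (u.isUnit.map (algebraMap O A)).mul_left_cancel hxy
  exact (mul_cancel_left_mem_nonZeroDivisors (pow_mem h n)).mp h1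

end Finite

section FiniteFree

open RingTheory.Sequence

variable {O : Type u} [CommRing O] [IsDomain O] [IsDiscreteValuationRing O]
  {B : Type v} [CommRing B] [Algebra O B]

/-- If `B` is finite over `O`, it has a complete intersection cover that is finite and free
over `O`: the relations are chosen to be regular modulo the uniformizer. -/
theorem exists_isCICover_finite_free [IsAdicComplete (maximalIdeal O) O] [IsLocalRing B]
    [IsNoetherianRing B] [IsAdicComplete (maximalIdeal B) B] [Module.Finite O B]
    (π : B →ₐ[O] O) (hπ : IsFiniteLength O (CotSpace π)) :
    ∃ (A : Type u) (_ : CommRing A) (_ : Algebra O A) (φ : A →ₐ[O] B),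
      IsCICover π φ ∧ Module.Finite O A ∧ Module.Free O A := by
  obtain ⟨n, Φ, hΦ⟩ := exists_mvPowerSeries_algHom_surjective π
  obtain ⟨c, hc, hc0⟩ := IsFiniteLength.exists_smul_eq_zero hπ
  obtain ⟨t, ht⟩ := IsDiscreteValuationRing.exists_irreducible O
  set R := MvPowerSeries (Fin n) O with hR
  set ct : R := MvPowerSeries.C t with hct
  have hctm : ct ∈ maximalIdeal R := by
    rw [← span_augVar_sup (π.comp Φ) ht]
    exact Ideal.mem_sup_right (Ideal.mem_span_singleton_self _)
  have hseq : IsWeaklyRegular (R ⧸ (⊥ : Ideal R)) (ct :: List.ofFn (augVar (π.comp Φ))) :=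
    IsWeaklyRegular.perm_mod
      ((isWeaklyRegular_quotient_bot_iff _).mpr (isWeaklyRegular_augVar_append (π.comp Φ) ht))
      (List.perm_append_singleton _ _) fun r hr => by
        rw [List.mem_append, List.mem_ofFn, List.mem_singleton] at hr
        rcases hr with ⟨i, rfl⟩ | rfl
        · exact augVar_mem_maximalIdeal (π.comp Φ) i
        · exact hctm
  rw [isWeaklyRegular_quotient_cons_iff] at hseq
  have hb : (⊥ ⊔ Ideal.span {ct} : Ideal R) ≠ ⊤ := by
    refine ne_top_of_le_ne_top (maximalIdeal.isMaximal R).ne_top (sup_le bot_le ?_)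
    rwa [Ideal.span_singleton_le_iff_mem]
  obtain ⟨f, hf, hfc, hreg⟩ := exists_relations_isWeaklyRegular hΦ hc0 hb (e := 0)
    ⟨_, by simp, fun r hr => by
        rw [List.mem_ofFn] at hr
        obtain ⟨i, rfl⟩ := hr
        exact augVar_mem_maximalIdeal (π.comp Φ) i, hseq.2⟩
    (fun P hP hbP hle => by
      have hctP : ct ∈ P :=
        hbP (Ideal.mem_sup_right (Ideal.mem_span_singleton_self _))
      refine (ringKrullDim_eq_zero_of_isField
        ((Ideal.Quotient.maximal_ideal_iff_isField_quotient P).mp ?_)).le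
      rcases hle with h1 | h1
      · -- `P` contains `t` and the translated variables
        have h2 : maximalIdeal R ≤ P := by
          rw [← span_augVar_sup (π.comp Φ) ht, ← ker_aug_eq_span_augVar]
          refine sup_le h1 ?_
          rwa [Ideal.span_singleton_le_iff_mem]
        rw [le_antisymm (le_maximalIdeal hP.ne_top) h2]
        exact maximalIdeal.isMaximal R
      · -- `R/P` is finite over the field `O/t`
        have hfin : Module.Finite O (R ⧸ P) := by
          have h2 : Module.Finite O (R ⧸ RingHom.ker Φ) :=
            Module.Finite.equiv (Ideal.quotientKerAlgEquivOfSurjective hΦ).symm.toLinearEquiv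
          exact Module.Finite.of_surjective (Ideal.Quotient.factorₐ O h1).toLinearMap
            (Ideal.Quotient.factor_surjective h1)
        have hmax : ((⊥ : Ideal (R ⧸ P)).comap (algebraMap O (R ⧸ P))).IsMaximal := by
          have h2 : maximalIdeal O ≤ (⊥ : Ideal (R ⧸ P)).comap (algebraMap O (R ⧸ P)) := by
            rw [ht.maximalIdeal_eq, Ideal.span_singleton_le_iff_mem, Ideal.mem_comap, Ideal.mem_bot]
            exact Ideal.Quotient.eq_zero_iff_mem.mpr hctP
          rw [← (maximalIdeal.isMaximal O).eq_of_le
            (Ideal.comap_ne_top _ bot_ne_top) h2]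
          exact maximalIdeal.isMaximal O
        have h3 := Ideal.isMaximal_of_isIntegral_of_isMaximal_comap (⊥ : Ideal (R ⧸ P)) hmax
        have h4 := Ideal.comap_isMaximal_of_surjective (Ideal.Quotient.mk P)
          Ideal.Quotient.mk_surjective (K := ⊥)
        rwa [← RingHom.ker_eq_comap_bot, Ideal.mk_ker] at h4)
  have hfm : ∀ r ∈ List.ofFn f, r ∈ maximalIdeal R := by
    intro r hr
    rw [List.mem_ofFn] at hr
    exact le_maximalIdeal (RingHom.ker_ne_top Φ) (hf r (Ideal.subset_span hr))
  -- by permutation, `f` is regular and `t` is regular on `R/(f)`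
  have hreg2 : IsWeaklyRegular (R ⧸ (⊥ : Ideal R)) (ct :: List.ofFn f) := by
    rw [isWeaklyRegular_quotient_cons_iff]
    exact ⟨hseq.1, hreg⟩
  have hreg3 := IsWeaklyRegular.perm_mod hreg2 (List.perm_append_singleton _ _).symm
    (fun r hr => by
      rcases List.mem_cons.mp hr with rfl | hr
      · exact hctm
      · exact hfm r hr)
  rw [isWeaklyRegular_quotient_append_iff, isWeaklyRegular_quotient_singleton_iff, bot_sup_eq,
    ofList_ofFn, isWeaklyRegular_quotient_bot_iff] at hreg3
  have hcov := isCICover_liftₐ hΦ hc hreg3.1 hf hfc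
  have hnt : Nontrivial (R ⧸ Ideal.span (Set.range f)) :=
    (Ideal.Quotient.lift_surjective_of_surjective _ hf hΦ).nontrivial
  have hloc : IsLocalRing (R ⧸ Ideal.span (Set.range f)) :=
    IsLocalRing.of_surjective' _ Ideal.Quotient.mk_surjective
  have hnzd : algebraMap O (R ⧸ Ideal.span (Set.range f)) t ∈
      nonZeroDivisors (R ⧸ Ideal.span (Set.range f)) := by
    rw [mem_nonZeroDivisors_iff_right]
    intro y hy
    obtain ⟨p, rfl⟩ := Ideal.Quotient.mk_surjective y
    exact Ideal.Quotient.eq_zero_iff_mem.mpr (hreg3.2 p (Ideal.Quotient.eq_zero_iff_mem.mp hy))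
  have hdim : Ring.KrullDimLE 1 (R ⧸ Ideal.span (Set.range f)) :=
    Ring.krullDimLE_iff.mpr (le_of_eq hcov.dim_eq_one)
  have hfin := finite_of_finite_quotient_span
    (π.comp (Ideal.Quotient.liftₐ (Ideal.span (Set.range f)) Φ hf)) ht
    (finite_of_isFiniteLength (π.comp (Ideal.Quotient.liftₐ (Ideal.span (Set.range f)) Φ hf))
      (isFiniteLength_quotient_span_singleton _ hnzd))
  have htf := isTorsionFree_of_uniformizer ht hnzd
  exact ⟨R ⧸ Ideal.span (Set.range f), inferInstance, inferInstance, _, hcov, hfin,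
    Module.free_of_finite_type_torsion_free'⟩

end FiniteFree

/-! ### The Wiles defect -/

section Counting

variable {O : Type u} [CommRing O]

/-- A module of finite length over a local ring whose residue field has `q` elements has `q ^ ℓ`
elements, where `ℓ` is the length. -/
theorem finite_and_card_of_isFiniteLength [IsLocalRing O] [Finite (ResidueField O)] {N : Type*}
    [AddCommGroup N] [Module O N] (h : IsFiniteLength O N) :
    Finite N ∧ Nat.card N = Nat.card (ResidueField O) ^ (Module.length O N).toNat := by
  induction h with
  | of_subsingleton => exact ⟨inferInstance, by simp⟩
  | @of_simple_quotient M _ _ N hs hN ih =>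
    obtain ⟨h1, h2⟩ := ih
    obtain ⟨I, hI, ⟨e⟩⟩ := isSimpleModule_iff_quot_maximal.mp hs
    obtain rfl := IsLocalRing.eq_maximalIdeal hI
    have hfin : Finite (O ⧸ maximalIdeal O) := inferInstanceAs (Finite (ResidueField O))
    have hfin2 : Finite (M ⧸ N) := Finite.of_equiv _ e.symm.toEquiv
    have hc : Nat.card (M ⧸ N) = Nat.card (ResidueField O) := Nat.card_congr e.toEquiv
    have hl : Module.length O M = Module.length O N + 1 := by
      rw [Module.length_eq_add_of_exact N.subtype N.mkQ N.injective_subtype N.mkQ_surjective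
        (LinearMap.exact_subtype_mkQ N), Module.length_eq_one (R := O) (M := M ⧸ N)]
    have hcard : Nat.card M = Nat.card (ResidueField O) ^ (Module.length O M).toNat := by
      rw [Submodule.card_eq_card_quotient_mul_card N, h2, hc, hl, ENat.toNat_add
        (Module.length_ne_top_iff.mpr hN) ENat.one_ne_top, pow_add, ENat.toNat_one, pow_one, mul_comm]
    refine ⟨Nat.finite_of_card_ne_zero ?_, hcard⟩
    rw [hcard]
    exact pow_ne_zero _ Nat.card_pos.ne'

variable [IsDomain O] [IsDiscreteValuationRing O] {B : Type v} [CommRing B] [Algebra O B]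

/-- In a local ring `B` that is finite over `O`, a power of the maximal ideal is contained in the
ideal generated by a uniformizer of `O`. -/
theorem exists_maximalIdeal_pow_le_span [IsLocalRing B] [IsNoetherianRing B] [Module.Finite O B]
    {t : O} (ht : Irreducible t) :
    ∃ k, maximalIdeal B ^ k ≤ Ideal.span {algebraMap O B t} := by
  refine Ideal.exists_pow_le_of_le_radical_of_fg ?_ (IsNoetherian.noetherian _)
  rw [Ideal.radical_eq_sInf]
  refine le_sInf fun P hP => ?_
  have hPp : P.IsPrime := hP.2
  have h1 : maximalIdeal O ≤ P.comap (algebraMap O B) := by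
    rw [ht.maximalIdeal_eq, Ideal.span_singleton_le_iff_mem, Ideal.mem_comap]
    exact hP.1 (Ideal.mem_span_singleton_self _)
  have h2 : (P.comap (algebraMap O B)).IsMaximal := by
    rw [← (maximalIdeal.isMaximal O).eq_of_le (Ideal.comap_ne_top _ hPp.ne_top) h1]
    exact maximalIdeal.isMaximal O
  exact (IsLocalRing.eq_maximalIdeal
    (Ideal.isMaximal_of_isIntegral_of_isMaximal_comap P h2)).ge

/-- If `B` is finite over `O`, its largest torsion-free quotient is its largest Cohen–Macaulay
quotient. -/
theorem torsionIdeal_eq_cmKernel [IsLocalRing B] [IsNoetherianRing B] [Module.Finite O B]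
    (π : B →ₐ[O] O) : torsionIdeal O B = cmKernel B := by
  obtain ⟨t, ht⟩ := IsDiscreteValuationRing.exists_irreducible O
  have htm : algebraMap O B t ∈ maximalIdeal B := by
    rw [mem_maximalIdeal, mem_nonunits_iff]
    intro h
    have h1 := h.map π
    rw [AlgHom.commutes] at h1
    exact ht.not_isUnit h1
  apply le_antisymm
  · rintro b ⟨⟨r, hr⟩, h⟩
    obtain ⟨n, e, rfl⟩ :=
      IsDiscreteValuationRing.eq_unit_mul_pow_irreducible (nonZeroDivisors.ne_zero hr) ht
    have h0 : algebraMap O B t ^ n * b = 0 := by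
      have h1 : ((e : O) * t ^ n) • b = 0 := h
      rw [Algebra.smul_def, map_mul, map_pow, mul_assoc] at h1
      exact (e.isUnit.map (algebraMap O B)).mul_right_eq_zero.mp h1
    obtain ⟨k, hk⟩ := exists_maximalIdeal_pow_le_span (B := B) ht
    refine ⟨k * n, fun a ha => ?_⟩
    rw [pow_mul] at ha
    have h2 := Ideal.pow_right_mono hk n ha
    rw [Ideal.span_singleton_pow, Ideal.mem_span_singleton'] at h2
    obtain ⟨z, rfl⟩ := h2
    rw [mul_assoc, h0, mul_zero]
  · rintro b ⟨n, hn⟩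
    refine ⟨⟨t ^ n, mem_nonZeroDivisors_of_ne_zero (pow_ne_zero _ ht.ne_zero)⟩, ?_⟩
    have h := hn _ (Ideal.pow_mem_pow htm n)
    rw [← map_pow, ← Algebra.smul_def] at h
    exact h

theorem congruenceIdeal_quotAug_congr {O : Type u} [CommRing O] {B : Type v} [CommRing B]
    [Algebra O B] {π : B →ₐ[O] O} {I J : Ideal B} (h : I = J)
    (hI : I ≤ RingHom.ker π) (hJ : J ≤ RingHom.ker π) :
    congruenceIdeal (quotAug π I hI) = congruenceIdeal (quotAug π J hJ) := by
  subst h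
  rfl

end Counting

end WilesDefect

end

theorem mainTheorem7 {O : Type u} {B : Type v}
    [CommRing O] [IsDomain O] [IsDiscreteValuationRing O] [IsAdicComplete (maximalIdeal O) O]
    [CommRing B] [IsLocalRing B] [IsNoetherianRing B] [IsAdicComplete (maximalIdeal B) B]
    [Algebra O B] (hdim : ringKrullDim B = 1)
    (π : B →ₐ[O] O) (hπ : IsFiniteLength O (CotSpace π)) :
    -- complete intersection covers exist, finite free ones if `B` is finite over `O`
    (∃ (A : Type u) (_ : CommRing A) (_ : Algebra O A) (φ : A →ₐ[O] B),
      IsCICover π φ ∧ (Module.Finite O B → Module.Finite O A ∧ Module.Free O A)) ∧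
    -- the invariants that do not involve a cover are finite
    IsFiniteLength O (C0 π) ∧
    IsFiniteLength O (Der0 O B (EModO π)) ∧
    IsFiniteLength O (Der1 O B (EModO π)) ∧
    -- the formula, for every cover and all generators of the kernel
    (∀ (A : Type w) [CommRing A] [Algebra O A] (φ : A →ₐ[O] B), IsCICover π φ →
      ∀ (d : ℕ) (x : Fin d → A), Ideal.span (Set.range x) = RingHom.ker φ →
        c1 (π.comp φ) x ≠ ⊤ ∧
        Module.length O (C1 (π.comp φ) x) = c1 (π.comp φ) x ∧
        ((Module.length O (C0 π)).toNat : ℤ) - ((c1 (π.comp φ) x).toNat : ℤ) =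
          ((Module.length O (Der0 O B (EModO π))).toNat : ℤ) -
            ((Module.length O (Der1 O B (EModO π))).toNat : ℤ)) ∧
    -- the form with the Wiles defect
    (∀ p : ℕ, p.Prime → CharZero O → Finite (ResidueField O) → CharP (ResidueField O) p →
      Module.Finite O B →
      ∀ (A : Type w) [CommRing A] [Algebra O A] (φ : A →ₐ[O] B), IsCICover π φ →
      ∀ (d : ℕ) (x : Fin d → A), Ideal.span (Set.range x) = RingHom.ker φ →
        Finite (Der1 O B (EModO π)) ∧ Finite (C1 (π.comp φ) x) ∧
        Finite (CotSpace π) ∧ Finite (CongruenceModule π) ∧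
        (Nat.card (Der1 O B (EModO π)) : ℚ) / (Nat.card (C1 (π.comp φ) x) : ℚ) =
          (Nat.card (CotSpace π) : ℚ) / (Nat.card (CongruenceModule π) : ℚ) ∧
        wilesDefect p π =
          (Real.log (Nat.card (Der1 O B (EModO π))) - Real.log (Nat.card (C1 (π.comp φ) x))) /
            Real.log (Nat.card (O ⧸ Ideal.span {(p : O)})) ∧
        wilesDefect p π =
          (((Module.length O (Der1 O B (EModO π))).toNat : ℝ) -
              ((Module.length O (C1 (π.comp φ) x)).toNat : ℝ)) /
            ((Module.length O (O ⧸ Ideal.span {(p : O)})).toNat : ℝ)) := by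
  have hfree : ∃ (A : Type u) (_ : CommRing A) (_ : Algebra O A) (φ : A →ₐ[O] B),
      IsCICover π φ ∧ (Module.Finite O B → Module.Finite O A ∧ Module.Free O A) := by
    by_cases hB : Module.Finite O B
    · obtain ⟨A, _, _, φ, h1, h2⟩ := exists_isCICover_finite_free π hπ
      exact ⟨A, _, _, φ, h1, fun _ => h2⟩
    · obtain ⟨A, _, _, φ, h⟩ := exists_isCICover hdim π hπ
      exact ⟨A, _, _, φ, h, fun h' => absurd h' hB⟩
  have hfin : IsFiniteLength O (C0 π) ∧ IsFiniteLength O (Der0 O B (EModO π)) ∧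
      IsFiniteLength O (Der1 O B (EModO π)) := by
    obtain ⟨A, _, _, φ, h, -⟩ := hfree
    obtain ⟨c⟩ := h.nonempty_ciPresentation
    have := c.isNoetherianRing
    obtain ⟨d, x, hx⟩ := Submodule.fg_iff_exists_fin_generating_family.mp
      (IsNoetherian.noetherian (RingHom.ker φ))
    obtain ⟨h1, h2, h3, -⟩ := h.length_formula hdim hπ hx
    exact ⟨h1, h2, h3⟩
  -- the formula, with natural numbers
  have hformula : ∀ (A : Type w) [CommRing A] [Algebra O A] (φ : A →ₐ[O] B), IsCICover π φ →
      ∀ (d : ℕ) (x : Fin d → A), Ideal.span (Set.range x) = RingHom.ker φ →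
        IsFiniteLength O (C1 (π.comp φ) x) ∧
        (Module.length O (C0 π)).toNat + (Module.length O (Der1 O B (EModO π))).toNat =
          (Module.length O (Der0 O B (EModO π))).toNat +
            (Module.length O (C1 (π.comp φ) x)).toNat := by
    intro A _ _ φ h d x hx
    obtain ⟨h1, h2, h3, h4, h5⟩ := h.length_formula hdim hπ hx
    refine ⟨h4, ?_⟩
    rw [← ENat.toNat_add (Module.length_ne_top_iff.mpr h1) (Module.length_ne_top_iff.mpr h3),
      ← ENat.toNat_add (Module.length_ne_top_iff.mpr h2) (Module.length_ne_top_iff.mpr h4), h5]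
  refine ⟨hfree, hfin.1, hfin.2.1, hfin.2.2, ?_, ?_⟩
  · intro A _ _ φ h d x hx
    obtain ⟨h1, h2⟩ := hformula A φ h d x hx
    rw [c1_eq_length_C1]
    refine ⟨Module.length_ne_top_iff.mpr h1, rfl, ?_⟩
    omega
  · intro p hp _ _ _ _ A _ _ φ h d x hx
    obtain ⟨h1, h2⟩ := hformula A φ h d x hx
    have hΨ : congruenceIdeal (quotAug π (torsionIdeal O B) (torsionIdeal_le_ker π)) =
        congruenceIdeal (quotAug π (cmKernel B) (cmKernel_le_ker π)) :=
      congruenceIdeal_quotAug_congr (torsionIdeal_eq_cmKernel π) _ _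
    have hΨfin : IsFiniteLength O (CongruenceModule π) := by
      change IsFiniteLength O (O ⧸ congruenceIdeal (quotAug π (torsionIdeal O B) _))
      rw [hΨ]
      exact hfin.1
    have hΨlen : Module.length O (CongruenceModule π) = Module.length O (C0 π) := by
      change Module.length O (O ⧸ congruenceIdeal (quotAug π (torsionIdeal O B) _)) = _
      rw [hΨ]
    have hp0 : (p : O) ≠ 0 := Nat.cast_ne_zero.mpr hp.ne_zero
    have hOp : IsFiniteLength O (O ⧸ Ideal.span {(p : O)}) :=
      isFiniteLength_quotient_span_singleton O (mem_nonZeroDivisors_of_ne_zero hp0)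
    obtain ⟨f1, c1⟩ := finite_and_card_of_isFiniteLength hfin.2.2
    obtain ⟨f2, c2⟩ := finite_and_card_of_isFiniteLength h1
    obtain ⟨f3, c3⟩ := finite_and_card_of_isFiniteLength hπ
    obtain ⟨f4, c4⟩ := finite_and_card_of_isFiniteLength hΨfin
    obtain ⟨f5, c5⟩ := finite_and_card_of_isFiniteLength hOp
    rw [length_derZero hπ, ← hΨlen] at h2
    have hq : 1 < Nat.card (ResidueField O) := Finite.one_lt_card
    have hlogq : Real.log (Nat.card (ResidueField O)) ≠ 0 :=
      (Real.log_pos (by exact_mod_cast hq)).ne'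
    have hδ : wilesDefect p π =
        (((Module.length O (Der1 O B (EModO π))).toNat : ℝ) -
            ((Module.length O (C1 (π.comp φ) x)).toNat : ℝ)) /
          ((Module.length O (O ⧸ Ideal.span {(p : O)})).toNat : ℝ) := by
      have h3 : ((Module.length O (CongruenceModule π)).toNat : ℝ) +
          ((Module.length O (Der1 O B (EModO π))).toNat : ℝ) =
            ((Module.length O (CotSpace π)).toNat : ℝ) +
              ((Module.length O (C1 (π.comp φ) x)).toNat : ℝ) := by exact_mod_cast h2
      rw [wilesDefect]
      congr 1
      linarith
    refine ⟨f1, f2, f3, f4, ?_, ?_, hδ⟩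
    · have hq0 : (Nat.card (ResidueField O) : ℚ) ≠ 0 := by
        exact_mod_cast (zero_lt_one.trans hq).ne'
      rw [c1, c2, c3, c4]
      push_cast
      rw [div_eq_div_iff (pow_ne_zero _ hq0) (pow_ne_zero _ hq0), ← pow_add, ← pow_add, add_comm, h2]
    · rw [hδ, c1, c2, c5]
      push_cast
      rw [Real.log_pow, Real.log_pow, Real.log_pow, ← sub_mul, mul_div_mul_right _ _ hlogq]
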